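/- Let $\mathbb N=\{0,1,2,\dots\}$. For a probability measure $\mu$ on $\mathbb Z$ write $\hat\mu(\theta)=\sum_{n\in\mathbb Z}\mu(n)e^{in\theta}$ for $\theta\in\mathbb R$. We say that $\mu$ is *centered* if $\sum_n|n|\mu(n)<\infty$ and $\sum_n n\mu(n)=0$; that $\mu$ is *strictly aperiodic* if $|\hat\mu(\theta)|<1$ for all $\theta\in(0,2\pi)$; and that $\mu$ has *bounded angular ratio* (BAR) if it is strictly aperiodic and $\sup_{\theta\in(0,2\pi)}\frac{|1-\hat\mu(\theta)|}{1-|\hat\mu(\theta)|}<\infty$. A real sequence $(t_n)_{n\in\mathbb N}$ is *completely monotone* if $(\Delta^m t)_n\ge 0$ for all $m,n\in\mathbb N$, where $(\Delta t)_n=t_n-t_{n+1}$. Let $\mathcal R$ be the set of probability measures $\mu$ on $\mathbb Z$ with $\sup_{n\ge1}n\,\|\mu^{*n}-\mu^{*(n+1)}\|_{\ell^1(\mathbb Z)}<\infty$. Let $\mathcal H$ be the set of probability measures $\mu$ on $\mathbb Z$ such that $\hat\mu$ is twice continuously differentiable at (i.e. in a neighbourhood in $\mathbb R$ of) every point of $[-\pi,\pi]\setminus\{0\}$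 and there exist an even continuous function $\psi:[-\pi,\pi]\to\mathbb R$ with $\psi(0)=0$, continuously differentiable on $[-\pi,\pi]\setminus\{0\}$ (with one-sided derivatives at $\pm\pi$), and constants $c,C>0$ such that for every $\theta\in(0,\pi]$: $|\hat\mu(\theta)|\le1-c\,\psi(\theta)$, $|\theta\hat\mu'(\theta)|\le C\psi(\theta)$, $|\hat\mu'(\theta)|\le C\psi'(\theta)$ and $|\theta\hat\mu''(\theta)|\le C\psi'(\theta)$. **Theorem.** Let $\mu\ne\delta_0$ be a centered probability measure on $\mathbb Z$ supported on $\{-1\}\cup\mathbb N$ such that $(\mu(n))_{n\in\mathbb N}$ is completely monotone. Then: (i) $\mu$ has BAR if and only if there exists $C>0$ such that $$n\sum_{k\ge n}k\mu(k)\le C\sum_{k=1}^n k^2\mu(k)\qquad\text{for all integers } n\ge1 .$$ (ii) Assume that $\mu$ has BAR. Let $\sigma$ be a centered probability measure on $\mathbb Z$ such that $\sum_{n\in\mathbb Z}n^2|\sigma(n)-c\mu(n)|<\infty$ for some $c>0$; if $\sum_{n\in\mathbb Z} n^2\sigma(n)<\infty$, assume also that $\sigma$ is strictly aperiodic. Then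 $\sigma\in\mathcal H\cap\mathcal R$. In particular, $\mu\in\mathcal H\cap\mathcal R$. -/

import Mathlib

open MeasureTheory

namespace IntProb

noncomputable section

/-- The mass `μ(n)` that a measure on `ℤ` gives to the integer `n`. -/
def mass (μ : Measure ℤ) (n : ℤ) : ℝ := μ.real {n}

/-- The Fourier transform `θ ↦ ∑ₙ μ(n) e^{inθ}` (an absolutely convergent series for every finite
measure), regarded as a `2π`-periodic function on the whole real line. -/
def hat (μ : Measure ℤ) (θ : ℝ) : ℂ :=
  ∑' n : ℤ, (mass μ n : ℂ) * Complex.exp (((n : ℝ) * θ : ℝ) * Complex.I)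

/-- Finite first moment and mean zero. -/
def Centered (μ : Measure ℤ) : Prop :=
  Summable (fun n : ℤ => |(n : ℝ)| * mass μ n) ∧ ∑' n : ℤ, (n : ℝ) * mass μ n = 0

/-- Finite second moment. -/
def HasSecondMoment (μ : Measure ℤ) : Prop :=
  Summable (fun n : ℤ => (n : ℝ) ^ 2 * mass μ n)

/-- The difference operator `(Δt)ₙ = tₙ - tₙ₊₁`. -/
def diffOp (t : ℕ → ℝ) : ℕ → ℝ := fun n => t n - t (n + 1)

/-- All the iterated differences `Δᵐt`, `m ≥ 0`, are non-negative sequences. -/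
def CompletelyMonotone (t : ℕ → ℝ) : Prop :=
  ∀ m n : ℕ, 0 ≤ (diffOp^[m] t) n

def StrictlyAperiodic (μ : Measure ℤ) : Prop :=
  ∀ θ ∈ Set.Ioo (0 : ℝ) (2 * Real.pi), ‖hat μ θ‖ < 1

/-- Bounded angular ratio. -/
def BAR (μ : Measure ℤ) : Prop :=
  StrictlyAperiodic μ ∧
    BddAbove ((fun θ : ℝ => ‖1 - hat μ θ‖ / (1 - ‖hat μ θ‖)) '' Set.Ioo (0 : ℝ) (2 * Real.pi))

/-- Convolution powers: `μ^{*0} = δ₀` and `μ^{*(n+1)} = μ * μ^{*n}`. -/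
def convPow (μ : Measure ℤ) : ℕ → Measure ℤ
  | 0 => Measure.dirac 0
  | n + 1 => Measure.conv μ (convPow μ n)

/-- The set of Ritt probability measures:
`sup_{n ≥ 1} n ‖μ^{*n} - μ^{*(n+1)}‖_{ℓ¹(ℤ)} < ∞`. -/
def rittSet : Set (ProbabilityMeasure ℤ) :=
  {μ | ∃ C : ℝ, ∀ n : ℕ, 1 ≤ n →
    (n : ℝ) * ∑' k : ℤ, |mass (convPow μ n) k - mass (convPow μ (n + 1)) k| ≤ C}

/-- `[-π, π] \ {0}`. -/
def puncturedInterval : Set ℝ := Set.Icc (-Real.pi) Real.pi \ {0}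

/-- The set of probability measures satisfying hypothesis (H). The Fourier transform is a function
on `ℝ`, so its derivatives at the points of `[-π, π] \ {0}` are ordinary two-sided ones; the
function `ψ` is only considered on `[-π, π]`, so its derivative at `π` is the one-sided one. -/
def hypHSet : Set (ProbabilityMeasure ℤ) :=
  {μ | (∀ θ ∈ puncturedInterval, ContDiffAt ℝ 2 (hat μ) θ) ∧
    ∃ ψ : ℝ → ℝ,
      (∀ θ ∈ Set.Icc (-Real.pi) Real.pi, ψ (-θ) = ψ θ) ∧
      ContinuousOn ψ (Set.Icc (-Real.pi) Real.pi) ∧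
      ψ 0 = 0 ∧
      ContDiffOn ℝ 1 ψ puncturedInterval ∧
      ∃ c C : ℝ, 0 < c ∧ 0 < C ∧
        ∀ θ ∈ Set.Ioc (0 : ℝ) Real.pi,
          ‖hat μ θ‖ ≤ 1 - c * ψ θ ∧
          ‖(θ : ℂ) * deriv (hat μ) θ‖ ≤ C * ψ θ ∧
          ‖deriv (hat μ) θ‖ ≤ C * derivWithin ψ puncturedInterval θ ∧
          ‖(θ : ℂ) * deriv (deriv (hat μ)) θ‖ ≤ C * derivWithin ψ puncturedInterval θ}

end

end IntProb

namespace IntProb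

noncomputable section

open Filter Topology Finset

/-! Everything rests on one integral formula. The iterated tails `a n = ∑_{k > n} (k - n) μ(k)` have
the shifted sequence `μ(n + 1)` as second difference, so they are again completely monotone, and
they tend to `0`. By Hausdorff's theorem they are the moments of a finite measure `m` on `[0, 1)`.
Centering says `a 0 = μ(-1)`, and summing geometric series gives, with `z = e^{iθ} ≠ 1`, `1 - hat μ
θ = |1 - z|² G(z)`, where `G(z) = ∫ (1 - t z)⁻¹ dm(t)` (`exists_isRepresentedBy`).

Since `|1 - t z|` is comparable to `1 - t + θ` for `0 < θ ≤ π`, the size of `G` is governed by `R(θ)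
= ∫ (1 - t + θ)⁻¹ dm` (`stieltjesInt m 0`), and its real part, up to an error `θ R(θ)`, by `S(θ) = ∫
(1 - t)(1 - t + θ)⁻² dm` (`stieltjesRe`). BAR means that `|1 - hat μ|` is controlled by its real
part near `0`, that is, `R ≤ K S` there (`Comparable`). The truncated second moments and the tails
of the first moment are also integrals against `m`, of explicit polynomial kernels, and pointwise
inequalities between these kernels and those of `R` and `S` at the scale `θ ~ 1/n` show that
`Comparable` is equivalent to the tail condition. The delicate inequality is `tailKernel_le`, in
which the hypothesis `R ≤ K S` enters as a kernel with nonpositive integral.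

For (ii) the function `ψ(θ) = θ² R(|θ|)` (`majorant`) dominates `1 - hat μ`, `θ` times its
derivative and `θ²` times its second derivative. It satisfies `ψ ≤ θ ψ'`, and under `Comparable`
also `Re (1 - hat μ) ≥ const · ψ` near `0`. Passing to `σ` adds to `c μ` a term whose transform is
`O(θ²)` after subtracting its value at `0`, because both measures are centered; as `ψ ≥ const · θ²`,
upper bounds survive. The lower bound survives because either `μ` has a second moment and `ψ` is
comparable to `θ²`, or `R → ∞` at `0` and the perturbation is negligible. Away from `0`, strict
aperiodicity and compactness suffice. This gives (H).

For the Ritt property, the `ℓ¹` norm of `σ^{*n} - σ^{*(n+1)}` is the sum of the absolute Fourier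
coefficients of `g = f^n (1 - f)`, `f = hat σ`. A Carlson inequality bounds it by the `L²` norms of
`g` and `g'` weighted by a scale `a`; choosing `a` with `ψ(a) = ψ(π)/n`, both `n |g|` and `n a |g'|`
are `O(min(1, a/θ))`, and the powers of `a` cancel (`IsMajorant.mem_rittSet`). -/

/-! ### Hausdorff's moment theorem through Bernstein measures -/

lemma diffOp_iterate_succ (a : ℕ → ℝ) (j i : ℕ) :
    (diffOp^[j + 1] a) i = (diffOp^[j] a) i - (diffOp^[j] a) (i + 1) := by
  rw [Function.iterate_succ_apply']; rfl

/-- Binomial expansion of `(Δ + S)^N = 1`, where `S` is the shift and `Δ = 1 - S`. -/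
lemma sum_choose_mul_diffOp (a : ℕ → ℝ) (N k : ℕ) :
    ∑ i ∈ range (N + 1), (N.choose i : ℝ) * (diffOp^[N - i] a) (k + i) = a k := by
  rw [← Finset.Nat.sum_antidiagonal_eq_sum_range_succ
    (fun i j => (N.choose i : ℝ) * (diffOp^[j] a) (k + i))]
  induction N with
  | zero => simp
  | succ n ih =>
    rw [Finset.sum_antidiagonal_choose_succ_mul (fun i j => (diffOp^[j] a) (k + i)) n]
    rw [← ih, ← Finset.sum_add_distrib]
    refine Finset.sum_congr rfl fun p hp => ?_
    have hp' := Finset.HasAntidiagonal.mem_antidiagonal.1 hp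
    have : n.choose p.2 = n.choose p.1 := by
      rw [← hp', ← Nat.choose_symm_add]
    rw [diffOp_iterate_succ, this, add_assoc]
    ring

/-- The mass at `i / N` of the Bernstein measure of order `N` of a sequence. -/
def bernsteinWeight (a : ℕ → ℝ) (N i : ℕ) : ℝ := (N.choose i : ℝ) * (diffOp^[N - i] a) i

lemma bernsteinWeight_nonneg {a : ℕ → ℝ} (h : CompletelyMonotone a) (N i : ℕ) :
    0 ≤ bernsteinWeight a N i := mul_nonneg (by positivity) (h _ _)

lemma sum_bernsteinWeight (a : ℕ → ℝ) (N : ℕ) :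
    ∑ i ∈ range (N + 1), bernsteinWeight a N i = a 0 := by
  simpa [bernsteinWeight] using sum_choose_mul_diffOp a N 0

/-- The Bernstein weights reproduce `a k` exactly when the power `(i/N)^k` is replaced by a ratio of
binomial coefficients: terms with `i < k` vanish, and `C(N,i) C(i,k) = C(N,k) C(N-k,i-k)` reduces
the rest to `sum_choose_mul_diffOp` of order `N - k`. -/
lemma sum_bernsteinWeight_mul_choose (a : ℕ → ℝ) (M k : ℕ) :
    ∑ i ∈ range (k + M + 1),
      bernsteinWeight a (k + M) i * ((i.choose k : ℝ) / ((k + M).choose k : ℝ)) = a k := by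
  rw [add_assoc, Finset.sum_range_add, Finset.sum_eq_zero, zero_add]
  · rw [← sum_choose_mul_diffOp a M k]
    refine Finset.sum_congr rfl fun i hi => ?_
    have hi' : i ≤ M := by simpa [Nat.lt_succ_iff] using hi
    have h1 : (k + M).choose (k + i) * (k + i).choose k = (k + M).choose k * M.choose i := by
      have := Nat.choose_mul (n := k + M) (k := k + i) (s := k) (by omega)
      simpa using this
    have h2 : ((k + M).choose k : ℝ) ≠ 0 := by
      exact_mod_cast (Nat.choose_pos (by omega)).ne'
    have h3 : ((k + M).choose (k + i) : ℝ) * ((k + i).choose k : ℝ)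
      = ((k + M).choose k : ℝ) * (M.choose i : ℝ) := by exact_mod_cast h1
    rw [bernsteinWeight, show k + M - (k + i) = M - i by omega]
    field_simp
    linear_combination (diffOp^[M - i] a) (k + i) * h3
  · intro i hi
    rw [Nat.choose_eq_zero_of_lt (Finset.mem_range.1 hi)]; simp

/-- Raising `k` by one multiplies the ratio by `(i - k)/(N - k)` and the power by `i/N`. These
factors differ by at most `k/(N - k)`, and the errors add up because `k + k² ≤ (k + 1)²`. -/
lemma abs_choose_div_choose_sub_pow_le (N i k : ℕ) (hi : i ≤ N) (hk : k < N) :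
    |(i.choose k : ℝ) / (N.choose k : ℝ) - ((i : ℝ) / N) ^ k| ≤ (k : ℝ) ^ 2 / (N - k) := by
  induction k with
  | zero => simp
  | succ k ih =>
    have hN : (0 : ℝ) < N := by exact_mod_cast (by omega : 0 < N)
    have hNk : (0 : ℝ) < (N : ℝ) - (k + 1 : ℕ) := by
      rw [sub_pos]; exact_mod_cast hk
    push_cast at hNk
    have hiN : (i : ℝ) ≤ N := by exact_mod_cast hi
    have ih' := ih (by omega)
    set r := (i.choose k : ℝ) / (N.choose k : ℝ) with hr
    have hcN : (0 : ℝ) < N.choose k := by exact_mod_cast Nat.choose_pos (by omega)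
    have hr0 : 0 ≤ r := by positivity
    have hr1 : r ≤ 1 := by
      rw [hr, div_le_one hcN]; exact_mod_cast Nat.choose_le_choose k hi
    have key : ∀ j : ℕ, (j.choose (k + 1) : ℝ) * (k + 1) = j.choose k * (j - k) := by
      intro j
      rcases le_or_gt k j with h | h
      · have := Nat.choose_succ_right_eq j k
        rw [← Nat.cast_sub h]; exact_mod_cast this
      · rw [Nat.choose_eq_zero_of_lt h, Nat.choose_eq_zero_of_lt (by omega)]; simp
    have hrec : (i.choose (k + 1) : ℝ) / (N.choose (k + 1) : ℝ) = r * ((i - k) / (N - k)) := by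
      have hk1 : (k : ℝ) + 1 ≠ 0 := by positivity
      have hNk0 : (N : ℝ) - k ≠ 0 := by linarith
      have e1 : (i.choose (k + 1) : ℝ) = i.choose k * (i - k) / (k + 1) := by
        rw [eq_div_iff hk1, key]
      have e2 : (N.choose (k + 1) : ℝ) = N.choose k * (N - k) / (k + 1) := by
        rw [eq_div_iff hk1, key]
      rw [e1, e2, hr]; field_simp
    have hx0 : 0 ≤ (i : ℝ) / N := by positivity
    have hx1 : (i : ℝ) / N ≤ 1 := by rw [div_le_one hN]; exact hiN
    have h1 : |r * ((i - k) / (N - k)) - i / N * r| ≤ k / (N - (k + 1)) := by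
      have e : r * ((i - k) / (N - k)) - i / N * r = - (r * (1 - i / N) * (k / (N - k))) := by
        have : (N : ℝ) - k ≠ 0 := by linarith
        field_simp; ring
      have hk0 : (0 : ℝ) ≤ k / (N - k) := div_nonneg (by positivity) (by linarith)
      rw [e, abs_neg, abs_of_nonneg (by
        refine mul_nonneg (mul_nonneg hr0 (by linarith)) hk0)]
      calc r * (1 - i / N) * (k / (N - k)) ≤ 1 * (k / (N - k)) := by
            refine mul_le_mul_of_nonneg_right ?_ hk0
            nlinarith
        _ ≤ k / (N - (k + 1)) := by
            rw [one_mul]; exact div_le_div_of_nonneg_left (by positivity) hNk (by linarith)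
    rw [hrec, pow_succ']
    have e : r * ((i - k) / (N - k)) - i / N * ((i : ℝ) / N) ^ k =
      (r * ((i - k) / (N - k)) - i / N * r) + i / N * (r - ((i : ℝ) / N) ^ k) := by ring
    rw [e]
    refine (abs_add_le _ _).trans ?_
    have h2 : |i / N * (r - ((i : ℝ) / N) ^ k)| ≤ (k : ℝ) ^ 2 / (N - (k + 1)) := by
      rw [abs_mul, abs_of_nonneg hx0]
      calc _ ≤ 1 * ((k : ℝ) ^ 2 / (N - k)) := by gcongr
        _ ≤ _ := by
          rw [one_mul]; exact div_le_div_of_nonneg_left (by positivity) hNk (by linarith)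
    refine (add_le_add h1 h2).trans ?_
    rw [← add_div]
    push_cast
    gcongr
    nlinarith [(Nat.cast_nonneg k : (0 : ℝ) ≤ k)]

/-- The point `i / N` of the unit interval. -/
def gridPoint (N i : ℕ) : unitInterval := Set.projIcc (0 : ℝ) 1 zero_le_one ((i : ℝ) / N)

lemma coe_gridPoint {N i : ℕ} (hi : i ≤ N) : (gridPoint N i : ℝ) = (i : ℝ) / N := by
  rw [gridPoint, Set.coe_projIcc, min_eq_right, max_eq_right]
  · positivity
  · exact div_le_one_of_le₀ (by exact_mod_cast hi) (by positivity)

/-- The Bernstein measure of order `N` of a sequence `a`, divided by `a 0`. -/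
def bernsteinMeasure (a : ℕ → ℝ) (N : ℕ) : Measure unitInterval :=
  ∑ i ∈ range (N + 1), ENNReal.ofReal (bernsteinWeight a N i / a 0) •
    Measure.dirac (gridPoint N i)

lemma integral_bernsteinMeasure {a : ℕ → ℝ} (h : CompletelyMonotone a) (h0 : 0 < a 0) (N : ℕ)
    (f : unitInterval → ℝ) : ∫ x, f x ∂(bernsteinMeasure a N) =
      ∑ i ∈ range (N + 1), bernsteinWeight a N i / a 0 * f (gridPoint N i) := by
  rw [bernsteinMeasure, integral_finsetSum_measure]
  · refine Finset.sum_congr rfl fun i _ => ?_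
    rw [integral_smul_measure, integral_dirac, ENNReal.toReal_ofReal
      (div_nonneg (bernsteinWeight_nonneg h _ _) h0.le), smul_eq_mul]
  · intro i _
    exact (integrable_dirac (by simp)).smul_measure ENNReal.ofReal_ne_top

lemma isProbabilityMeasure_bernsteinMeasure {a : ℕ → ℝ} (h : CompletelyMonotone a)
    (h0 : 0 < a 0) (N : ℕ) : IsProbabilityMeasure (bernsteinMeasure a N) := by
  constructor
  simp only [bernsteinMeasure, Measure.coe_finsetSum, Finset.sum_apply, Measure.smul_apply,
    measure_univ, smul_eq_mul, mul_one]
  rw [← ENNReal.ofReal_sum_of_nonneg, ← Finset.sum_div, sum_bernsteinWeight, div_self h0.ne',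
    ENNReal.ofReal_one]
  intro i _
  exact div_nonneg (bernsteinWeight_nonneg h _ _) h0.le

lemma tendsto_integral_pow_bernsteinMeasure {a : ℕ → ℝ} (h : CompletelyMonotone a)
    (h0 : 0 < a 0) (k : ℕ) :
    Tendsto (fun N => ∫ x, (x : ℝ) ^ k ∂(bernsteinMeasure a N)) atTop (𝓝 (a k / a 0)) := by
  rw [tendsto_iff_norm_sub_tendsto_zero]
  have hlim : Tendsto (fun N : ℕ => (k : ℝ) ^ 2 / (N - k)) atTop (𝓝 0) :=
    Tendsto.const_div_atTop
      (tendsto_atTop_add_const_right _ _ tendsto_natCast_atTop_atTop) _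
  refine squeeze_zero' (Eventually.of_forall fun _ => norm_nonneg _) ?_ hlim
  filter_upwards [eventually_gt_atTop k] with N hN
  have hak : a k / a 0 = ∑ i ∈ range (N + 1), bernsteinWeight a N i / a 0 *
      ((i.choose k : ℝ) / (N.choose k : ℝ)) := by
    obtain ⟨M, rfl⟩ := Nat.exists_eq_add_of_le hN.le
    rw [← sum_bernsteinWeight_mul_choose a M k, Finset.sum_div]
    exact Finset.sum_congr rfl fun i _ => by ring
  have hone : ∑ i ∈ range (N + 1), bernsteinWeight a N i / a 0 = 1 := by
    rw [← Finset.sum_div, sum_bernsteinWeight, div_self h0.ne']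
  rw [integral_bernsteinMeasure h h0, hak, ← Finset.sum_sub_distrib]
  calc _ ≤ ∑ i ∈ range (N + 1), bernsteinWeight a N i / a 0 * ((k : ℝ) ^ 2 / (N - k)) := by
        refine (norm_sum_le _ _).trans (Finset.sum_le_sum fun i hi => ?_)
        have hi' : i ≤ N := by simpa [Nat.lt_succ_iff] using hi
        have hw : 0 ≤ bernsteinWeight a N i / a 0 :=
          div_nonneg (bernsteinWeight_nonneg h _ _) h0.le
        rw [← mul_sub, norm_mul, Real.norm_of_nonneg hw, coe_gridPoint hi', Real.norm_eq_abs,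
          abs_sub_comm]
        exact mul_le_mul_of_nonneg_left (abs_choose_div_choose_sub_pow_le N i k hi' hN) hw
    _ = _ := by rw [← Finset.sum_mul, hone, one_mul]

/-- **Hausdorff's moment theorem**: a completely monotone sequence is the sequence of moments of a
finite measure on `[0, 1]`. -/
theorem CompletelyMonotone.exists_measure {a : ℕ → ℝ} (h : CompletelyMonotone a)
    (h0 : 0 < a 0) : ∃ m : Measure ℝ, IsFiniteMeasure m ∧ (∀ᵐ t ∂m, t ∈ Set.Icc (0 : ℝ) 1) ∧
      ∀ n, ∫ t, t ^ n ∂m = a n := by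
  let P : ℕ → ProbabilityMeasure unitInterval := fun N =>
    ⟨bernsteinMeasure a N, isProbabilityMeasure_bernsteinMeasure h h0 N⟩
  -- Probability measures on the compact interval form a compact space, so a limit along a free
  -- ultrafilter exists without extracting a subsequence. The moments converge along `atTop`, hence
  -- along the ultrafilter.
  obtain ⟨ν, -, hν⟩ := isCompact_univ.ultrafilter_le_nhds ((hyperfilter ℕ).map P) (by simp)
  have hν' : Tendsto P (hyperfilter ℕ : Filter ℕ) (𝓝 ν) := hν
  rw [ProbabilityMeasure.tendsto_iff_forall_integral_tendsto] at hν'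
  have hmom : ∀ n : ℕ, ∫ x : unitInterval, (x : ℝ) ^ n ∂(ν : Measure unitInterval)
      = a n / a 0 := by
    intro n
    have h1 := hν' (BoundedContinuousFunction.mkOfCompact
      ⟨fun x : unitInterval => (x : ℝ) ^ n, by fun_prop⟩)
    exact tendsto_nhds_unique h1
      ((tendsto_integral_pow_bernsteinMeasure h h0 n).mono_left Nat.hyperfilter_le_atTop)
  refine ⟨ENNReal.ofReal (a 0) • (ν : Measure unitInterval).map Subtype.val, ?_, ?_, ?_⟩
  · exact Measure.smul_finite _ ENNReal.ofReal_ne_top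
  · refine Measure.ae_smul_measure ?_ _
    exact (ae_map_iff measurable_subtype_coe.aemeasurable
      (measurableSet_Icc (a := (0 : ℝ)) (b := 1))).2 (Eventually.of_forall fun x => x.2)
  · intro n
    rw [integral_smul_measure, integral_map measurable_subtype_coe.aemeasurable
      (by fun_prop), hmom, ENNReal.toReal_ofReal h0.le, smul_eq_mul]
    field_simp

/-- A completely monotone sequence tending to zero is the sequence of moments of a finite measure
on `[0, 1)`. -/
theorem CompletelyMonotone.exists_measure_Ico {a : ℕ → ℝ} (h : CompletelyMonotone a)
    (h0 : 0 < a 0) (hlim : Tendsto a atTop (𝓝 0)) :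
    ∃ m : Measure ℝ, IsFiniteMeasure m ∧ (∀ᵐ t ∂m, t ∈ Set.Ico (0 : ℝ) 1) ∧
      ∀ n, ∫ t, t ^ n ∂m = a n := by
  obtain ⟨m, hm, hI, hmom⟩ := h.exists_measure h0
  refine ⟨m, hm, ?_, hmom⟩
  -- An atom at `1` contributes its full mass to every moment, so moments tending to `0` exclude it.
  have hle : ∀ n, m.real {1} ≤ a n := by
    intro n
    rw [← hmom n, ← integral_indicator_one (measurableSet_singleton (1 : ℝ))]
    refine integral_mono_of_nonneg (Eventually.of_forall fun t => ?_) ?_ ?_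
    · exact Set.indicator_nonneg (fun _ _ => zero_le_one) t
    · refine Integrable.of_bound (C := 1) (by fun_prop) ?_
      filter_upwards [hI] with t ht
      rw [norm_pow, Real.norm_of_nonneg ht.1]
      exact pow_le_one₀ ht.1 ht.2
    · filter_upwards [hI] with t ht
      by_cases h1 : t = 1
      · simp [h1]
      · simp [h1, pow_nonneg ht.1 n]
  have h1 : m.real {1} ≤ 0 := ge_of_tendsto' hlim hle
  have h2 : m {1} = 0 := by
    have := le_antisymm h1 measureReal_nonneg
    rwa [measureReal_eq_zero_iff] at this
  have h3 : ∀ᵐ t ∂m, t ≠ 1 := by rw [ae_iff]; simpa using h2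
  filter_upwards [hI, h3] with t ht ht1
  exact ⟨ht.1, lt_of_le_of_ne ht.2 ht1⟩

/-! ### Trigonometric series and Fourier transforms on `ℤ` -/

/-- The sum of a trigonometric series. -/
def trig (c : ℤ → ℂ) (θ : ℝ) : ℂ :=
  ∑' n : ℤ, c n * Complex.exp (((n : ℝ) * θ : ℝ) * Complex.I)

lemma hat_eq_trig (μ : Measure ℤ) : hat μ = trig (fun n => (mass μ n : ℂ)) := rfl

lemma norm_trig_term (c : ℤ → ℂ) (n : ℤ) (θ : ℝ) :
    ‖c n * Complex.exp (((n : ℝ) * θ : ℝ) * Complex.I)‖ = ‖c n‖ := by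
  rw [norm_mul, Complex.norm_exp_ofReal_mul_I, mul_one]

lemma summable_trig {c : ℤ → ℂ} (hc : Summable fun n => ‖c n‖) (θ : ℝ) :
    Summable fun n : ℤ => c n * Complex.exp (((n : ℝ) * θ : ℝ) * Complex.I) :=
  Summable.of_norm (by simpa only [norm_trig_term] using hc)

lemma norm_trig_le {c : ℤ → ℂ} (hc : Summable fun n => ‖c n‖) (θ : ℝ) :
    ‖trig c θ‖ ≤ ∑' n, ‖c n‖ := by
  refine (norm_tsum_le_tsum_norm (summable_trig hc θ).norm).trans_eq ?_
  simp only [norm_trig_term]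

lemma continuous_trig {c : ℤ → ℂ} (hc : Summable fun n => ‖c n‖) : Continuous (trig c) :=
  continuous_tsum (fun n => by fun_prop) hc fun n θ => (norm_trig_term c n θ).le

lemma one_le_abs_intCast {n : ℤ} (hn : n ≠ 0) : (1 : ℝ) ≤ |(n : ℝ)| := by
  exact_mod_cast Int.one_le_abs hn

lemma summable_of_summable_abs_mul {f : ℤ → ℝ} (h : Summable fun n : ℤ => |(n : ℝ)| * f n)
    (h0 : ∀ n, 0 ≤ f n) : Summable f := by
  refine Summable.of_norm_bounded_eventually h ?_
  filter_upwards [(Set.finite_singleton (0 : ℤ)).compl_mem_cofinite] with n hn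
  rw [Real.norm_of_nonneg (h0 n)]
  exact le_mul_of_one_le_left (h0 n) (one_le_abs_intCast hn)

lemma summable_abs_mul_of_summable_sq_mul {f : ℤ → ℝ}
    (h : Summable fun n : ℤ => (n : ℝ) ^ 2 * f n) (h0 : ∀ n, 0 ≤ f n) :
    Summable fun n : ℤ => |(n : ℝ)| * f n := by
  refine Summable.of_nonneg_of_le (fun n => mul_nonneg (abs_nonneg _) (h0 n)) (fun n => ?_) h
  refine mul_le_mul_of_nonneg_right ?_ (h0 n)
  rw [← sq_abs]
  rcases eq_or_ne n 0 with rfl | hn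
  · simp
  · nlinarith [one_le_abs_intCast hn]

/-- The coefficients of the derivative of a trigonometric series. -/
def dcoef (c : ℤ → ℂ) (n : ℤ) : ℂ := ((n : ℝ) * Complex.I) * c n

lemma norm_dcoef (c : ℤ → ℂ) (n : ℤ) : ‖dcoef c n‖ = |(n : ℝ)| * ‖c n‖ := by
  simp [dcoef]

lemma hasDerivAt_trig {c : ℤ → ℂ} (hc : Summable fun n : ℤ => |(n : ℝ)| * ‖c n‖) (θ : ℝ) :
    HasDerivAt (trig c) (trig (dcoef c) θ) θ := by
  have h0 : Summable fun n => ‖c n‖ := summable_of_summable_abs_mul hc fun n => norm_nonneg _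
  refine hasDerivAt_tsum (u := fun n : ℤ => |(n : ℝ)| * ‖c n‖) hc
    (g := fun (n : ℤ) (θ : ℝ) => c n * Complex.exp (((n : ℝ) * θ : ℝ) * Complex.I))
    (g' := fun (n : ℤ) (θ : ℝ) => dcoef c n * Complex.exp (((n : ℝ) * θ : ℝ) * Complex.I))
    (fun n y => ?_) (fun n y => ?_) (summable_trig h0 0) θ
  · have h1 : HasDerivAt (fun y : ℝ => (((n : ℝ) * y : ℝ) : ℂ) * Complex.I)
        (((n : ℝ) * 1 : ℝ) * Complex.I) y :=
      (((hasDerivAt_id y).const_mul (n : ℝ)).ofReal_comp).mul_const _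
    refine (h1.cexp.const_mul (c n)).congr_deriv ?_
    rw [dcoef, mul_one]; ring
  · rw [norm_trig_term, norm_dcoef]

lemma mass_nonneg (μ : Measure ℤ) (n : ℤ) : 0 ≤ mass μ n := measureReal_nonneg

lemma summable_mass (μ : Measure ℤ) [IsFiniteMeasure μ] : Summable (mass μ) := by
  refine summable_of_sum_le (c := μ.real Set.univ) (mass_nonneg μ) fun s => ?_
  have : ∑ n ∈ s, mass μ n = μ.real s := by simp [mass]
  rw [this]
  exact measureReal_mono (Set.subset_univ _)

lemma summable_norm_mass (μ : Measure ℤ) [IsFiniteMeasure μ] :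
    Summable fun n => ‖(mass μ n : ℂ)‖ := by
  simpa [abs_of_nonneg (mass_nonneg μ _)] using summable_mass μ

lemma tsum_mass (μ : Measure ℤ) [IsProbabilityMeasure μ] : ∑' n, mass μ n = 1 := by
  have := integral_countable (μ := μ) (f := fun _ : ℤ => (1 : ℝ)) (by simp)
  simpa [mass] using this.symm

lemma hat_eq_integral (μ : Measure ℤ) [IsProbabilityMeasure μ] (θ : ℝ) :
    hat μ θ = ∫ n : ℤ, Complex.exp (((n : ℝ) * θ : ℝ) * Complex.I) ∂μ := by
  rw [integral_countable, hat]
  · simp [mass]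
  · refine Integrable.of_bound (C := 1) (by fun_prop) (Eventually.of_forall fun n => ?_)
    rw [Complex.norm_exp_ofReal_mul_I]

lemma continuous_hat (μ : Measure ℤ) [IsFiniteMeasure μ] : Continuous (hat μ) :=
  continuous_trig (summable_norm_mass μ)

lemma hat_zero (μ : Measure ℤ) [IsProbabilityMeasure μ] : hat μ 0 = 1 := by
  rw [hat_eq_integral]; simp

lemma hat_neg (μ : Measure ℤ) (θ : ℝ) : hat μ (-θ) = (starRingEnd ℂ) (hat μ θ) := by
  rw [hat, hat, Complex.conj_tsum]
  refine tsum_congr fun n => ?_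
  rw [map_mul, Complex.conj_ofReal, ← Complex.exp_conj]
  simp

lemma hat_add_two_pi (μ : Measure ℤ) (θ : ℝ) : hat μ (θ + 2 * Real.pi) = hat μ θ := by
  refine tsum_congr fun n => ?_
  congr 1
  rw [Complex.exp_eq_exp_iff_exists_int]
  exact ⟨n, by push_cast; ring⟩

lemma hat_conv (μ ν : Measure ℤ) [IsProbabilityMeasure μ] [IsProbabilityMeasure ν] (θ : ℝ) :
    hat (μ.conv ν) θ = hat μ θ * hat ν θ := by
  rw [hat_eq_integral, hat_eq_integral, hat_eq_integral, integral_conv]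
  · simp_rw [← integral_mul_const, ← integral_const_mul]
    refine integral_congr_ae (Eventually.of_forall fun m => ?_)
    refine integral_congr_ae (Eventually.of_forall fun n => ?_)
    simp only
    rw [← Complex.exp_add]
    push_cast
    ring_nf
  · refine Integrable.of_bound (C := 1) (by fun_prop) (Eventually.of_forall fun n => ?_)
    rw [Complex.norm_exp_ofReal_mul_I]

instance isProbabilityMeasure_convPow (μ : Measure ℤ) [IsProbabilityMeasure μ] (n : ℕ) :
    IsProbabilityMeasure (convPow μ n) := by
  induction n with
  | zero => rw [convPow]; infer_instance
  | succ n ih => rw [convPow]; infer_instance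

lemma hat_convPow (μ : Measure ℤ) [IsProbabilityMeasure μ] (n : ℕ) (θ : ℝ) :
    hat (convPow μ n) θ = hat μ θ ^ n := by
  induction n with
  | zero =>
    have := hat_eq_integral (convPow μ 0) θ
    rw [this, convPow, integral_dirac]; simp
  | succ n ih => rw [convPow, hat_conv, ih, pow_succ']

/-- If two neighbouring atoms are charged, modulus one would force equality in the triangle
inequality for their two terms; these differ in phase by `e^{iθ}`, so `e^{iθ} = 1`. -/
lemma norm_hat_lt_one_of_adjacent (μ : Measure ℤ) [IsProbabilityMeasure μ] {n : ℤ}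
    (h0 : 0 < mass μ n) (h1 : 0 < mass μ (n + 1)) {θ : ℝ}
    (hθ : Complex.exp (θ * Complex.I) ≠ 1) : ‖hat μ θ‖ < 1 := by
  set z := Complex.exp (θ * Complex.I) with hz
  have hz1 : ‖z‖ = 1 := Complex.norm_exp_ofReal_mul_I θ
  set g : ℤ → ℂ := fun n => (mass μ n : ℂ) * Complex.exp (((n : ℝ) * θ : ℝ) * Complex.I) with hg
  have hs : Summable g := summable_trig (summable_norm_mass μ) θ
  have hgn : ∀ k, ‖g k‖ = mass μ k := fun k => by
    rw [hg]; simp only; rw [norm_trig_term (fun n => (mass μ n : ℂ))]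
    simp [abs_of_nonneg (mass_nonneg μ _)]
  have hsplit := hs.sum_add_tsum_compl (s := ({n, n + 1} : Finset ℤ))
  have hsplit' := (summable_mass μ).sum_add_tsum_compl (s := ({n, n + 1} : Finset ℤ))
  rw [tsum_mass] at hsplit'
  have hne : n ≠ n + 1 := by omega
  rw [Finset.sum_pair hne] at hsplit hsplit'
  have hrest : ‖∑' k : ↑((({n, n + 1} : Finset ℤ) : Set ℤ)ᶜ), g k‖ ≤
      ∑' k : ↑((({n, n + 1} : Finset ℤ) : Set ℤ)ᶜ), mass μ k := by
    refine (norm_tsum_le_tsum_norm (hs.norm.subtype _)).trans_eq ?_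
    exact tsum_congr fun k => hgn k
  have hpair : ‖g n + g (n + 1)‖ < mass μ n + mass μ (n + 1) := by
    have hle : ‖g n + g (n + 1)‖ ≤ ‖g n‖ + ‖g (n + 1)‖ := norm_add_le _ _
    rw [← hgn n, ← hgn (n + 1)]
    refine lt_of_le_of_ne hle fun heq => hθ ?_
    -- Equality in the strictly convex plane puts the two terms on one ray; cancelling the positive
    -- masses and the common phase leaves `z = 1`.
    have hray := (sameRay_iff_norm_add.2 heq)
    have he : g (n + 1) = (mass μ (n + 1) : ℂ) *
        (z * Complex.exp (((n : ℝ) * θ : ℝ) * Complex.I)) := by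
      rw [hg, hz, ← Complex.exp_add]; push_cast; ring_nf
    have hgn0 : g n ≠ 0 := norm_ne_zero_iff.1 (by rw [hgn]; exact h0.ne')
    have h3 := sameRay_iff_norm_smul_eq.1 hray
    rw [hgn, hgn, he] at h3
    have h4 : (mass μ n : ℂ) * (mass μ (n + 1) : ℂ) *
        Complex.exp (((n : ℝ) * θ : ℝ) * Complex.I) * (z - 1) = 0 := by
      have h5 : (mass μ n : ℂ) * ((mass μ (n + 1) : ℂ) *
        (z * Complex.exp (((n : ℝ) * θ : ℝ) * Complex.I))) = (mass μ (n + 1) : ℂ) *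
          ((mass μ n : ℂ) * Complex.exp (((n : ℝ) * θ : ℝ) * Complex.I)) := by
        simpa [hg] using h3
      linear_combination h5
    have h6 : (mass μ n : ℂ) ≠ 0 := by exact_mod_cast h0.ne'
    have h7 : (mass μ (n + 1) : ℂ) ≠ 0 := by exact_mod_cast h1.ne'
    have h8 := Complex.exp_ne_zero (((n : ℝ) * θ : ℝ) * Complex.I)
    have h9 : z - 1 = 0 := by
      simpa only [mul_eq_zero, h6, h7, h8, false_or] using h4
    exact sub_eq_zero.1 h9
  have hhat : hat μ θ = ∑' k, g k := rfl
  rw [hhat, ← hsplit]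
  refine (norm_add_le _ _).trans_lt ?_
  linarith

lemma exp_mul_I_ne_one {θ : ℝ} (h : θ ∈ Set.Ioo 0 (2 * Real.pi)) :
    Complex.exp (θ * Complex.I) ≠ 1 := by
  intro he
  rw [Complex.exp_eq_one_iff] at he
  obtain ⟨k, hk⟩ := he
  have h1 : (θ : ℂ) = ((k * (2 * Real.pi) : ℝ) : ℂ) := by
    refine mul_right_cancel₀ Complex.I_ne_zero ?_
    rw [hk]; push_cast; ring
  have h2 : θ = k * (2 * Real.pi) := by exact_mod_cast h1
  have hp := Real.two_pi_pos
  have h3 : (0 : ℝ) < k := by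
    by_contra hcon
    nlinarith [h.1]
  have h4 : (k : ℝ) < 1 := by
    by_contra hcon
    nlinarith [h.2]
  have h5 : (0 : ℤ) < k := by exact_mod_cast h3
  have h6 : k < (1 : ℤ) := by exact_mod_cast h4
  omega

lemma strictlyAperiodic_of_adjacent (μ : Measure ℤ) [IsProbabilityMeasure μ] {n : ℤ}
    (h0 : 0 < mass μ n) (h1 : 0 < mass μ (n + 1)) : StrictlyAperiodic μ :=
  fun _ hθ => norm_hat_lt_one_of_adjacent μ h0 h1 (exp_mul_I_ne_one hθ)

/-! ### Cauchy and Stieltjes integrals of a measure on `[0, 1)` -/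

/-- The `k`-th derivative, up to the factor `k!`, of the function `z ↦ ∫ (1 - t z)⁻¹ dm(t)`. -/
def cauchyInt (m : Measure ℝ) (k : ℕ) (z : ℂ) : ℂ := ∫ t : ℝ, (t : ℂ) ^ k / (1 - t * z) ^ (k + 1) ∂m

/-- The points `z` outside the ray `[1, ∞)`. -/
def slitSet : Set ℂ := {z | ∀ t ∈ Set.Icc (0 : ℝ) 1, (1 : ℂ) - t * z ≠ 0}

/-- Half the minimum over the compact interval `[0, 1]` serves both as radius and as lower bound.
This local uniformity is what dominates the integrands when differentiating under the integral sign.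
-/
lemma exists_le_norm_one_sub_mul {z : ℂ} (hz : z ∈ slitSet) :
    ∃ ε > 0, ∀ t ∈ Set.Icc (0 : ℝ) 1, ∀ w ∈ Metric.ball z ε, ε ≤ ‖(1 : ℂ) - t * w‖ := by
  obtain ⟨t₀, ht₀, hmin⟩ := isCompact_Icc.exists_isMinOn (s := Set.Icc (0 : ℝ) 1)
    (f := fun t : ℝ => ‖(1 : ℂ) - t * z‖) ⟨0, by simp⟩ (by fun_prop)
  have hpos : 0 < ‖(1 : ℂ) - t₀ * z‖ := norm_pos_iff.2 (hz t₀ ht₀)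
  refine ⟨‖(1 : ℂ) - t₀ * z‖ / 2, by positivity, fun t ht w hw => ?_⟩
  have h1 : ‖(1 : ℂ) - t₀ * z‖ ≤ ‖(1 : ℂ) - t * z‖ := hmin ht
  have h2 : ‖(1 : ℂ) - t * z‖ ≤ ‖(1 : ℂ) - t * w‖ + ‖(t : ℂ) * (w - z)‖ := by
    refine le_trans (le_of_eq ?_) (norm_add_le _ _)
    congr 1; ring
  have h3 : ‖(t : ℂ) * (w - z)‖ ≤ ‖w - z‖ := by
    rw [norm_mul, Complex.norm_real, Real.norm_of_nonneg ht.1]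
    exact mul_le_of_le_one_left (norm_nonneg _) ht.2
  have h4 : ‖w - z‖ < ‖(1 : ℂ) - t₀ * z‖ / 2 := by simpa [dist_eq_norm] using hw
  linarith

lemma isOpen_slitSet : IsOpen slitSet := by
  rw [Metric.isOpen_iff]
  intro z hz
  obtain ⟨ε, hε, h⟩ := exists_le_norm_one_sub_mul hz
  exact ⟨ε, hε, fun w hw t ht => norm_pos_iff.1 (hε.trans_le (h t ht w hw))⟩

variable {m : Measure ℝ}

lemma measurable_cauchyKernel (k : ℕ) (z : ℂ) :
    Measurable fun t : ℝ => (t : ℂ) ^ k / (1 - t * z) ^ (k + 1) := by fun_prop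

lemma norm_cauchyKernel_le {t : ℝ} (ht : t ∈ Set.Icc (0 : ℝ) 1) {ε : ℝ} (hε : 0 < ε) {w : ℂ}
    (h : ε ≤ ‖(1 : ℂ) - t * w‖) (k : ℕ) :
    ‖(t : ℂ) ^ k / (1 - t * w) ^ (k + 1)‖ ≤ 1 / ε ^ (k + 1) := by
  rw [norm_div, norm_pow, norm_pow, Complex.norm_real, Real.norm_of_nonneg ht.1]
  have := pow_le_one₀ (n := k) ht.1 ht.2
  gcongr

lemma integrable_cauchyKernel [IsFiniteMeasure m] (hm : ∀ᵐ t ∂m, t ∈ Set.Ico (0 : ℝ) 1) (k : ℕ)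
    {z : ℂ} (hz : z ∈ slitSet) :
    Integrable (fun t : ℝ => (t : ℂ) ^ k / (1 - t * z) ^ (k + 1)) m := by
  obtain ⟨ε, hε, h⟩ := exists_le_norm_one_sub_mul hz
  refine Integrable.of_bound (C := 1 / ε ^ (k + 1))
    (measurable_cauchyKernel k z).aestronglyMeasurable ?_
  filter_upwards [hm] with t ht
  exact norm_cauchyKernel_le ⟨ht.1, ht.2.le⟩ hε
    (h t ⟨ht.1, ht.2.le⟩ z (Metric.mem_ball_self hε)) k

lemma hasDerivAt_cauchyInt [IsFiniteMeasure m] (hm : ∀ᵐ t ∂m, t ∈ Set.Ico (0 : ℝ) 1) (k : ℕ)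
    {z : ℂ} (hz : z ∈ slitSet) :
    HasDerivAt (cauchyInt m k) ((k + 1) * cauchyInt m (k + 1) z) z := by
  obtain ⟨ε, hε, h⟩ := exists_le_norm_one_sub_mul hz
  have := (hasDerivAt_integral_of_dominated_loc_of_deriv_le (μ := m)
    (F := fun (w : ℂ) (t : ℝ) => (t : ℂ) ^ k / (1 - t * w) ^ (k + 1))
    (F' := fun (w : ℂ) (t : ℝ) => (k + 1) * ((t : ℂ) ^ (k + 1) / (1 - t * w) ^ (k + 1 + 1)))
    (x₀ := z) (bound := fun _ => (k + 1) * (1 / ε ^ (k + 1 + 1)))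
    (Metric.ball_mem_nhds z hε)
    (Eventually.of_forall fun w => (measurable_cauchyKernel k w).aestronglyMeasurable)
    (integrable_cauchyKernel hm k hz)
    ((measurable_cauchyKernel (k + 1) z).const_mul _).aestronglyMeasurable ?_
    (integrable_const _) ?_).2
  · rwa [integral_const_mul] at this
  · filter_upwards [hm] with t ht w hw
    have ht' : t ∈ Set.Icc (0 : ℝ) 1 := ⟨ht.1, ht.2.le⟩
    rw [norm_mul]
    refine mul_le_mul (le_of_eq ?_) (norm_cauchyKernel_le ht' hε (h t ht' w hw) (k + 1))
      (norm_nonneg _) (by positivity)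
    exact_mod_cast Complex.norm_natCast (k + 1)
  · filter_upwards [hm] with t ht w hw
    have ht' : t ∈ Set.Icc (0 : ℝ) 1 := ⟨ht.1, ht.2.le⟩
    have hne : (1 : ℂ) - t * w ≠ 0 := norm_pos_iff.1 (hε.trans_le (h t ht' w hw))
    have h1 : HasDerivAt (fun w : ℂ => (1 : ℂ) - t * w) (-(t : ℂ)) w := by
      simpa using ((hasDerivAt_id w).const_mul (t : ℂ)).const_sub 1
    have h2 := ((h1.pow (k + 1)).inv (pow_ne_zero _ hne)).const_mul ((t : ℂ) ^ k)
    refine (h2.congr_deriv ?_)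
    simp only [Pi.pow_apply]
    push_cast
    field_simp
    ring

lemma contDiffAt_cauchyInt [IsFiniteMeasure m] (hm : ∀ᵐ t ∂m, t ∈ Set.Ico (0 : ℝ) 1) (k : ℕ)
    {z : ℂ} (hz : z ∈ slitSet) (n : ℕ) : ContDiffAt ℂ n (cauchyInt m k) z := by
  have : DifferentiableOn ℂ (cauchyInt m k) slitSet := fun w hw =>
    (hasDerivAt_cauchyInt hm k hw).differentiableAt.differentiableWithinAt
  exact (this.analyticAt (isOpen_slitSet.mem_nhds hz)).contDiffAt

/-- The Stieltjes-type integrals `∫ (1 - t + x)^{-(k+1)} dm(t)`. -/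
def stieltjesInt (m : Measure ℝ) (k : ℕ) (x : ℝ) : ℝ := ∫ t : ℝ, 1 / (1 - t + x) ^ (k + 1) ∂m

/-- The integral `∫ (1 - t) / (1 - t + x)² dm(t)`. -/
def stieltjesRe (m : Measure ℝ) (x : ℝ) : ℝ := ∫ t : ℝ, (1 - t) / (1 - t + x) ^ 2 ∂m

lemma integrable_stieltjes [IsFiniteMeasure m] (hm : ∀ᵐ t ∂m, t ∈ Set.Ico (0 : ℝ) 1) (k : ℕ)
    {x : ℝ} (hx : 0 < x) : Integrable (fun t : ℝ => 1 / (1 - t + x) ^ (k + 1)) m := by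
  refine Integrable.of_bound (C := 1 / x ^ (k + 1)) (Measurable.aestronglyMeasurable
    (by fun_prop)) ?_
  filter_upwards [hm] with t ht
  have : 0 < 1 - t + x := by linarith [ht.2]
  rw [Real.norm_of_nonneg (by positivity)]
  gcongr
  linarith [ht.2]

lemma integrable_stieltjesRe [IsFiniteMeasure m] (hm : ∀ᵐ t ∂m, t ∈ Set.Ico (0 : ℝ) 1)
    {x : ℝ} (hx : 0 < x) : Integrable (fun t : ℝ => (1 - t) / (1 - t + x) ^ 2) m := by
  refine Integrable.of_bound (C := 1 / x ^ 2) (Measurable.aestronglyMeasurable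
    (by fun_prop)) ?_
  filter_upwards [hm] with t ht
  have : 0 < 1 - t + x := by linarith [ht.2]
  rw [Real.norm_of_nonneg (div_nonneg (by linarith [ht.2]) (by positivity))]
  have h1 := ht.1
  have h2 := ht.2
  gcongr <;> linarith

lemma stieltjesInt_nonneg (hm : ∀ᵐ t ∂m, t ∈ Set.Ico (0 : ℝ) 1) (k : ℕ)
    {x : ℝ} (hx : 0 < x) : 0 ≤ stieltjesInt m k x := by
  refine integral_nonneg_of_ae ?_
  filter_upwards [hm] with t ht
  have : 0 < 1 - t + x := by linarith [ht.2]
  simp only [Pi.zero_apply]; positivity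

lemma stieltjesInt_succ_le [IsFiniteMeasure m] (hm : ∀ᵐ t ∂m, t ∈ Set.Ico (0 : ℝ) 1) (k : ℕ)
    {x : ℝ} (hx : 0 < x) : x * stieltjesInt m (k + 1) x ≤ stieltjesInt m k x := by
  rw [stieltjesInt, ← integral_const_mul]
  refine integral_mono_ae ((integrable_stieltjes hm _ hx).const_mul x)
    (integrable_stieltjes hm k hx) ?_
  filter_upwards [hm] with t ht
  have : 0 < 1 - t + x := by linarith [ht.2]
  have h2 : x ≤ 1 - t + x := by linarith [ht.2]
  calc x * (1 / (1 - t + x) ^ (k + 1 + 1)) ≤ (1 - t + x) * (1 / (1 - t + x) ^ (k + 1 + 1)) := by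
        gcongr
    _ = 1 / (1 - t + x) ^ (k + 1) := by field_simp; ring

/-- The integrand `x / (1 - t + x)` is nondecreasing in `x`. This becomes the monotonicity of
`ψ(θ)/θ` for the majorant. -/
lemma mul_stieltjesInt_le_mul [IsFiniteMeasure m] (hm : ∀ᵐ t ∂m, t ∈ Set.Ico (0 : ℝ) 1)
    {x y : ℝ} (hx : 0 < x) (hxy : x ≤ y) :
    x * stieltjesInt m 0 x ≤ y * stieltjesInt m 0 y := by
  have hy := hx.trans_le hxy
  rw [stieltjesInt, stieltjesInt, ← integral_const_mul, ← integral_const_mul]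
  refine integral_mono_ae ((integrable_stieltjes hm 0 hx).const_mul x)
    ((integrable_stieltjes hm 0 hy).const_mul y) ?_
  filter_upwards [hm] with t ht
  have h1 : 0 < 1 - t + x := by linarith [ht.2]
  have h2 : 0 < 1 - t + y := by linarith [ht.2]
  simp only [zero_add, pow_one, mul_one_div]
  rw [div_le_div_iff₀ h1 h2]
  nlinarith [ht.2]

lemma mul_stieltjesInt_zero_le [IsFiniteMeasure m] (hm : ∀ᵐ t ∂m, t ∈ Set.Ico (0 : ℝ) 1)
    {x : ℝ} (hx : 0 < x) : x * stieltjesInt m 0 x ≤ m.real Set.univ := by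
  rw [stieltjesInt, ← integral_const_mul]
  refine (integral_mono_ae ((integrable_stieltjes hm 0 hx).const_mul x)
    (integrable_const 1) ?_).trans_eq (by simp)
  filter_upwards [hm] with t ht
  have h1 : 0 < 1 - t + x := by linarith [ht.2]
  simp only [zero_add, pow_one, mul_one_div]
  rw [div_le_one h1]
  linarith [ht.2]

lemma stieltjesInt_zero_lower [IsFiniteMeasure m] (hm : ∀ᵐ t ∂m, t ∈ Set.Ico (0 : ℝ) 1)
    {x : ℝ} (hx : 0 < x) : m.real Set.univ / (1 + x) ≤ stieltjesInt m 0 x := by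
  have : m.real Set.univ / (1 + x) = ∫ _ : ℝ, 1 / (1 + x) ∂m := by
    rw [integral_const, smul_eq_mul]; ring
  rw [this]
  refine integral_mono_ae (integrable_const _) (integrable_stieltjes hm 0 hx) ?_
  filter_upwards [hm] with t ht
  have h1 : 0 < 1 - t + x := by linarith [ht.2]
  simp only [zero_add, pow_one]
  gcongr
  linarith [ht.1]

lemma hasDerivAt_stieltjesInt [IsFiniteMeasure m] (hm : ∀ᵐ t ∂m, t ∈ Set.Ico (0 : ℝ) 1) (k : ℕ)
    {x : ℝ} (hx : 0 < x) :
    HasDerivAt (stieltjesInt m k) (-((k + 1) * stieltjesInt m (k + 1) x)) x := by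
  have := (hasDerivAt_integral_of_dominated_loc_of_deriv_le (μ := m)
    (F := fun (x : ℝ) (t : ℝ) => 1 / (1 - t + x) ^ (k + 1))
    (F' := fun (x : ℝ) (t : ℝ) => -((k + 1) * (1 / (1 - t + x) ^ (k + 1 + 1))))
    (x₀ := x) (bound := fun _ => (k + 1) * (1 / (x / 2) ^ (k + 1 + 1)))
    (Ioi_mem_nhds (half_lt_self hx))
    (Eventually.of_forall fun w => Measurable.aestronglyMeasurable (by fun_prop))
    (integrable_stieltjes hm k hx)
    (Measurable.aestronglyMeasurable (by fun_prop)) ?_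
    (integrable_const _) ?_).2
  · rwa [integral_neg, integral_const_mul] at this
  · filter_upwards [hm] with t ht y hy
    have hy' : x / 2 < y := hy
    have h1 : 0 < 1 - t + y := by linarith [ht.2]
    rw [norm_neg, Real.norm_of_nonneg (by positivity)]
    gcongr
    linarith [ht.2]
  · filter_upwards [hm] with t ht y hy
    have hy' : x / 2 < y := hy
    have h1 : 1 - t + y ≠ 0 := by linarith [ht.2]
    have h2 : HasDerivAt (fun y : ℝ => 1 - t + y) 1 y := (hasDerivAt_id y).const_add _
    have h3 := (h2.pow (k + 1)).inv (pow_ne_zero _ h1)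
    simp only [one_div]
    refine h3.congr_deriv ?_
    simp only [Pi.pow_apply]
    push_cast
    field_simp
    ring

lemma contDiffOn_stieltjesInt [IsFiniteMeasure m] (hm : ∀ᵐ t ∂m, t ∈ Set.Ico (0 : ℝ) 1)
    (k : ℕ) : ContDiffOn ℝ 1 (stieltjesInt m k) (Set.Ioi 0) := by
  have hd : ∀ k, DifferentiableOn ℝ (stieltjesInt m k) (Set.Ioi 0) := fun k x hx =>
    (hasDerivAt_stieltjesInt hm k hx).differentiableAt.differentiableWithinAt
  rw [show (1 : WithTop ℕ∞) = 0 + 1 by simp, contDiffOn_succ_iff_deriv_of_isOpen isOpen_Ioi]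
  refine ⟨hd k, by simp, ?_⟩
  rw [contDiffOn_zero]
  refine ContinuousOn.congr (f := fun x => -((k + 1) * stieltjesInt m (k + 1) x)) ?_
    fun x hx => (hasDerivAt_stieltjesInt hm k hx).deriv
  exact ((hd (k + 1)).continuousOn.const_mul _).neg

lemma normSq_one_sub_mul_exp (t θ : ℝ) :
    Complex.normSq (1 - t * Complex.exp (θ * Complex.I)) = (1 - t) ^ 2 + 2 * t * (1 - Real.cos θ) := by
  rw [Complex.normSq_apply]
  simp only [Complex.sub_re, Complex.one_re, Complex.re_ofReal_mul, Complex.exp_ofReal_mul_I_re,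
    Complex.sub_im, Complex.one_im, Complex.im_ofReal_mul, Complex.exp_ofReal_mul_I_im]
  linear_combination t ^ 2 * Real.sin_sq_add_cos_sq θ

lemma one_sub_cos_bounds {θ : ℝ} (h0 : 0 < θ) (hπ : θ ≤ Real.pi) :
    θ ^ 2 / 5 ≤ 1 - Real.cos θ ∧ 1 - Real.cos θ ≤ θ ^ 2 / 2 := by
  constructor
  · have h1 := Real.cos_le_one_sub_mul_cos_sq (x := θ) (by rw [abs_of_pos h0]; exact hπ)
    have h2 : Real.pi ^ 2 < 10 := by nlinarith [Real.pi_lt_d2, Real.pi_pos]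
    -- The constant `1/5` is `2/π²` rounded down through `π² < 10`.
    have h3 : (1 : ℝ) / 5 ≤ 2 / Real.pi ^ 2 := by
      rw [div_le_div_iff₀ (by norm_num) (by positivity)]; linarith
    nlinarith [sq_nonneg θ]
  · linarith [Real.one_sub_sq_div_two_le_cos (x := θ)]

lemma norm_one_sub_mul_exp_le {t θ : ℝ} (ht : t ∈ Set.Icc (0 : ℝ) 1) (h0 : 0 < θ)
    (hπ : θ ≤ Real.pi) : ‖1 - t * Complex.exp (θ * Complex.I)‖ ≤ 1 - t + θ := by
  have h1 := ht.1
  have h2 := ht.2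
  refine abs_le_of_sq_le_sq' ?_ (by linarith) |>.2
  rw [Complex.sq_norm, normSq_one_sub_mul_exp]
  have h3 := (one_sub_cos_bounds h0 hπ).2
  have h4 : 0 ≤ 1 - Real.cos θ := by linarith [Real.cos_le_one θ]
  nlinarith [mul_nonneg (sub_nonneg.2 h2) h0.le]

/-- For `t ≤ 1/2` the distance is at least `1 - t ≥ 1/2`, which dominates the bounded `θ`; for `t ≥
1/2` the term `2t(1 - cos θ)` is at least `θ²/5`. -/
lemma le_norm_one_sub_mul_exp {t θ : ℝ} (ht : t ∈ Set.Icc (0 : ℝ) 1) (h0 : 0 < θ)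
    (hπ : θ ≤ Real.pi) : 1 - t + θ ≤ 8 * ‖1 - t * Complex.exp (θ * Complex.I)‖ := by
  have h1 := ht.1
  have h2 := ht.2
  refine abs_le_of_sq_le_sq' ?_ (by positivity) |>.2
  rw [mul_pow, Complex.sq_norm, normSq_one_sub_mul_exp]
  have h3 := (one_sub_cos_bounds h0 hπ).1
  have h4 : Real.pi < 3.15 := Real.pi_lt_d2
  rcases le_total t (1 / 2) with h | h
  · have h5 : 1 - t + θ ≤ 8 * (1 - t) := by linarith
    have h6 : (1 - t + θ) ^ 2 ≤ (8 * (1 - t)) ^ 2 := by gcongr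
    have h7 : 0 ≤ 2 * t * (1 - Real.cos θ) := by
      have : 0 ≤ 1 - Real.cos θ := by linarith [Real.cos_le_one θ]
      positivity
    nlinarith
  · have h5 : θ ^ 2 / 5 ≤ 2 * t * (1 - Real.cos θ) := by nlinarith [sq_nonneg θ]
    nlinarith [sq_nonneg ((1 - t) - θ), sq_nonneg (1 - t), sq_nonneg θ]

lemma exp_mul_I_mem_slitSet {θ : ℝ} (h : Complex.exp (θ * Complex.I) ≠ 1) :
    Complex.exp (θ * Complex.I) ∈ slitSet := by
  intro t ht hcon
  have h1 := normSq_one_sub_mul_exp t θ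
  rw [hcon, map_zero] at h1
  have h2 : 0 ≤ 1 - Real.cos θ := by linarith [Real.cos_le_one θ]
  have h3 : 0 ≤ 2 * t * (1 - Real.cos θ) := mul_nonneg (by linarith [ht.1]) h2
  have h4 : (1 - t) = 0 := by nlinarith [sq_nonneg (1 - t)]
  have h5 : t = 1 := by linarith
  rw [h5] at hcon
  apply h
  push_cast at hcon
  linear_combination -hcon

lemma exp_mul_I_mem_slitSet_of_pos {θ : ℝ} (h0 : 0 < θ) (hπ : θ ≤ Real.pi) :
    Complex.exp (θ * Complex.I) ∈ slitSet :=
  exp_mul_I_mem_slitSet (exp_mul_I_ne_one ⟨h0, by linarith [Real.pi_pos]⟩)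

lemma norm_cauchyInt_le [IsFiniteMeasure m] (hm : ∀ᵐ t ∂m, t ∈ Set.Ico (0 : ℝ) 1) (k : ℕ)
    {θ : ℝ} (h0 : 0 < θ) (hπ : θ ≤ Real.pi) :
    ‖cauchyInt m k (Complex.exp (θ * Complex.I))‖ ≤ 8 ^ (k + 1) * stieltjesInt m k θ := by
  rw [stieltjesInt, ← integral_const_mul]
  refine norm_integral_le_of_norm_le ((integrable_stieltjes hm k h0).const_mul _) ?_
  filter_upwards [hm] with t ht
  have ht' : t ∈ Set.Icc (0 : ℝ) 1 := ⟨ht.1, ht.2.le⟩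
  have hp : 0 < 1 - t + θ := by linarith [ht.2]
  refine (norm_cauchyKernel_le ht' (ε := (1 - t + θ) / 8) (by positivity) ?_ k).trans_eq ?_
  · linarith [le_norm_one_sub_mul_exp ht' h0 hπ]
  · rw [div_pow]; field_simp

lemma re_one_div_one_sub (t θ : ℝ) :
    (1 / (1 - t * Complex.exp (θ * Complex.I))).re =
      (1 - t * Real.cos θ) / Complex.normSq (1 - t * Complex.exp (θ * Complex.I)) := by
  rw [one_div, Complex.inv_re]
  simp only [Complex.sub_re, Complex.one_re, Complex.re_ofReal_mul, Complex.exp_ofReal_mul_I_re]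

lemma im_one_div_one_sub (t θ : ℝ) :
    (1 / (1 - t * Complex.exp (θ * Complex.I))).im =
      t * Real.sin θ / Complex.normSq (1 - t * Complex.exp (θ * Complex.I)) := by
  rw [one_div, Complex.inv_im]
  simp only [Complex.sub_im, Complex.one_im, Complex.im_ofReal_mul, Complex.exp_ofReal_mul_I_im]
  ring

lemma re_cauchyInt [IsFiniteMeasure m] (hm : ∀ᵐ t ∂m, t ∈ Set.Ico (0 : ℝ) 1)
    {z : ℂ} (hz : z ∈ slitSet) : (cauchyInt m 0 z).re = ∫ t : ℝ, (1 / (1 - t * z)).re ∂m := by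
  have h := integrable_cauchyKernel hm 0 hz
  have := integral_re h
  simp only [pow_zero, zero_add, pow_one, RCLike.re_eq_complex_re] at this
  rw [cauchyInt, this]
  simp

lemma im_cauchyInt [IsFiniteMeasure m] (hm : ∀ᵐ t ∂m, t ∈ Set.Ico (0 : ℝ) 1)
    {z : ℂ} (hz : z ∈ slitSet) : (cauchyInt m 0 z).im = ∫ t : ℝ, (1 / (1 - t * z)).im ∂m := by
  have h := integrable_cauchyKernel hm 0 hz
  have := integral_im h
  simp only [pow_zero, zero_add, pow_one, RCLike.im_eq_complex_im] at this
  rw [cauchyInt, this]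
  simp

lemma integrable_one_div_one_sub [IsFiniteMeasure m] (hm : ∀ᵐ t ∂m, t ∈ Set.Ico (0 : ℝ) 1)
    {z : ℂ} (hz : z ∈ slitSet) : Integrable (fun t : ℝ => 1 / (1 - t * z)) m := by
  simpa using integrable_cauchyKernel hm 0 hz

lemma normSq_one_sub_mul_exp_bounds {t θ : ℝ} (ht : t ∈ Set.Icc (0 : ℝ) 1) (h0 : 0 < θ)
    (hπ : θ ≤ Real.pi) :
    (1 - t + θ) ^ 2 / 64 ≤ Complex.normSq (1 - t * Complex.exp (θ * Complex.I)) ∧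
    Complex.normSq (1 - t * Complex.exp (θ * Complex.I)) ≤ (1 - t + θ) ^ 2 := by
  have h1 := le_norm_one_sub_mul_exp ht h0 hπ
  have h2 := norm_one_sub_mul_exp_le ht h0 hπ
  have hp : 0 < 1 - t + θ := by linarith [ht.2]
  rw [Complex.normSq_eq_norm_sq]
  constructor <;> nlinarith [norm_nonneg (1 - t * Complex.exp (θ * Complex.I))]

lemma stieltjesRe_le_re_cauchyInt [IsFiniteMeasure m] (hm : ∀ᵐ t ∂m, t ∈ Set.Ico (0 : ℝ) 1)
    {θ : ℝ} (h0 : 0 < θ) (hπ : θ ≤ Real.pi) :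
    stieltjesRe m θ ≤ (cauchyInt m 0 (Complex.exp (θ * Complex.I))).re := by
  have hz := exp_mul_I_mem_slitSet_of_pos h0 hπ
  rw [re_cauchyInt hm hz]
  refine integral_mono_ae (integrable_stieltjesRe hm h0)
    (integrable_one_div_one_sub hm hz).re ?_
  filter_upwards [hm] with t ht
  have ht' : t ∈ Set.Icc (0 : ℝ) 1 := ⟨ht.1, ht.2.le⟩
  obtain ⟨h1, h2⟩ := normSq_one_sub_mul_exp_bounds ht' h0 hπ
  have hp : 0 < 1 - t + θ := by linarith [ht.2]
  have hp2 : 0 < Complex.normSq (1 - t * Complex.exp (θ * Complex.I)) :=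
    lt_of_lt_of_le (by positivity) h1
  rw [re_one_div_one_sub]
  have h3 : 1 - t ≤ 1 - t * Real.cos θ := by nlinarith [Real.cos_le_one θ, ht.1]
  have h4 : 0 ≤ 1 - t := by linarith [ht.2]
  gcongr
  linarith

/-- The numerator of the real part exceeds `1 - t` only by `t(1 - cos θ) = O(θ²)`, hence by at most
`θ(1 - t + θ)`. The resulting extra term `θ R(θ)` carries a small factor and is absorbed later for
small `θ`. -/
lemma re_cauchyInt_le [IsFiniteMeasure m] (hm : ∀ᵐ t ∂m, t ∈ Set.Ico (0 : ℝ) 1)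
    {θ : ℝ} (h0 : 0 < θ) (hπ : θ ≤ Real.pi) :
    (cauchyInt m 0 (Complex.exp (θ * Complex.I))).re ≤
      64 * (stieltjesRe m θ + θ * stieltjesInt m 0 θ) := by
  have hz := exp_mul_I_mem_slitSet_of_pos h0 hπ
  rw [re_cauchyInt hm hz, stieltjesRe, stieltjesInt, ← integral_const_mul, ← integral_add
    (integrable_stieltjesRe hm h0) ((integrable_stieltjes hm 0 h0).const_mul _),
    ← integral_const_mul]
  refine integral_mono_ae (integrable_one_div_one_sub hm hz).re
    (((integrable_stieltjesRe hm h0).add ((integrable_stieltjes hm 0 h0).const_mul _)).const_mul _) ?_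
  filter_upwards [hm] with t ht
  have ht' : t ∈ Set.Icc (0 : ℝ) 1 := ⟨ht.1, ht.2.le⟩
  obtain ⟨h1, h2⟩ := normSq_one_sub_mul_exp_bounds ht' h0 hπ
  have hp : 0 < 1 - t + θ := by linarith [ht.2]
  rw [re_one_div_one_sub]
  have h3 : 1 - t * Real.cos θ ≤ 1 - t + θ * (1 - t + θ) := by
    have h5 := (one_sub_cos_bounds h0 hπ).2
    have h6 : 0 ≤ 1 - Real.cos θ := by linarith [Real.cos_le_one θ]
    nlinarith [ht.1, ht.2, mul_nonneg h0.le (sub_nonneg.2 ht'.2)]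
  have h4 : 0 ≤ 1 - t := by linarith [ht.2]
  calc _ ≤ (1 - t + θ * (1 - t + θ)) / ((1 - t + θ) ^ 2 / 64) := by
        gcongr
    _ = _ := by
        simp only [zero_add, pow_one]
        field_simp

/-- The real part sees `1 - t` and the imaginary part sees `t sin θ ≥ tθ/2`; together they recover
`1 - t + θ` because `θ ≤ 1`. Hence `R(θ)` is at most a multiple of `|G|`, the converse of
`norm_cauchyInt_le`. -/
lemma stieltjesInt_le_re_add_im [IsFiniteMeasure m] (hm : ∀ᵐ t ∂m, t ∈ Set.Ico (0 : ℝ) 1)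
    {θ : ℝ} (h0 : 0 < θ) (h1 : θ ≤ 1) :
    stieltjesInt m 0 θ ≤ 4 * ((cauchyInt m 0 (Complex.exp (θ * Complex.I))).re +
      (cauchyInt m 0 (Complex.exp (θ * Complex.I))).im) := by
  have hπ : θ ≤ Real.pi := by linarith [Real.pi_gt_three]
  have hz := exp_mul_I_mem_slitSet_of_pos h0 hπ
  have hi := integrable_one_div_one_sub hm hz
  have hadd := integral_add hi.re hi.im
  simp only [RCLike.re_eq_complex_re, RCLike.im_eq_complex_im] at hadd
  rw [re_cauchyInt hm hz, im_cauchyInt hm hz, ← hadd, ← integral_const_mul]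
  refine integral_mono_ae (integrable_stieltjes hm 0 h0) ((hi.re.add hi.im).const_mul _) ?_
  filter_upwards [hm] with t ht
  have ht' : t ∈ Set.Icc (0 : ℝ) 1 := ⟨ht.1, ht.2.le⟩
  obtain ⟨h2, h3⟩ := normSq_one_sub_mul_exp_bounds ht' h0 hπ
  have hp : 0 < 1 - t + θ := by linarith [ht.2]
  have hp2 : 0 < Complex.normSq (1 - t * Complex.exp (θ * Complex.I)) :=
    lt_of_lt_of_le (by positivity) h2
  rw [re_one_div_one_sub, im_one_div_one_sub, ← add_div, zero_add, pow_one, mul_div_assoc',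
    div_le_div_iff₀ hp hp2, one_mul]
  refine h3.trans ?_
  have h5 : θ / 2 ≤ Real.sin θ := by
    have := Real.mul_le_sin h0.le (by linarith [Real.pi_gt_three])
    refine le_trans ?_ this
    have : (1 : ℝ) / 2 ≤ 2 / Real.pi := by
      rw [div_le_div_iff₀ (by norm_num) Real.pi_pos]; linarith [Real.pi_lt_four]
    nlinarith
  rw [pow_two]
  refine mul_le_mul_of_nonneg_right ?_ hp.le
  have h6 : 1 - t ≤ 1 - t * Real.cos θ := by nlinarith [Real.cos_le_one θ, ht.1]
  nlinarith [ht.1, ht.2, mul_nonneg h0.le (sub_nonneg.2 ht'.2)]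

/-! ### Iterated tails and the integral representation of the Fourier transform -/

lemma tsum_int_of_support {E : Type*} [NormedAddCommGroup E] [CompleteSpace E] {f : ℤ → E}
    (hf : Summable f) (h0 : ∀ n < -1, f n = 0) :
    ∑' n : ℤ, f n = f (-1) + ∑' n : ℕ, f n := by
  have h1 : Summable fun n : ℕ => f n := hf.comp_injective Nat.cast_injective
  have h2 : Summable fun n : ℕ => f (-(n + 1 : ℤ)) :=
    hf.comp_injective (i := fun n : ℕ => -(n + 1 : ℤ)) fun a b h => by simpa using h
  rw [tsum_of_nat_of_neg_add_one h1 h2, add_comm]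
  congr 1
  rw [tsum_eq_single 0]
  · simp
  · intro n hn
    exact h0 _ (by omega)

section Sequences

variable {p : ℕ → ℝ}

/-- The tails of a sequence. -/
def tailSum (p : ℕ → ℝ) (n : ℕ) : ℝ := ∑' j : ℕ, p (n + 1 + j)

/-- The iterated tails of a sequence. -/
def tailSum₂ (p : ℕ → ℝ) (n : ℕ) : ℝ := ∑' j : ℕ, ((j : ℝ) + 1) * p (n + 1 + j)

lemma summable_of_summable_natCast_mul (h0 : ∀ n, 0 ≤ p n) (hp : Summable fun k : ℕ => (k : ℝ) * p k) :
    Summable p := by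
  refine Summable.of_norm_bounded_eventually_nat hp ?_
  filter_upwards [eventually_ge_atTop 1] with n hn
  rw [Real.norm_of_nonneg (h0 n)]
  exact le_mul_of_one_le_left (h0 n) (by exact_mod_cast hn)

lemma summable_tail (hp : Summable p) (n : ℕ) : Summable fun j : ℕ => p (n + j) :=
  hp.comp_injective (add_right_injective n)

lemma summable_tail₂ (h0 : ∀ n, 0 ≤ p n) (hp : Summable fun k : ℕ => (k : ℝ) * p k) (n : ℕ) :
    Summable fun j : ℕ => ((j : ℝ) + 1) * p (n + 1 + j) := by
  refine Summable.of_nonneg_of_le (fun j => mul_nonneg (by positivity) (h0 _)) (fun j => ?_)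
    (hp.comp_injective (add_right_injective (n + 1)))
  simp only [Function.comp]
  refine mul_le_mul_of_nonneg_right ?_ (h0 _)
  push_cast
  linarith [(Nat.cast_nonneg n : (0 : ℝ) ≤ n)]

lemma tailSum_sub (hp : Summable p) (n : ℕ) : tailSum p n - tailSum p (n + 1) = p (n + 1) := by
  rw [tailSum, (summable_tail hp (n + 1)).tsum_eq_zero_add, tailSum, add_zero]
  have : ∀ j : ℕ, p (n + 1 + (j + 1)) = p (n + 1 + 1 + j) := fun j => by congr 1; ring
  simp only [this]
  ring

lemma tailSum₂_sub (h0 : ∀ n, 0 ≤ p n) (hp : Summable fun k : ℕ => (k : ℝ) * p k) (n : ℕ) :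
    tailSum₂ p n - tailSum₂ p (n + 1) = tailSum p n := by
  rw [tailSum₂, tailSum₂, tailSum, (summable_tail₂ h0 hp n).tsum_eq_zero_add]
  have hs := summable_of_summable_natCast_mul h0 hp
  have e : ∀ j : ℕ, (((j + 1 : ℕ) : ℝ) + 1) * p (n + 1 + (j + 1)) =
      ((j : ℝ) + 1) * p (n + 1 + 1 + j) + p (n + 1 + (j + 1)) := by
    intro j
    rw [show n + 1 + (j + 1) = n + 1 + 1 + j by ring]
    push_cast; ring
  simp only [e]
  have hs' : Summable fun j : ℕ => p (n + 1 + (j + 1)) :=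
    (summable_nat_add_iff 1).2 (summable_tail hs (n + 1))
  rw [(summable_tail₂ h0 hp (n + 1)).tsum_add hs',
    (summable_tail hs (n + 1)).tsum_eq_zero_add]
  simp
  ring

lemma tailSum₂_eq_sub (h0 : ∀ n, 0 ≤ p n) (hp : Summable fun k : ℕ => (k : ℝ) * p k) (n : ℕ) :
    ∑' j : ℕ, ((n + 1 + j : ℕ) : ℝ) * p (n + 1 + j) = n * tailSum p n + tailSum₂ p n := by
  have hs := summable_of_summable_natCast_mul h0 hp
  rw [tailSum, tailSum₂, ← tsum_mul_left, ← ((summable_tail hs (n + 1)).mul_left _).tsum_add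
    (summable_tail₂ h0 hp n)]
  refine tsum_congr fun j => ?_
  push_cast; ring

lemma tendsto_tailSum₂ (h0 : ∀ n, 0 ≤ p n) (hp : Summable fun k : ℕ => (k : ℝ) * p k) :
    Tendsto (tailSum₂ p) atTop (𝓝 0) := by
  have h1 := (tendsto_sum_nat_add fun k : ℕ => (k : ℝ) * p k).comp (tendsto_add_atTop_nat 1)
  refine squeeze_zero (fun n => tsum_nonneg fun j => mul_nonneg (by positivity) (h0 _))
    (fun n => ?_) h1
  simp only [Function.comp, tailSum₂]
  have e : ∀ j : ℕ, ((j + (n + 1) : ℕ) : ℝ) * p (j + (n + 1)) =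
      ((n + 1 + j : ℕ) : ℝ) * p (n + 1 + j) := fun j => by rw [add_comm j]
  simp only [e]
  refine (summable_tail₂ h0 hp n).tsum_le_tsum (fun j => ?_)
    (hp.comp_injective (add_right_injective (n + 1)))
  refine mul_le_mul_of_nonneg_right ?_ (h0 _)
  push_cast
  linarith [(Nat.cast_nonneg n : (0 : ℝ) ≤ n)]

/-- The first two differences of the iterated tails are the tails and the shifted sequence, so all
further differences are differences of `p`. -/
lemma completelyMonotone_tailSum₂ (hcm : CompletelyMonotone p)
    (hp : Summable fun k : ℕ => (k : ℝ) * p k) : CompletelyMonotone (tailSum₂ p) := by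
  have h0 : ∀ n, 0 ≤ p n := fun n => hcm 0 n
  have hs := summable_of_summable_natCast_mul h0 hp
  have e1 : diffOp (tailSum₂ p) = tailSum p := funext fun n => tailSum₂_sub h0 hp n
  have e2 : diffOp (tailSum p) = fun n => p (n + 1) := funext fun n => tailSum_sub hs n
  have e3 : ∀ m n, (diffOp^[m] fun n => p (n + 1)) n = (diffOp^[m] p) (n + 1) := by
    intro m
    induction m with
    | zero => intro n; rfl
    | succ m ih => intro n; rw [diffOp_iterate_succ, diffOp_iterate_succ, ih, ih]
  intro m n
  match m with
  | 0 => exact tsum_nonneg fun j => mul_nonneg (by positivity) (h0 _)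
  | 1 =>
    rw [Function.iterate_one, e1]
    exact tsum_nonneg fun j => h0 _
  | m + 2 =>
    rw [Function.iterate_add_apply, Function.iterate_succ_apply, Function.iterate_one, e1, e2, e3]
    exact hcm _ _

end Sequences

variable {m : Measure ℝ}

lemma integrable_pow [IsFiniteMeasure m] (hm : ∀ᵐ t ∂m, t ∈ Set.Ico (0 : ℝ) 1) (n : ℕ) :
    Integrable (fun t : ℝ => t ^ n) m := by
  refine Integrable.of_bound (C := 1) (by fun_prop) ?_
  filter_upwards [hm] with t ht
  rw [norm_pow, Real.norm_of_nonneg ht.1]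
  exact pow_le_one₀ ht.1 ht.2.le

/-- On the unit circle the integrals of the norms are the `q n`, so summability of `q` alone
justifies exchanging sum and integral, however much mass `m` has near `1`. -/
lemma hasSum_integral_geometric [IsFiniteMeasure m] (hm : ∀ᵐ t ∂m, t ∈ Set.Ico (0 : ℝ) 1)
    {z : ℂ} (hz : ‖z‖ = 1) {q : ℕ → ℝ} (hq : Summable q)
    (hqm : ∀ n, q n = ∫ t, t ^ n * (1 - t) ^ 2 ∂m) :
    HasSum (fun n => (q n : ℂ) * z ^ (n + 1))
      (∫ t : ℝ, z * (1 - t) ^ 2 / (1 - t * z) ∂m) := by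
  have hI : ∀ n : ℕ, Integrable (fun t : ℝ => t ^ n * (1 - t) ^ 2) m := fun n => by
    refine Integrable.of_bound (C := 1) (Measurable.aestronglyMeasurable (by fun_prop)) ?_
    filter_upwards [hm] with t ht
    rw [norm_mul, norm_pow, norm_pow, Real.norm_of_nonneg ht.1,
      Real.norm_of_nonneg (sub_nonneg.2 ht.2.le)]
    have h1 : t ^ n ≤ 1 := pow_le_one₀ ht.1 ht.2.le
    have h2 : (1 - t) ^ 2 ≤ 1 := pow_le_one₀ (by linarith [ht.2]) (by linarith [ht.1])
    exact mul_le_one₀ h1 (by positivity) h2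
  have hint : ∀ n : ℕ, Integrable (fun t : ℝ => ((t ^ n * (1 - t) ^ 2 : ℝ) : ℂ) * z ^ (n + 1)) m :=
    fun n => (hI n).ofReal.mul_const _
  have hnorm : ∀ n : ℕ, ∫ t : ℝ, ‖((t ^ n * (1 - t) ^ 2 : ℝ) : ℂ) * z ^ (n + 1)‖ ∂m = q n := by
    intro n
    rw [hqm]
    refine integral_congr_ae ?_
    filter_upwards [hm] with t ht
    rw [norm_mul, norm_pow, hz, one_pow, mul_one, Complex.norm_real, Real.norm_of_nonneg]
    exact mul_nonneg (pow_nonneg ht.1 _) (by positivity)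
  have key := hasSum_integral_of_summable_integral_norm hint (by simpa only [hnorm] using hq)
  have e1 : ∀ n : ℕ, ∫ t : ℝ, ((t ^ n * (1 - t) ^ 2 : ℝ) : ℂ) * z ^ (n + 1) ∂m
      = (q n : ℂ) * z ^ (n + 1) := by
    intro n
    rw [integral_mul_const, integral_complex_ofReal, hqm]
  simp only [e1] at key
  convert! key using 1
  refine integral_congr_ae ?_
  filter_upwards [hm] with t ht
  have hlt : ‖(t : ℂ) * z‖ < 1 := by
    rw [norm_mul, hz, mul_one, Complex.norm_real, Real.norm_of_nonneg ht.1]; exact ht.2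
  have e2 : ∀ n : ℕ, ((t ^ n * (1 - t) ^ 2 : ℝ) : ℂ) * z ^ (n + 1) =
      z * (1 - t) ^ 2 * ((t : ℂ) * z) ^ n := by
    intro n; push_cast; ring
  simp only [e2]
  rw [tsum_mul_left, tsum_geometric_of_norm_lt_one hlt, div_eq_mul_inv]

/-- The data attached to a centered measure on `{-1, 0, 1, …}` whose restriction to `ℕ` is
completely monotone: the measure `m` on `[0, 1)` whose moments are the iterated tails. -/
structure IsRepresentedBy (μ : Measure ℤ) (m : Measure ℝ) : Prop where
  finite : IsFiniteMeasure m
  ae_mem : ∀ᵐ t ∂m, t ∈ Set.Ico (0 : ℝ) 1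
  pos : 0 < m.real Set.univ
  mass_succ : ∀ n : ℕ, mass μ (n + 1 : ℕ) = ∫ t, t ^ n * (1 - t) ^ 2 ∂m
  tail : ∀ n : ℕ, ∑' k : Set.Ici (n + 1), ((k : ℕ) : ℝ) * mass μ ((k : ℕ) : ℤ) =
    ∫ t, t ^ n * (1 + n * (1 - t)) ∂m
  hat_eq : ∀ θ : ℝ, Complex.exp (θ * Complex.I) ≠ 1 →
    hat μ θ = 1 - (2 - 2 * Real.cos θ : ℝ) * cauchyInt m 0 (Complex.exp (θ * Complex.I))

lemma eq_dirac_zero_of_mass (μ : Measure ℤ) [IsProbabilityMeasure μ]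
    (h : ∀ n : ℤ, n ≠ 0 → mass μ n = 0) : μ = Measure.dirac 0 := by
  have h1 : mass μ 0 = 1 := by
    rw [← tsum_mass μ, tsum_eq_single 0 h]
  refine Measure.ext_of_singleton fun n => ?_
  by_cases hn : n = 0
  · subst hn
    rw [← ENNReal.toReal_eq_toReal_iff' (by finiteness) (by finiteness)]
    simpa [mass, Measure.real] using h1
  · rw [← ENNReal.toReal_eq_toReal_iff' (by finiteness) (by finiteness)]
    have := h n hn
    simp only [mass, Measure.real] at this
    rw [this]
    simp [Ne.symm hn]

lemma exists_isRepresentedBy (μ : Measure ℤ) [IsProbabilityMeasure μ] (hcent : Centered μ)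
    (hsupp : ∀ n : ℤ, n < -1 → mass μ n = 0)
    (hcm : CompletelyMonotone (fun n : ℕ => mass μ (n : ℤ))) (hne : μ ≠ Measure.dirac 0) :
    ∃ m : Measure ℝ, IsRepresentedBy μ m := by
  set p : ℕ → ℝ := fun n => mass μ (n : ℤ) with hp
  have h0 : ∀ n, 0 ≤ p n := fun n => mass_nonneg μ _
  have hs1 : Summable fun k : ℕ => (k : ℝ) * p k := by
    have := hcent.1.comp_injective (Nat.cast_injective (R := ℤ))
    simpa [Function.comp_def] using this
  have hs := summable_of_summable_natCast_mul h0 hs1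
  have hmean : ∑' k : ℕ, (k : ℝ) * p k = mass μ (-1) := by
    have h1 : Summable fun n : ℤ => (n : ℝ) * mass μ n :=
      Summable.of_norm (by simpa [abs_of_nonneg (mass_nonneg μ _)] using hcent.1)
    have h2 := tsum_int_of_support h1 fun n hn => by rw [hsupp n hn, mul_zero]
    rw [hcent.2] at h2
    simp only [Int.cast_natCast] at h2
    push_cast at h2
    change _ = _ + ∑' k : ℕ, (k : ℝ) * p k at h2
    linarith
  have htot : mass μ (-1) + ∑' k, p k = 1 := by
    rw [← tsum_mass μ, tsum_int_of_support (summable_mass μ) hsupp]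
  have ha0 : tailSum₂ p 0 = mass μ (-1) := by
    have := tailSum₂_eq_sub h0 hs1 0
    rw [Nat.cast_zero, zero_mul, zero_add, zero_add] at this
    rw [← this, ← hmean, hs1.tsum_eq_zero_add]
    simp [add_comm]
  -- Total mass one, with `μ(-1) = a 0` and `∑_{k ≥ 1} p k = a 0 - a 1`.
  have hp0 : p 0 = 1 - 2 * tailSum₂ p 0 + tailSum₂ p 1 := by
    have h1 := tailSum₂_sub h0 hs1 0
    have h2 : tailSum p 0 = ∑' k, p k - p 0 := by
      rw [hs.tsum_eq_zero_add, tailSum]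
      simp [add_comm]
    simp only [zero_add] at h1
    linarith
  -- If `μ(-1) = 0`, then mean zero forces all mass on the positive integers to vanish,
  -- contradicting `μ ≠ δ₀`.
  have hpos : 0 < tailSum₂ p 0 := by
    rw [ha0]
    refine lt_of_le_of_ne (mass_nonneg μ _) fun hcon => hne (eq_dirac_zero_of_mass μ ?_)
    have hz : ∀ k : ℕ, (k : ℝ) * p k = 0 := by
      have h3 : HasSum (fun k : ℕ => (k : ℝ) * p k) 0 := by
        have := hs1.hasSum
        rwa [hmean, ← hcon] at this
      have := (hasSum_zero_iff_of_nonneg fun k => mul_nonneg (Nat.cast_nonneg k) (h0 k)).1 h3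
      exact fun k => congrFun this k
    intro n hn
    rcases lt_trichotomy n (-1) with h | h | h
    · exact hsupp n h
    · rw [h, ← hcon]
    · obtain ⟨k, rfl⟩ := Int.eq_ofNat_of_zero_le (by omega : 0 ≤ n)
      have hk : (k : ℝ) ≠ 0 := by
        rintro h
        apply hn
        exact_mod_cast h
      exact (mul_eq_zero.1 (hz k)).resolve_left hk
  obtain ⟨m, hfin, hm, hmom⟩ := (completelyMonotone_tailSum₂ hcm hs1).exists_measure_Ico hpos
    (tendsto_tailSum₂ h0 hs1)
  have hI := fun n => integrable_pow hm n
  have hsucc : ∀ n : ℕ, p (n + 1) = ∫ t, t ^ n * (1 - t) ^ 2 ∂m := by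
    intro n
    have e : ∀ t : ℝ, t ^ n * (1 - t) ^ 2 = (t ^ n - 2 * t ^ (n + 1)) + t ^ (n + 2) := fun t => by
      ring
    simp only [e]
    have hsub : Integrable (fun t : ℝ => t ^ n - 2 * t ^ (n + 1)) m :=
      (hI n).sub ((hI _).const_mul _)
    rw [integral_add hsub (hI _),
      integral_sub (hI n) ((hI _).const_mul _), integral_const_mul, hmom, hmom, hmom,
      ← tailSum_sub hs, ← tailSum₂_sub h0 hs1, ← tailSum₂_sub h0 hs1]
    ring
  refine ⟨m, hfin, hm, ?_, hsucc, ?_, ?_⟩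
  · have := hmom 0
    simp only [pow_zero, integral_const, smul_eq_mul, mul_one] at this
    rw [this]; exact hpos
  · intro n
    have e1 : ∑' k : Set.Ici (n + 1), ((k : ℕ) : ℝ) * mass μ ((k : ℕ) : ℤ) =
        ∑' j : ℕ, ((n + 1 + j : ℕ) : ℝ) * p (n + 1 + j) := by
      let e : ℕ ≃ Set.Ici (n + 1) :=
        { toFun := fun j => ⟨n + 1 + j, Nat.le_add_right _ _⟩
          invFun := fun k => k - (n + 1)
          left_inv := fun j => by simp
          right_inv := fun k => by
            ext
            have : n + 1 ≤ (k : ℕ) := k.2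
            simp only
            omega }
      rw [← e.tsum_eq]
      rfl
    have hsub : Integrable (fun t : ℝ => t ^ n - t ^ (n + 1)) m := (hI n).sub (hI _)
    rw [e1, tailSum₂_eq_sub h0 hs1, ← tailSum₂_sub h0 hs1, ← hmom, ← hmom, ← integral_sub (hI _)
      (hI _), ← integral_const_mul, ← integral_add (hsub.const_mul _) (hI _)]
    refine integral_congr_ae (Eventually.of_forall fun t => ?_)
    simp only
    ring
  · intro θ hθ
    set z := Complex.exp (θ * Complex.I) with hz
    have hz1 : ‖z‖ = 1 := Complex.norm_exp_ofReal_mul_I θ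
    have hz0 : z ≠ 0 := Complex.exp_ne_zero _
    have hzs : z ∈ slitSet := exp_mul_I_mem_slitSet hθ
    have hterm : ∀ k : ℕ, Complex.exp ((((k : ℤ) : ℝ) * θ : ℝ) * Complex.I) = z ^ k := by
      intro k
      rw [hz, ← Complex.exp_nat_mul]
      push_cast; ring_nf
    have hterm' : Complex.exp ((((-1 : ℤ) : ℝ) * θ : ℝ) * Complex.I) = z⁻¹ := by
      rw [hz, ← Complex.exp_neg]
      push_cast; ring_nf
    have h1 : hat μ θ = mass μ (-1) * z⁻¹ + ∑' k : ℕ, (p k : ℂ) * z ^ k := by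
      rw [hat, tsum_int_of_support (summable_trig (summable_norm_mass μ) θ)
        (fun n hn => by rw [hsupp n hn]; simp), hterm']
      simp only [hterm]
      rfl
    have hpz : Summable fun k : ℕ => (p k : ℂ) * z ^ k := by
      refine Summable.of_norm ?_
      simpa [hz1, abs_of_nonneg (h0 _)] using hs
    have hgeo := hasSum_integral_geometric hm hz1 ((summable_nat_add_iff 1).2 hs) hsucc
    have hker := integrable_one_div_one_sub hm hzs
    have hIt : Integrable (fun t : ℝ => (t : ℂ)) m := by
      simpa using (hI 1).ofReal (𝕜 := ℂ)
    have hcos : ((2 - 2 * Real.cos θ : ℝ) : ℂ) = 2 - z - z⁻¹ := by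
      rw [hz, ← Complex.exp_neg]
      push_cast
      rw [Complex.cos]
      ring_nf
    -- Division with remainder in `t`: `z(1 - t)² = -(2 - z - z⁻¹) - (z⁻¹ - 2 + t)(1 - t z)`. The
    -- integral of the remainder cancels against the contributions of `μ(-1)` and `μ(0)`, up to the
    -- constant `1`.
    have hint : ∫ t : ℝ, z * (1 - t) ^ 2 / (1 - t * z) ∂m =
        -(2 - z - z⁻¹) * cauchyInt m 0 z - ((tailSum₂ p 0 : ℂ) * (z⁻¹ - 2) + tailSum₂ p 1) := by
      have e1 : (tailSum₂ p 0 : ℂ) * (z⁻¹ - 2) = ∫ _ : ℝ, (z⁻¹ - 2) ∂m := by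
        have := hmom 0
        simp only [pow_zero, integral_const, smul_eq_mul, mul_one] at this
        rw [integral_const, this, Complex.real_smul]
      have e2 : (tailSum₂ p 1 : ℂ) = ∫ t : ℝ, (t : ℂ) ∂m := by
        rw [integral_complex_ofReal, ← hmom 1]
        simp
      have e3 : cauchyInt m 0 z = ∫ t : ℝ, 1 / (1 - t * z) ∂m := by simp [cauchyInt]
      rw [e1, e2, e3, ← integral_const_mul, ← integral_add (integrable_const _) hIt,
        ← integral_sub (hker.const_mul _) ((integrable_const _).fun_add hIt)]
      refine integral_congr_ae ?_
      filter_upwards [hm] with t ht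
      have hne : (1 : ℂ) - t * z ≠ 0 := hzs t ⟨ht.1, ht.2.le⟩
      have hu := inv_mul_cancel₀ hne
      have hv := mul_inv_cancel₀ hz0
      rw [div_eq_mul_inv, one_div]
      linear_combination (-((1 - t * z)⁻¹ * t)) * hv - (z⁻¹ - 2 + t) * hu
    rw [h1, hpz.tsum_eq_zero_add, hgeo.tsum_eq, hint, hcos, ← ha0, hp0]
    push_cast
    ring

/-! ### Pointwise comparison of the moment kernels with the Stieltjes kernels -/

section Kernels

/-- The kernel of the truncated second moment `∑_{1 ≤ k ≤ n} k² μ(k)`. -/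
def truncKernel (n : ℕ) (t : ℝ) : ℝ := ∑ i ∈ range n, ((i : ℝ) + 1) ^ 2 * (t ^ i * (1 - t) ^ 2)

/-- The kernel of the tail `∑_{k ≥ N + 1} k μ(k)`, multiplied by `N + 1`. -/
def tailKernel (N : ℕ) (t : ℝ) : ℝ := ((N : ℝ) + 1) * (t ^ N * (1 + N * (1 - t)))

variable {t : ℝ}

lemma sum_choose_mul_pow_le (ht : t ∈ Set.Ico (0 : ℝ) 1) (k n : ℕ) :
    ∑ i ∈ range n, ((i + k).choose k : ℝ) * t ^ i ≤ 1 / (1 - t) ^ (k + 1) := by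
  have h := hasSum_choose_mul_geometric_of_norm_lt_one k
    (r := t) (by rw [Real.norm_of_nonneg ht.1]; exact ht.2)
  exact sum_le_hasSum _ (fun i _ => mul_nonneg (Nat.cast_nonneg _) (pow_nonneg ht.1 _)) h

lemma truncKernel_nonneg (ht : t ∈ Set.Ico (0 : ℝ) 1) (n : ℕ) : 0 ≤ truncKernel n t :=
  Finset.sum_nonneg fun i _ => mul_nonneg (by positivity)
    (mul_nonneg (pow_nonneg ht.1 _) (sq_nonneg _))

lemma truncKernel_le_div (ht : t ∈ Set.Ico (0 : ℝ) 1) (n : ℕ) :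
    truncKernel n t ≤ 2 / (1 - t) := by
  have hs : 0 < 1 - t := by linarith [ht.2]
  have h1 : truncKernel n t ≤
      2 * (1 - t) ^ 2 * ∑ i ∈ range n, ((i + 2).choose 2 : ℝ) * t ^ i := by
    rw [truncKernel, Finset.mul_sum]
    refine Finset.sum_le_sum fun i _ => ?_
    have h2 : ((i + 2).choose 2 : ℝ) = (i + 2) * (i + 1) / 2 := by
      rw [Nat.cast_choose_two]; push_cast; ring
    rw [h2]
    have h3 : 0 ≤ t ^ i * (1 - t) ^ 2 := mul_nonneg (pow_nonneg ht.1 _) (sq_nonneg _)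
    have h4 : (0 : ℝ) ≤ i := Nat.cast_nonneg i
    nlinarith
  refine h1.trans ((mul_le_mul_of_nonneg_left (sum_choose_mul_pow_le ht 2 n)
    (by positivity)).trans_eq ?_)
  field_simp

lemma truncKernel_le_cube (ht : t ∈ Set.Ico (0 : ℝ) 1) (n : ℕ) :
    truncKernel n t ≤ (n : ℝ) ^ 3 * (1 - t) ^ 2 := by
  have h1 : truncKernel n t ≤ ∑ i ∈ range n, (n : ℝ) ^ 2 * (1 * (1 - t) ^ 2) := by
    refine Finset.sum_le_sum fun i hi => ?_
    have h2 : (i : ℝ) + 1 ≤ n := by exact_mod_cast Finset.mem_range.1 hi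
    have h3 : t ^ i ≤ 1 := pow_le_one₀ ht.1 ht.2.le
    have h4 : (0 : ℝ) ≤ t ^ i := pow_nonneg ht.1 _
    gcongr
  refine h1.trans_eq ?_
  rw [Finset.sum_const, Finset.card_range, nsmul_eq_mul]
  ring

/-- The right side behaves like `(1 - t)/θ²` for `1 - t` below `θ` and like `1/(1 - t)` above it.
The bound `n³(1 - t)²` handles `n(1 - t) ≤ 1`, and `2/(1 - t)` handles the rest. -/
lemma truncKernel_le (ht : t ∈ Set.Ico (0 : ℝ) 1) {n : ℕ} (hn : 1 ≤ n) {θ : ℝ} (h0 : 0 < θ)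
    (hθ : θ ≤ 2 / n) : truncKernel n t ≤ 18 * ((1 - t) / (1 - t + θ) ^ 2) := by
  have hs : 0 < 1 - t := by linarith [ht.2]
  have hn0 : (0 : ℝ) < n := by exact_mod_cast hn
  rw [le_div_iff₀ hn0] at hθ
  rw [mul_div_assoc', le_div_iff₀ (by positivity)]
  rcases le_total (n * (1 - t)) 1 with h | h
  · have h1 := truncKernel_le_cube ht n
    have h2 : n * (1 - t + θ) ≤ 3 := by linarith
    have h3 : (n * (1 - t + θ)) ^ 2 ≤ 9 := by
      have : 0 ≤ n * (1 - t + θ) := by positivity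
      nlinarith
    calc _ ≤ (n : ℝ) ^ 3 * (1 - t) ^ 2 * (1 - t + θ) ^ 2 := by gcongr
      _ = (n * (1 - t)) * (1 - t) * (n * (1 - t + θ)) ^ 2 := by ring
      _ ≤ 1 * (1 - t) * 9 := by gcongr
      _ ≤ _ := by linarith
  · have h1 := truncKernel_le_div ht n
    have h2 : 1 - t + θ ≤ 3 * (1 - t) := by
      have : n * θ ≤ n * (2 * (1 - t)) := by linarith
      linarith [le_of_mul_le_mul_left this hn0]
    calc _ ≤ 2 / (1 - t) * (3 * (1 - t)) ^ 2 := by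
          have := truncKernel_nonneg ht n
          gcongr
      _ = 18 * (1 - t) := by field_simp; norm_num

lemma cube_div_three_le_sum (j : ℕ) : (j : ℝ) ^ 3 / 3 ≤ ∑ i ∈ range j, ((i : ℝ) + 1) ^ 2 := by
  induction j with
  | zero => simp
  | succ j ih =>
    rw [Finset.sum_range_succ]
    push_cast
    nlinarith [(Nat.cast_nonneg j : (0 : ℝ) ≤ j)]

/-- Only the first `j ~ ε / (2(1 - t))` terms are kept: on these `t^i ≥ 1/2` by Bernoulli's
inequality, and the squares sum to at least `j³/3`. -/
lemma le_truncKernel (ht : t ∈ Set.Ico (0 : ℝ) 1) {n : ℕ} (hn : 1 ≤ n) {ε : ℝ} (h0 : 0 < ε)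
    (h1 : ε ≤ 1) (hs : ε ≤ n * (1 - t)) : ε ^ 3 / 48 / (1 - t) ≤ truncKernel n t := by
  have hs0 : 0 < 1 - t := by linarith [ht.2]
  have hn0 : (1 : ℝ) ≤ n := by exact_mod_cast hn
  set j := ⌈ε / (2 * (1 - t))⌉₊ with hj
  have hj1 : ε / (2 * (1 - t)) ≤ j := Nat.le_ceil _
  have hj2 : (j : ℝ) < ε / (2 * (1 - t)) + 1 := Nat.ceil_lt_add_one (by positivity)
  have hjpos : 1 ≤ j := Nat.one_le_ceil_iff.2 (by positivity)
  have hjn : j ≤ n := by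
    have h2 : ε / (2 * (1 - t)) ≤ n := by
      rw [div_le_iff₀ (by positivity)]
      nlinarith
    exact Nat.ceil_le.2 h2
  have hpow : (1 : ℝ) / 2 ≤ t ^ (j - 1) := by
    have h2 := one_add_mul_le_pow (a := -(1 - t)) (by linarith [ht.1]) (j - 1)
    rw [show 1 + -(1 - t) = t by ring] at h2
    refine le_trans ?_ h2
    rw [Nat.cast_sub hjpos]
    have h3 : ((j : ℝ) - 1) * (1 - t) ≤ 1 / 2 := by
      have : (j : ℝ) - 1 ≤ ε / (2 * (1 - t)) := by linarith
      calc _ ≤ ε / (2 * (1 - t)) * (1 - t) := by gcongr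
        _ = ε / 2 := by field_simp
        _ ≤ 1 / 2 := by linarith
    push_cast
    linarith
  have hsum : truncKernel n t ≥ 1 / 2 * (1 - t) ^ 2 * ∑ i ∈ range j, ((i : ℝ) + 1) ^ 2 := by
    rw [truncKernel, Finset.mul_sum]
    refine le_trans (Finset.sum_le_sum (f := fun i : ℕ => 1 / 2 * (1 - t) ^ 2 * ((i : ℝ) + 1) ^ 2)
      (g := fun i : ℕ => ((i : ℝ) + 1) ^ 2 * (t ^ i * (1 - t) ^ 2)) fun i hi => ?_) ?_
    · have h4 : t ^ (j - 1) ≤ t ^ i :=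
        pow_le_pow_of_le_one ht.1 ht.2.le (by have := Finset.mem_range.1 hi; omega)
      have h5 : 1 / 2 ≤ t ^ i := hpow.trans h4
      have h6 : 0 ≤ (1 - t) ^ 2 * ((i : ℝ) + 1) ^ 2 := by positivity
      nlinarith
    · refine Finset.sum_le_sum_of_subset_of_nonneg (Finset.range_mono hjn) fun i _ _ => ?_
      exact mul_nonneg (by positivity) (mul_nonneg (pow_nonneg ht.1 _) (sq_nonneg _))
  refine le_trans ?_ hsum
  have h7 : (ε / (2 * (1 - t))) ^ 3 / 3 ≤ ∑ i ∈ range j, ((i : ℝ) + 1) ^ 2 := by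
    refine le_trans ?_ (cube_div_three_le_sum j)
    gcongr
  calc _ = 1 / 2 * (1 - t) ^ 2 * ((ε / (2 * (1 - t))) ^ 3 / 3) := by field_simp; norm_num
    _ ≤ _ := by gcongr

lemma tailKernel_nonneg (ht : t ∈ Set.Ico (0 : ℝ) 1) (N : ℕ) : 0 ≤ tailKernel N t := by
  have hs : 0 < 1 - t := by linarith [ht.2]
  have := pow_nonneg ht.1 N
  unfold tailKernel
  positivity

/-- Since `t^N` is the smallest of `t^0, …, t^N`, the products `(N + 1) t^N` and `(N + 1)(N + 2)/2 ·
t^N` are below partial sums of the series for `(1 - t)⁻¹` and `(1 - t)⁻²`. -/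
lemma tailKernel_le_div (ht : t ∈ Set.Ico (0 : ℝ) 1) (N : ℕ) : tailKernel N t ≤ 3 / (1 - t) := by
  have hs : 0 < 1 - t := by linarith [ht.2]
  have hmono : ∀ i ∈ range (N + 1), t ^ N ≤ t ^ i := fun i hi =>
    pow_le_pow_of_le_one ht.1 ht.2.le (by have := Finset.mem_range.1 hi; omega)
  have hN0 : (0 : ℝ) ≤ N := Nat.cast_nonneg N
  have h1 : ((N : ℝ) + 1) * t ^ N ≤ 1 / (1 - t) := by
    have := sum_choose_mul_pow_le ht 0 (N + 1)
    simp only [Nat.choose_zero_right, Nat.cast_one, one_mul, zero_add, pow_one] at this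
    refine le_trans ?_ this
    refine le_trans (le_of_eq ?_) (Finset.sum_le_sum hmono)
    rw [Finset.sum_const, Finset.card_range, nsmul_eq_mul]
    push_cast; ring
  have h2 : ((N : ℝ) + 1) * (N + 2) / 2 * t ^ N ≤ 1 / (1 - t) ^ 2 := by
    have := sum_choose_mul_pow_le ht 1 (N + 1)
    simp only [Nat.choose_one_right, Nat.reduceAdd] at this
    refine le_trans ?_ this
    refine le_trans (le_of_eq ?_) (Finset.sum_le_sum (f := fun i : ℕ => ((i + 1 : ℕ) : ℝ) * t ^ N)
      fun i hi => mul_le_mul_of_nonneg_left (hmono i hi) (by positivity))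
    rw [← Finset.sum_mul]
    congr 1
    clear h1 hmono this hN0
    induction N with
    | zero => norm_num
    | succ N ih => rw [Finset.sum_range_succ, ← ih]; push_cast; ring
  have hp := pow_nonneg ht.1 N
  have h3 : ((N : ℝ) + 1) * N * t ^ N * (1 - t) ≤ 2 / (1 - t) := by
    calc _ ≤ 2 * (((N : ℝ) + 1) * (N + 2) / 2 * t ^ N) * (1 - t) := by
          refine mul_le_mul_of_nonneg_right ?_ hs.le
          nlinarith [mul_nonneg hN0 hp]
      _ ≤ 2 * (1 / (1 - t) ^ 2) * (1 - t) := by gcongr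
      _ = _ := by field_simp
  have h4 : tailKernel N t = ((N : ℝ) + 1) * t ^ N + ((N : ℝ) + 1) * N * t ^ N * (1 - t) := by
    rw [tailKernel]; ring
  rw [h4]
  calc _ ≤ 1 / (1 - t) + 2 / (1 - t) := add_le_add h1 h3
    _ = _ := by rw [← add_div]; norm_num

lemma tailKernel_le_mul (ht : t ∈ Set.Ico (0 : ℝ) 1) (N : ℕ) :
    tailKernel N t ≤ ((N : ℝ) + 1) * (1 + N * (1 - t)) := by
  have hs : 0 < 1 - t := by linarith [ht.2]
  have : t ^ N ≤ 1 := pow_le_one₀ ht.1 ht.2.le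
  unfold tailKernel
  have h2 : 0 ≤ 1 + N * (1 - t) := by positivity
  have h3 : (0 : ℝ) ≤ (N : ℝ) + 1 := by positivity
  exact mul_le_mul_of_nonneg_left (mul_le_of_le_one_left h2 this) h3

/-- When `1 - t` is small against `1/(N + 1)` the tail kernel has its full size `~ N + 1 ~ 1/θ`;
otherwise `θ ≤ 4(1 - t)` and the kernels of `R` and `S` agree up to a factor `5`. -/
lemma one_div_le_tailKernel_add (ht : t ∈ Set.Ico (0 : ℝ) 1) {N : ℕ} {θ : ℝ} (h0 : 0 < θ)
    (h1 : 1 ≤ ((N : ℝ) + 1) * θ) (h2 : ((N : ℝ) + 1) * θ ≤ 2) :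
    1 / (1 - t + θ) ≤ 2 * tailKernel N t + 5 * ((1 - t) / (1 - t + θ) ^ 2) := by
  have hs : 0 < 1 - t := by linarith [ht.2]
  have hn : (0 : ℝ) < (N : ℝ) + 1 := by positivity
  have ht0 := tailKernel_nonneg ht N
  rcases le_total (2 * (((N : ℝ) + 1) * (1 - t))) 1 with h | h
  · have h3 := one_add_mul_le_pow (a := -(1 - t)) (by linarith [ht.1]) N
    rw [show 1 + -(1 - t) = t by ring] at h3
    have h4 : 1 / 2 ≤ t ^ N := by nlinarith
    have h5 : ((N : ℝ) + 1) / 2 ≤ tailKernel N t := by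
      unfold tailKernel
      have h6 : 1 / 2 ≤ t ^ N * (1 + N * (1 - t)) := by
        have : 0 ≤ N * (1 - t) := by positivity
        nlinarith
      nlinarith
    have h7 : 1 / (1 - t + θ) ≤ (N : ℝ) + 1 := by
      rw [div_le_iff₀ (by positivity)]
      nlinarith
    have h8 : 0 ≤ 5 * ((1 - t) / (1 - t + θ) ^ 2) := by positivity
    linarith
  · have h3 : θ ≤ 4 * (1 - t) := by
      have : ((N : ℝ) + 1) * θ ≤ ((N : ℝ) + 1) * (4 * (1 - t)) := by linarith
      exact le_of_mul_le_mul_left this hn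
    have h4 : 1 / (1 - t + θ) ≤ 5 * ((1 - t) / (1 - t + θ) ^ 2) := by
      rw [mul_div_assoc', div_le_div_iff₀ (by positivity) (by positivity)]
      nlinarith [mul_pos hs h0]
    linarith

/-- The Tauberian step, made pointwise. After integration the bracket becomes `R - K S ≤ 0`, so the
tails are bounded by truncated second moments. Where `1 - t ≤ θ/(2K)` the bracket is at least half
of `1/(1 - t + θ)`, which already dominates the tail kernel. Elsewhere the bracket may be negative,
but it and the tail kernel are `O(1/(1 - t))`, which the truncated kernel controls from above. -/
lemma tailKernel_le (ht : t ∈ Set.Ico (0 : ℝ) 1) (N : ℕ) {K : ℝ} (hK : 1 ≤ K) {θ : ℝ}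
    (hθ : ((N : ℝ) + 1) * θ = 1) :
    tailKernel N t ≤ 6 * (1 / (1 - t + θ) - K * ((1 - t) / (1 - t + θ) ^ 2)) +
      384 * K ^ 3 * (3 + 6 * K) * truncKernel (N + 1) t := by
  have hs : 0 < 1 - t := by linarith [ht.2]
  have hn : (0 : ℝ) < (N : ℝ) + 1 := by positivity
  have h0 : 0 < θ := by
    rcases le_or_gt θ 0 with h | h
    · nlinarith
    · exact h
  have hL := truncKernel_nonneg ht (N + 1)
  rcases le_total (1 / (2 * K)) (((N : ℝ) + 1) * (1 - t)) with h | h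
  -- With `ε = 1/(2K)` the lower bound has constant `ε³/48 = 1/(384 K³)`. In `3 + 6K` the `3` pays
  -- for the tail kernel and `6K` for the negative part of the bracket.
  · have h1 := le_truncKernel ht (n := N + 1) (by omega) (ε := 1 / (2 * K)) (by positivity)
      (by rw [div_le_one (by positivity)]; linarith) (by push_cast; exact h)
    have h2 : 384 * K ^ 3 * (3 + 6 * K) * ((1 / (2 * K)) ^ 3 / 48 / (1 - t)) =
        (3 + 6 * K) / (1 - t) := by field_simp; norm_num
    have h3 : (3 + 6 * K) / (1 - t) ≤ 384 * K ^ 3 * (3 + 6 * K) * truncKernel (N + 1) t := by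
      rw [← h2]; gcongr
    have h4 := tailKernel_le_div ht N
    have h5 : (1 - t) / (1 - t + θ) ^ 2 ≤ 1 / (1 - t) := by
      rw [div_le_div_iff₀ (by positivity) hs]
      nlinarith
    have h6 : 0 ≤ 1 / (1 - t + θ) := by positivity
    have h7 : K * ((1 - t) / (1 - t + θ) ^ 2) ≤ K * (1 / (1 - t)) := by gcongr
    have h8 : (3 + 6 * K) / (1 - t) = 3 / (1 - t) + 6 * (K * (1 / (1 - t))) := by field_simp
    linarith
  · have h1 := tailKernel_le_mul ht N
    have h9 : 1 / (2 * K) ≤ 1 / 2 := by gcongr; linarith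
    have h2 : tailKernel N t ≤ 2 * ((N : ℝ) + 1) := by nlinarith
    have h3 : K * (1 - t) ≤ θ / 2 := by
      have h4 : ((N : ℝ) + 1) * (K * (1 - t)) ≤ ((N : ℝ) + 1) * (θ / 2) := by
        have : K * (((N : ℝ) + 1) * (1 - t)) ≤ K * (1 / (2 * K)) := by gcongr
        have h5 : K * (1 / (2 * K)) = 1 / 2 := by field_simp
        nlinarith
      exact le_of_mul_le_mul_left h4 hn
    have h5 : K * ((1 - t) / (1 - t + θ) ^ 2) ≤ 1 / 2 * (1 / (1 - t + θ)) := by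
      rw [mul_div_assoc', mul_one_div, div_le_div_iff₀ (by positivity) (by positivity)]
      nlinarith [mul_pos hs h0]
    have h6 : 2 / 3 * ((N : ℝ) + 1) ≤ 1 / (1 - t + θ) := by
      rw [le_div_iff₀ (by positivity)]
      nlinarith
    have h7 : 0 ≤ 384 * K ^ 3 * (3 + 6 * K) * truncKernel (N + 1) t := by positivity
    linarith

end Kernels

/-! ### BAR, comparability of the Stieltjes integrals, and the tail condition -/

variable {μ : Measure ℤ} {m : Measure ℝ}

lemma integrable_of_bounded_of_ae_mem [IsFiniteMeasure m] (hm : ∀ᵐ t ∂m, t ∈ Set.Ico (0 : ℝ) 1)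
    {f : ℝ → ℝ} (hf : Continuous f) : Integrable f m := by
  obtain ⟨C, hC⟩ := isCompact_Icc.exists_bound_of_continuousOn (s := Set.Icc (0 : ℝ) 1)
    hf.continuousOn
  refine Integrable.of_bound (C := C) hf.aestronglyMeasurable ?_
  filter_upwards [hm] with t ht
  exact hC t ⟨ht.1, ht.2.le⟩

lemma continuous_truncKernel (n : ℕ) : Continuous (truncKernel n) := by
  unfold truncKernel; fun_prop

lemma continuous_tailKernel (N : ℕ) : Continuous (tailKernel N) := by
  unfold tailKernel; fun_prop

namespace IsRepresentedBy

lemma sum_sq_mul_mass (h : IsRepresentedBy μ m) (n : ℕ) :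
    ∑ k ∈ Finset.Icc 1 n, (k : ℝ) ^ 2 * mass μ (k : ℤ) = ∫ t, truncKernel n t ∂m := by
  have := h.finite
  have e : ∑ k ∈ Finset.Icc 1 n, (k : ℝ) ^ 2 * mass μ (k : ℤ) =
      ∑ i ∈ range n, ((i : ℝ) + 1) ^ 2 * mass μ ((i + 1 : ℕ) : ℤ) := by
    induction n with
    | zero => simp
    | succ n ih =>
      rw [Finset.sum_Icc_succ_top (by omega), ih, Finset.sum_range_succ]
      push_cast; rfl
  rw [e]
  unfold truncKernel
  rw [integral_finsetSum]
  · refine Finset.sum_congr rfl fun i _ => ?_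
    rw [integral_const_mul, h.mass_succ]
  · intro i _
    exact integrable_of_bounded_of_ae_mem h.ae_mem (by fun_prop)

lemma mul_tail (h : IsRepresentedBy μ m) (N : ℕ) :
    ((N + 1 : ℕ) : ℝ) * ∑' k : Set.Ici (N + 1), ((k : ℕ) : ℝ) * mass μ ((k : ℕ) : ℤ) =
      ∫ t, tailKernel N t ∂m := by
  unfold tailKernel
  rw [h.tail, integral_const_mul]
  push_cast; rfl

lemma mass_one_pos (h : IsRepresentedBy μ m) : 0 < mass μ 1 := by
  have := h.finite
  have h1 := h.mass_succ 0
  simp only [zero_add, Nat.cast_one, pow_zero, one_mul] at h1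
  have hI : Integrable (fun t : ℝ => (1 - t) ^ 2) m :=
    integrable_of_bounded_of_ae_mem h.ae_mem (by fun_prop)
  rw [h1, integral_pos_iff_support_of_nonneg (fun t => sq_nonneg _) hI]
  have h2 : m (Function.support fun t : ℝ => (1 - t) ^ 2)ᶜ = 0 := by
    refine measure_mono_null ?_ h.ae_mem
    intro t ht
    have : t = 1 := by
      simp at ht; linarith
    simp [this]
  have h3 : m Set.univ ≠ 0 := by
    intro h0
    have := h.pos
    simp [Measure.real, h0] at this
  by_contra hcon
  have h4 : m (Function.support fun t : ℝ => (1 - t) ^ 2) = 0 := by simpa using hcon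
  apply h3
  rw [← Set.union_compl_self (Function.support fun t : ℝ => (1 - t) ^ 2)]
  exact measure_union_null h4 h2

end IsRepresentedBy

/-- The comparability of the integrals of `(1 - t + θ)⁻¹` and `(1 - t) (1 - t + θ)⁻²` as `θ → 0`. -/
def Comparable (m : Measure ℝ) : Prop :=
  ∃ K δ : ℝ, 1 ≤ K ∧ 0 < δ ∧ δ ≤ 1 ∧
    ∀ θ ∈ Set.Ioc 0 δ, stieltjesInt m 0 θ ≤ K * stieltjesRe m θ

/-- The comparison of the tails of the first moment with the truncated second moment. -/
def TailCondition (μ : Measure ℤ) : Prop :=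
  ∃ C : ℝ, 0 < C ∧ ∀ n : ℕ, 1 ≤ n →
    (n : ℝ) * ∑' k : Set.Ici n, ((k : ℕ) : ℝ) * mass μ ((k : ℕ) : ℤ) ≤
      C * ∑ k ∈ Finset.Icc 1 n, (k : ℝ) ^ 2 * mass μ (k : ℤ)

namespace IsRepresentedBy

lemma sum_sq_mul_mass_le (h : IsRepresentedBy μ m) {n : ℕ} (hn : 1 ≤ n) {θ : ℝ} (h0 : 0 < θ)
    (hθ : θ ≤ 2 / n) :
    ∑ k ∈ Finset.Icc 1 n, (k : ℝ) ^ 2 * mass μ (k : ℤ) ≤ 18 * stieltjesRe m θ := by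
  have := h.finite
  rw [h.sum_sq_mul_mass, stieltjesRe, ← integral_const_mul]
  refine integral_mono_ae (integrable_of_bounded_of_ae_mem h.ae_mem (continuous_truncKernel n))
    ((integrable_stieltjesRe h.ae_mem h0).const_mul _) ?_
  filter_upwards [h.ae_mem] with t ht
  exact truncKernel_le ht hn h0 hθ

lemma comparable_of_tailCondition (h : IsRepresentedBy μ m) (hC : TailCondition μ) :
    Comparable m := by
  have := h.finite
  obtain ⟨C, hC0, hC⟩ := hC
  -- The constant is `2 · C · 18 + 5`, from `one_div_le_tailKernel_add`, the tail condition and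
  -- `sum_sq_mul_mass_le`, applied with `N + 1 = ⌈1/θ⌉`.
  refine ⟨36 * C + 5, 1, by linarith, one_pos, le_rfl, fun θ hθ => ?_⟩
  have h0 := hθ.1
  obtain ⟨N, hN⟩ : ∃ N : ℕ, ⌈1 / θ⌉₊ = N + 1 :=
    Nat.exists_eq_succ_of_ne_zero (Nat.ceil_pos.2 (by positivity)).ne'
  have h1 : 1 ≤ ((N : ℝ) + 1) * θ := by
    have := Nat.le_ceil (1 / θ)
    rw [hN, div_le_iff₀ h0] at this
    exact_mod_cast this
  have h2 : ((N : ℝ) + 1) * θ ≤ 2 := by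
    have := (Nat.ceil_lt_add_one (a := 1 / θ) (by positivity)).le
    rw [hN] at this
    push_cast at this
    have h3 : ((N : ℝ) + 1) * θ ≤ (1 / θ + 1) * θ := by gcongr
    have h4 : (1 / θ + 1) * θ = 1 + θ := by field_simp
    linarith [hθ.2]
  have h3 : stieltjesInt m 0 θ ≤ 2 * ∫ t, tailKernel N t ∂m + 5 * stieltjesRe m θ := by
    have hI1 := integrable_of_bounded_of_ae_mem h.ae_mem (continuous_tailKernel N)
    have hI2 := integrable_stieltjesRe h.ae_mem h0
    rw [stieltjesRe, ← integral_const_mul, ← integral_const_mul,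
      ← integral_add (hI1.const_mul _) (hI2.const_mul _)]
    refine integral_mono_ae (integrable_stieltjes h.ae_mem 0 h0)
      ((hI1.const_mul _).add (hI2.const_mul _)) ?_
    filter_upwards [h.ae_mem] with t ht
    simpa using one_div_le_tailKernel_add ht h0 h1 h2
  have h4 := hC (N + 1) (by omega)
  rw [h.mul_tail] at h4
  have h5 := h.sum_sq_mul_mass_le (n := N + 1) (by omega) h0 (by
    rw [le_div_iff₀ (by positivity)]; push_cast; linarith)
  nlinarith

lemma tailCondition_of_comparable (h : IsRepresentedBy μ m) (hC : Comparable m) :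
    TailCondition μ := by
  have := h.finite
  obtain ⟨K, δ, hK, hδ, hδ1, hC⟩ := hC
  have hmass := h.mass_one_pos
  have hL1 : ∀ N : ℕ, mass μ 1 ≤ ∑ k ∈ Finset.Icc 1 (N + 1), (k : ℝ) ^ 2 * mass μ (k : ℤ) := by
    intro N
    have := Finset.single_le_sum (s := Finset.Icc 1 (N + 1))
      (f := fun k : ℕ => (k : ℝ) ^ 2 * mass μ (k : ℤ))
      (fun k _ => mul_nonneg (sq_nonneg _) (mass_nonneg μ _))
      (Finset.mem_Icc.2 ⟨le_rfl, by omega⟩ : 1 ∈ Finset.Icc 1 (N + 1))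
    simpa using this
  set B := 384 * K ^ 3 * (3 + 6 * K) with hB
  have hB0 : 0 < B := by positivity
  set A := (1 / δ * (1 / δ)) * m.real Set.univ / mass μ 1 with hA
  have hA0 : 0 ≤ A := by positivity
  refine ⟨B + A, by positivity, fun n hn => ?_⟩
  obtain ⟨N, rfl⟩ := Nat.exists_eq_add_of_le' hn
  have hS : 0 ≤ ∑ k ∈ Finset.Icc 1 (N + 1), (k : ℝ) ^ 2 * mass μ (k : ℤ) := hmass.le.trans (hL1 N)
  have hI1 := integrable_of_bounded_of_ae_mem h.ae_mem (continuous_tailKernel N)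
  rw [h.mul_tail]
  -- Comparability speaks only of `θ ≤ δ`. For the finitely many `n < 1/δ` the left side is bounded,
  -- and the right side is at least a multiple of `μ(1) > 0`.
  rcases le_total (1 / δ) ((N : ℝ) + 1) with hNδ | hNδ
  · set θ := 1 / ((N : ℝ) + 1) with hθ
    have h0 : 0 < θ := by positivity
    have hθ1 : ((N : ℝ) + 1) * θ = 1 := by rw [hθ]; field_simp
    have hθδ : θ ≤ δ := by
      rw [hθ, div_le_iff₀ (by positivity)]
      rw [div_le_iff₀ hδ] at hNδ
      linarith
    have h1 := hC θ ⟨h0, hθδ⟩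
    have hI2 := integrable_stieltjes h.ae_mem 0 h0
    have hI3 := integrable_stieltjesRe h.ae_mem h0
    have hI4 := integrable_of_bounded_of_ae_mem h.ae_mem (continuous_truncKernel (N + 1))
    have h2 : ∫ t, tailKernel N t ∂m ≤ 6 * (stieltjesInt m 0 θ - K * stieltjesRe m θ) +
        B * ∫ t, truncKernel (N + 1) t ∂m := by
      have hsub : Integrable (fun t : ℝ => 1 / (1 - t + θ) ^ (0 + 1) -
          K * ((1 - t) / (1 - t + θ) ^ 2)) m := hI2.sub (hI3.const_mul K)
      have e : stieltjesInt m 0 θ - K * stieltjesRe m θ =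
          ∫ t, (1 / (1 - t + θ) ^ (0 + 1) - K * ((1 - t) / (1 - t + θ) ^ 2)) ∂m := by
        rw [integral_sub hI2 (hI3.const_mul K), integral_const_mul]; rfl
      rw [e, ← integral_const_mul, ← integral_const_mul,
        ← integral_add (hsub.const_mul _) (hI4.const_mul _)]
      refine integral_mono_ae hI1 ((hsub.const_mul _).add (hI4.const_mul _)) ?_
      filter_upwards [h.ae_mem] with t ht
      simpa using tailKernel_le ht N hK hθ1
    rw [← h.sum_sq_mul_mass] at h2
    nlinarith
  · have h1 : ∫ t, tailKernel N t ∂m ≤ (1 / δ * (1 / δ)) * m.real Set.univ := by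
      have e : (1 / δ * (1 / δ)) * m.real Set.univ = ∫ _ : ℝ, (1 / δ * (1 / δ)) ∂m := by
        rw [integral_const, smul_eq_mul, mul_comm]
      rw [e]
      refine integral_mono_ae hI1 (integrable_const _) ?_
      filter_upwards [h.ae_mem] with t ht
      have hs : 0 < 1 - t := by linarith [ht.2]
      refine (tailKernel_le_mul ht N).trans ?_
      have h2 : 1 + N * (1 - t) ≤ (N : ℝ) + 1 := by
        nlinarith [ht.1, (Nat.cast_nonneg N : (0 : ℝ) ≤ N)]
      have h3 : 0 ≤ 1 + N * (1 - t) := by positivity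
      exact mul_le_mul hNδ (h2.trans hNδ) h3 (by positivity)
    have h2 : A * mass μ 1 = (1 / δ * (1 / δ)) * m.real Set.univ := by
      rw [hA]; field_simp
    nlinarith [hL1 N]

end IsRepresentedBy

lemma two_sub_two_cos_bounds {θ : ℝ} (h0 : 0 < θ) (hπ : θ ≤ Real.pi) :
    2 / 5 * θ ^ 2 ≤ 2 - 2 * Real.cos θ ∧ 2 - 2 * Real.cos θ ≤ θ ^ 2 := by
  have := one_sub_cos_bounds h0 hπ
  constructor <;> linarith [this.1, this.2]

/-- With `r = Re (1 - f)`, `|f|² = 1 - 2r + |1 - f|² ≤ 1 - r ≤ (1 - r/2)²`. This turns lower bounds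
on the real part of `1 - f` into bounds on `1 - |f|`. -/
lemma norm_le_of_sq_norm_one_sub_le {f : ℂ} (h : ‖1 - f‖ ^ 2 ≤ (1 - f).re) :
    ‖f‖ ≤ 1 - (1 - f).re / 2 := by
  have h1 : ‖f‖ ^ 2 = 1 - 2 * (1 - f).re + ‖1 - f‖ ^ 2 := by
    rw [Complex.sq_norm, Complex.sq_norm, Complex.normSq_apply, Complex.normSq_apply]
    simp only [Complex.sub_re, Complex.sub_im, Complex.one_re, Complex.one_im]
    ring
  have h2 : 0 ≤ 1 - (1 - f).re := by nlinarith [sq_nonneg ‖f‖]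
  refine abs_le_of_sq_le_sq' ?_ ?_ |>.2
  · nlinarith [sq_nonneg (1 - f).re]
  · nlinarith [sq_nonneg ‖1 - f‖]

lemma one_sub_norm_le_re (f : ℂ) : 1 - ‖f‖ ≤ (1 - f).re := by
  have := Complex.re_le_norm f
  simp only [Complex.sub_re, Complex.one_re]
  linarith

lemma exists_norm_hat_le (μ : Measure ℤ) [IsFiniteMeasure μ] (h : StrictlyAperiodic μ)
    {δ : ℝ} (hδ : 0 < δ) : ∃ η > 0, ∀ θ ∈ Set.Icc δ Real.pi, ‖hat μ θ‖ ≤ 1 - η := by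
  rcases le_or_gt δ Real.pi with hδπ | hδπ
  · obtain ⟨θ₀, hθ₀, hmax⟩ := isCompact_Icc.exists_isMaxOn (s := Set.Icc δ Real.pi)
      (f := fun θ => ‖hat μ θ‖) ⟨δ, by simp [hδπ]⟩ (continuous_hat μ).norm.continuousOn
    have h1 := h θ₀ ⟨hδ.trans_le hθ₀.1, by linarith [hθ₀.2, Real.pi_pos]⟩
    exact ⟨1 - ‖hat μ θ₀‖, by linarith, fun θ hθ => by
      have : ‖hat μ θ‖ ≤ ‖hat μ θ₀‖ := hmax hθ
      linarith⟩
  · exact ⟨1, one_pos, fun θ hθ => absurd (hθ.1.trans hθ.2) (not_le.2 hδπ)⟩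

lemma exists_mul_norm_one_sub_hat_le (μ : Measure ℤ) [IsProbabilityMeasure μ] {ε : ℝ}
    (hε : 0 < ε) : ∃ δ > 0, ∀ θ, |θ| < δ → ‖1 - hat μ θ‖ ≤ ε := by
  have h1 := Metric.continuousAt_iff.1 ((continuous_hat μ).continuousAt (x := 0)) ε hε
  obtain ⟨δ, hδ, h⟩ := h1
  refine ⟨δ, hδ, fun θ hθ => ?_⟩
  have := h (x := θ) (by simpa using hθ)
  rw [dist_comm, dist_eq_norm, hat_zero] at this
  exact this.le

namespace IsRepresentedBy

variable {μ : Measure ℤ} {m : Measure ℝ}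

lemma one_sub_hat (h : IsRepresentedBy μ m) {θ : ℝ} (h0 : 0 < θ) (hπ : θ ≤ Real.pi) :
    1 - hat μ θ =
      (2 - 2 * Real.cos θ : ℝ) * cauchyInt m 0 (Complex.exp (θ * Complex.I)) := by
  rw [h.hat_eq θ (exp_mul_I_ne_one ⟨h0, by linarith [Real.pi_pos]⟩)]
  ring

lemma norm_one_sub_hat (h : IsRepresentedBy μ m) {θ : ℝ} (h0 : 0 < θ) (hπ : θ ≤ Real.pi) :
    ‖1 - hat μ θ‖ =
      (2 - 2 * Real.cos θ) * ‖cauchyInt m 0 (Complex.exp (θ * Complex.I))‖ := by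
  rw [h.one_sub_hat h0 hπ, norm_mul, Complex.norm_real, Real.norm_of_nonneg]
  linarith [Real.cos_le_one θ]

lemma re_one_sub_hat (h : IsRepresentedBy μ m) {θ : ℝ} (h0 : 0 < θ) (hπ : θ ≤ Real.pi) :
    (1 - hat μ θ).re =
      (2 - 2 * Real.cos θ) * (cauchyInt m 0 (Complex.exp (θ * Complex.I))).re := by
  rw [h.one_sub_hat h0 hπ, Complex.re_ofReal_mul]

lemma norm_one_sub_hat_le (h : IsRepresentedBy μ m) {θ : ℝ} (h0 : 0 < θ) (hπ : θ ≤ Real.pi) :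
    ‖1 - hat μ θ‖ ≤ 8 * (θ ^ 2 * stieltjesInt m 0 θ) := by
  have := h.finite
  rw [h.norm_one_sub_hat h0 hπ]
  have h1 := norm_cauchyInt_le h.ae_mem 0 h0 hπ
  have h2 := two_sub_two_cos_bounds h0 hπ
  have h3 := stieltjesInt_nonneg h.ae_mem 0 h0
  calc _ ≤ θ ^ 2 * (8 ^ (0 + 1) * stieltjesInt m 0 θ) := by
        gcongr
        exact h2.2
    _ = _ := by ring

lemma stieltjesRe_le_re_one_sub_hat (h : IsRepresentedBy μ m) {θ : ℝ} (h0 : 0 < θ)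
    (hπ : θ ≤ Real.pi) : 2 / 5 * (θ ^ 2 * stieltjesRe m θ) ≤ (1 - hat μ θ).re := by
  have := h.finite
  rw [h.re_one_sub_hat h0 hπ]
  have h1 := stieltjesRe_le_re_cauchyInt h.ae_mem h0 hπ
  have h2 := two_sub_two_cos_bounds h0 hπ
  have h3 : 0 ≤ stieltjesRe m θ := by
    refine integral_nonneg_of_ae ?_
    filter_upwards [h.ae_mem] with t ht
    exact div_nonneg (by linarith [ht.2]) (sq_nonneg _)
  calc _ = 2 / 5 * θ ^ 2 * stieltjesRe m θ := by ring
    _ ≤ _ := by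
      refine mul_le_mul h2.1 h1 h3 ?_
      linarith [Real.cos_le_one θ]

lemma strictlyAperiodic [IsProbabilityMeasure μ] (h : IsRepresentedBy μ m)
    (hcm : CompletelyMonotone (fun n : ℕ => mass μ (n : ℤ))) : StrictlyAperiodic μ := by
  have h1 := h.mass_one_pos
  have h2 := hcm 1 0
  simp only [Function.iterate_one, diffOp, Nat.cast_zero, zero_add, Nat.cast_one] at h2
  exact strictlyAperiodic_of_adjacent μ (n := 0) (by linarith) (by simpa using h1)

/-- As `1 - |f| ≤ Re (1 - f)`, BAR gives `|G| ≤ B Re G`. Then `R ≤ 8 |G| ≤ 8 B Re G ≤ K (S + θ R)`,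
and the last term is absorbed once `K θ ≤ 1/2`. -/
lemma comparable_of_bar [IsProbabilityMeasure μ] (h : IsRepresentedBy μ m) (hB : BAR μ) :
    Comparable m := by
  have := h.finite
  obtain ⟨hap, B, hB⟩ := hB
  have hratio : ∀ θ ∈ Set.Ioc (0 : ℝ) 1, ‖cauchyInt m 0 (Complex.exp (θ * Complex.I))‖ ≤
      |B| * (cauchyInt m 0 (Complex.exp (θ * Complex.I))).re := by
    intro θ hθ
    have hπ : θ ≤ Real.pi := by linarith [hθ.2, Real.pi_gt_three]
    have hmem : θ ∈ Set.Ioo 0 (2 * Real.pi) := ⟨hθ.1, by linarith [Real.pi_pos]⟩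
    have h1 : ‖1 - hat μ θ‖ / (1 - ‖hat μ θ‖) ≤ |B| :=
      (hB ⟨θ, hmem, rfl⟩).trans (le_abs_self B)
    have h2 : 0 < 1 - ‖hat μ θ‖ := by linarith [hap θ hmem]
    rw [div_le_iff₀ h2] at h1
    have h3 : ‖1 - hat μ θ‖ ≤ |B| * (1 - hat μ θ).re :=
      h1.trans (mul_le_mul_of_nonneg_left (one_sub_norm_le_re _) (abs_nonneg B))
    rw [h.norm_one_sub_hat hθ.1 hπ, h.re_one_sub_hat hθ.1 hπ] at h3
    have h4 : 0 < 2 - 2 * Real.cos θ :=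
      lt_of_lt_of_le (by have := hθ.1; positivity) (two_sub_two_cos_bounds hθ.1 hπ).1
    refine le_of_mul_le_mul_left (h3.trans_eq ?_) h4
    ring
  set K := 512 * |B| + 1 with hK
  have hB0 := abs_nonneg B
  refine ⟨2 * K, 1 / (2 * K), by linarith, by positivity, ?_, fun θ hθ => ?_⟩
  · rw [div_le_one (by positivity)]; linarith
  have hθ1 : θ ≤ 1 := hθ.2.trans (by rw [div_le_one (by positivity)]; linarith)
  have h0 := hθ.1
  have hπ : θ ≤ Real.pi := by linarith [Real.pi_gt_three]
  have h1 := stieltjesInt_le_re_add_im h.ae_mem h0 hθ1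
  have h2 := hratio θ ⟨h0, hθ1⟩
  have h3 := re_cauchyInt_le h.ae_mem h0 hπ
  set G := cauchyInt m 0 (Complex.exp (θ * Complex.I))
  have h4 := Complex.re_le_norm G
  have h5 := (le_abs_self _).trans (Complex.abs_im_le_norm G)
  have h6 := stieltjesInt_nonneg h.ae_mem 0 h0
  have h7 : 0 ≤ stieltjesRe m θ + θ * stieltjesInt m 0 θ := by
    have hre : 0 ≤ G.re := by
      by_contra hcon
      have := norm_nonneg G
      rcases eq_or_lt_of_le hB0 with hb | hb
      · rw [← hb] at h2
        have h8 : ‖G‖ = 0 := by linarith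
        rw [norm_eq_zero] at h8
        simp [h8] at hcon
      · nlinarith
    linarith
  have h8 : stieltjesInt m 0 θ ≤ K * (stieltjesRe m θ + θ * stieltjesInt m 0 θ) := by
    calc _ ≤ 8 * ‖G‖ := by linarith
      _ ≤ 8 * (|B| * (64 * (stieltjesRe m θ + θ * stieltjesInt m 0 θ))) := by
          have := mul_le_mul_of_nonneg_left h3 hB0
          linarith
      _ ≤ _ := by rw [hK]; nlinarith
  have h9 : K * θ ≤ 1 / 2 := by
    have := hθ.2
    rw [le_div_iff₀ (by positivity)] at this
    linarith
  nlinarith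

lemma norm_one_sub_hat_le_re (h : IsRepresentedBy μ m) (hC : Comparable m) :
    ∃ K δ : ℝ, 1 ≤ K ∧ 0 < δ ∧ δ ≤ 1 ∧ ∀ θ ∈ Set.Ioc 0 δ,
      θ ^ 2 * stieltjesInt m 0 θ ≤ K * (1 - hat μ θ).re ∧
      ‖1 - hat μ θ‖ ≤ K * (1 - hat μ θ).re := by
  have := h.finite
  obtain ⟨K, δ, hK, hδ, hδ1, hC⟩ := hC
  refine ⟨20 * K, δ, by linarith, hδ, hδ1, fun θ hθ => ?_⟩
  have h0 := hθ.1
  have hπ : θ ≤ Real.pi := by linarith [hθ.2, Real.pi_gt_three]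
  have h1 := h.norm_one_sub_hat_le h0 hπ
  have h2 := h.stieltjesRe_le_re_one_sub_hat h0 hπ
  have h3 := hC θ hθ
  have h4 : θ ^ 2 * stieltjesInt m 0 θ ≤ K * (5 / 2 * (1 - hat μ θ).re) := by
    calc _ ≤ θ ^ 2 * (K * stieltjesRe m θ) := by gcongr
      _ = K * (θ ^ 2 * stieltjesRe m θ) := by ring
      _ ≤ _ := mul_le_mul_of_nonneg_left (by linarith) (by linarith)
  have h5 := mul_nonneg (sq_nonneg θ) (stieltjesInt_nonneg h.ae_mem 0 h0)
  constructor <;> nlinarith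

/-- Near `0`, `|1 - f| ≤ K Re (1 - f)` and `|1 - f| ≤ 1/K` give `|1 - f|² ≤ Re (1 - f)`, so `1 -
|f|` is at least half the real part. Away from `0` the denominator is bounded below by compactness.
-/
lemma bar_of_comparable [IsProbabilityMeasure μ] (h : IsRepresentedBy μ m)
    (hap : StrictlyAperiodic μ) (hC : Comparable m) : BAR μ := by
  obtain ⟨K, δ, hK, hδ, hδ1, hC⟩ := h.norm_one_sub_hat_le_re hC
  obtain ⟨δ', hδ', hsmall⟩ := exists_mul_norm_one_sub_hat_le μ (ε := 1 / K) (by positivity)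
  obtain ⟨η, hη, hfar⟩ := exists_norm_hat_le μ hap (δ := min δ (δ' / 2)) (by positivity)
  have hbound : ∀ θ ∈ Set.Ioc 0 Real.pi,
      ‖1 - hat μ θ‖ / (1 - ‖hat μ θ‖) ≤ 2 * K + 2 / η := by
    intro θ hθ
    have hpos : 0 < 1 - ‖hat μ θ‖ := by
      linarith [hap θ ⟨hθ.1, by linarith [hθ.2, Real.pi_pos]⟩]
    rw [div_le_iff₀ hpos]
    have hη2 : 0 ≤ 2 / η := by positivity
    rcases le_total θ (min δ (δ' / 2)) with hle | hle
    · have h1 := (hC θ ⟨hθ.1, hle.trans (min_le_left _ _)⟩).2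
      have h2 := hsmall θ (by
        rw [abs_of_pos hθ.1]
        linarith [hle.trans (min_le_right _ _)])
      have h3 : ‖1 - hat μ θ‖ ^ 2 ≤ (1 - hat μ θ).re := by
        rw [le_div_iff₀ (by positivity)] at h2
        have hre : 0 ≤ (1 - hat μ θ).re := by
          by_contra hcon
          nlinarith [norm_nonneg (1 - hat μ θ)]
        nlinarith [norm_nonneg (1 - hat μ θ)]
      have h4 := norm_le_of_sq_norm_one_sub_le h3
      nlinarith
    · have h1 := hfar θ ⟨hle, hθ.2⟩
      have h2 : ‖1 - hat μ θ‖ ≤ 2 := by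
        refine (norm_sub_le _ _).trans ?_
        rw [norm_one]; linarith
      have h3 : 2 ≤ 2 / η * (1 - ‖hat μ θ‖) := by
        calc (2 : ℝ) = 2 / η * η := by field_simp
          _ ≤ _ := by gcongr; linarith
      nlinarith
  refine ⟨hap, 2 * K + 2 / η, ?_⟩
  rintro _ ⟨θ, hθ, rfl⟩
  -- Angles beyond `π` reduce to `2π - θ`, where the transform is conjugated.
  rcases le_total θ Real.pi with hle | hle
  · exact hbound θ ⟨hθ.1, hle⟩
  · have h1 := hbound (2 * Real.pi - θ) ⟨by linarith [hθ.2], by linarith⟩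
    have h2 : hat μ (2 * Real.pi - θ) = (starRingEnd ℂ) (hat μ θ) := by
      rw [← hat_neg, ← hat_add_two_pi μ (-θ)]; congr 1; ring
    have h3 : ‖1 - (starRingEnd ℂ) (hat μ θ)‖ = ‖1 - hat μ θ‖ := by
      rw [← map_one (starRingEnd ℂ), ← map_sub, RCLike.norm_conj, map_one]
    rw [h2, h3, RCLike.norm_conj] at h1
    exact h1

end IsRepresentedBy

/-! ### Fourier coefficients and a Carlson inequality -/

lemma neg_pi_lt_pi : -Real.pi < Real.pi := by linarith [Real.pi_pos]

lemma fourierCoeffOn_trig {c : ℤ → ℂ} (hc : Summable fun n => ‖c n‖) (k : ℤ) :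
    fourierCoeffOn neg_pi_lt_pi (trig c) k = c k := by
  have hT : Fact (0 < Real.pi - -Real.pi) := ⟨by linarith [Real.pi_pos]⟩
  let F : ℤ → C(AddCircle (Real.pi - -Real.pi), ℂ) := fun n => c n • fourier n
  have hF : Summable fun n => ‖F n‖ := by
    refine hc.congr fun n => ?_
    rw [norm_smul, fourier_norm, mul_one]
  have hFs : Summable F := hF.of_norm
  let G : C(AddCircle (Real.pi - -Real.pi), ℂ) := ∑' n, F n
  have hGx : ∀ x : ℝ, G x = trig c x := by
    intro x
    have h1 : G x = ∑' n, F n x := (ContinuousMap.tsum_apply hFs x).symm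
    rw [h1, trig]
    refine tsum_congr fun n => ?_
    simp only [F, ContinuousMap.smul_apply, smul_eq_mul, fourier_coe_apply]
    congr 2
    have hp : (Real.pi : ℂ) ≠ 0 := by exact_mod_cast Real.pi_ne_zero
    push_cast
    field_simp
    ring
  have h1 : fourierCoeffOn neg_pi_lt_pi (trig c) k = fourierCoeff G k := by
    rw [fourierCoeffOn_eq_integral, fourierCoeff_eq_intervalIntegral _ _ (-Real.pi)]
    simp only [hGx, add_sub_cancel]
  have h2 : fourierCoeff G k = ∑' n, fourierCoeff (F n) k := by
    have hnorm : ∀ n t, ‖fourier (-k) t • F n t‖ = ‖c n‖ := fun n t => by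
      simp [F, Circle.norm_coe]
    have hI := hasSum_integral_of_summable_integral_norm
      (μ := AddCircle.haarAddCircle (T := Real.pi - -Real.pi))
      (F := fun n t => fourier (-k) t • F n t)
      (fun n => Integrable.of_bound (C := ‖c n‖)
        (Continuous.aestronglyMeasurable (by fun_prop))
        (Eventually.of_forall fun t => (hnorm n t).le))
      (by simpa only [hnorm, integral_const, probReal_univ, one_smul] using hc)
    unfold fourierCoeff
    rw [hI.tsum_eq]
    refine integral_congr_ae (Eventually.of_forall fun t => ?_)
    simp only [smul_eq_mul]
    rw [tsum_mul_left]
    congr 1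
    exact (ContinuousMap.tsum_apply hFs t).symm
  rw [h1, h2, tsum_eq_single k]
  · simp only [F, ContinuousMap.coe_smul]
    rw [fourierCoeff.const_smul, fourierCoeff_fourier]
    simp
  · intro n hn
    simp only [F, ContinuousMap.coe_smul]
    rw [fourierCoeff.const_smul, fourierCoeff_fourier]
    simp [hn.symm]

/-- For `k ≠ 0` the terms are dominated by a telescoping sum; `M ≥ 1/4` serves only to bound the `k
= 0` term `1/M²` by `4/M`. -/
lemma sum_one_div_sq_add_sq_le {M : ℝ} (hM : 1 / 4 ≤ M) (s : Finset ℤ) :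
    ∑ k ∈ s, 1 / (M ^ 2 + (k : ℝ) ^ 2) ≤ 8 / M := by
  have hM0 : 0 < M := by linarith
  have hpart : ∀ n : ℕ, ∑ i ∈ range n, 1 / (M ^ 2 + ((i : ℝ) + 1) ^ 2) ≤
      2 * (1 / M - 1 / (M + n)) := by
    intro n
    induction n with
    | zero => simp
    | succ n ih =>
      rw [Finset.sum_range_succ]
      have h1 : 1 / (M ^ 2 + ((n : ℝ) + 1) ^ 2) ≤ 2 * (1 / (M + n) - 1 / (M + (n + 1 : ℕ))) := by
        push_cast
        have e : 2 * (1 / (M + n) - 1 / (M + ((n : ℝ) + 1))) =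
            2 / ((M + n) * (M + ((n : ℝ) + 1))) := by
          have : M + (n : ℝ) ≠ 0 := by positivity
          have : M + ((n : ℝ) + 1) ≠ 0 := by positivity
          field_simp; ring
        rw [e, div_le_div_iff₀ (by positivity) (by positivity)]
        nlinarith [sq_nonneg (M - ((n : ℝ) + 1)), (Nat.cast_nonneg n : (0 : ℝ) ≤ n)]
      linarith
  have hpart' : ∀ n : ℕ, ∑ i ∈ range n, 1 / (M ^ 2 + ((i : ℝ) + 1) ^ 2) ≤ 2 / M := fun n => by
    have h1 : 0 ≤ 1 / (M + n) := by positivity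
    have := hpart n
    have e : 2 / M = 2 * (1 / M) := by ring
    linarith
  have hsum : Summable fun i : ℕ => 1 / (M ^ 2 + ((i : ℝ) + 1) ^ 2) :=
    summable_of_sum_range_le (fun i => by positivity) hpart'
  have htsum : ∑' i : ℕ, 1 / (M ^ 2 + ((i : ℝ) + 1) ^ 2) ≤ 2 / M :=
    Real.tsum_le_of_sum_range_le (fun i => by positivity) hpart'
  set u : ℤ → ℝ := fun k => 1 / (M ^ 2 + (k : ℝ) ^ 2) with hu
  have hu0 : ∀ i : ℕ, u ((i + 1 : ℕ) : ℤ) = 1 / (M ^ 2 + ((i : ℝ) + 1) ^ 2) := fun i => by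
    simp [hu]
  have hu1 : ∀ i : ℕ, u (-((i : ℤ) + 1)) = 1 / (M ^ 2 + ((i : ℝ) + 1) ^ 2) := fun i => by
    simp only [hu]; push_cast; rw [neg_sq]
  have hs0 : Summable fun i : ℕ => u (i : ℤ) := by
    rw [← summable_nat_add_iff 1]
    simpa only [hu0] using hsum
  have hs1 : Summable fun i : ℕ => u (-((i : ℤ) + 1)) := by simpa only [hu1] using hsum
  have hZ : Summable u := hs0.of_nat_of_neg_add_one hs1
  refine (hZ.sum_le_tsum s fun k _ => by positivity).trans ?_
  rw [tsum_of_nat_of_neg_add_one hs0 hs1, hs0.tsum_eq_zero_add]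
  simp only [hu0, hu1]
  have h3 : u ((0 : ℕ) : ℤ) ≤ 4 / M := by
    simp only [hu]
    rw [div_le_div_iff₀ (by positivity) hM0]
    push_cast
    nlinarith
  have e3 : 8 / M = 4 / M + 2 / M + 2 / M := by ring
  linarith

/-- A bound of Carlson type for the absolute sum of the Fourier coefficients. -/
lemma sq_sum_norm_fourierCoeffOn_le {h h' : ℝ → ℂ} (hd : ∀ x, HasDerivAt h (h' x) x)
    (hc : Continuous h') (hper : h (-Real.pi) = h Real.pi) {M : ℝ} (hM : 1 / 4 ≤ M)
    (s : Finset ℤ) :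
    (∑ k ∈ s, ‖fourierCoeffOn neg_pi_lt_pi h k‖) ^ 2 ≤ 8 / M * ((2 * Real.pi)⁻¹ *
      ∫ x in (-Real.pi)..Real.pi, (M ^ 2 * ‖h x‖ ^ 2 + ‖h' x‖ ^ 2)) := by
  have hM0 : 0 < M := by linarith
  have hch : Continuous h := continuous_iff_continuousAt.2 fun x => (hd x).continuousAt
  have hL2 : ∀ g : ℝ → ℂ, Continuous g →
      MemLp g 2 (volume.restrict (Set.Ioc (-Real.pi) Real.pi)) := by
    intro g hg
    obtain ⟨C, hC⟩ := isCompact_Icc.exists_bound_of_continuousOn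
      (s := Set.Icc (-Real.pi) Real.pi) hg.continuousOn
    refine MemLp.of_bound hg.aestronglyMeasurable C ?_
    rw [ae_restrict_iff' measurableSet_Ioc]
    exact Eventually.of_forall fun x hx => hC x ⟨hx.1.le, hx.2⟩
  set c := fourierCoeffOn neg_pi_lt_pi h with hcdef
  set c' := fourierCoeffOn neg_pi_lt_pi h' with hcdef'
  have hP := hasSum_sq_fourierCoeffOn neg_pi_lt_pi (hL2 h hch)
  have hP' := hasSum_sq_fourierCoeffOn neg_pi_lt_pi (hL2 h' hc)
  have hrel : ∀ k : ℤ, |(k : ℝ)| * ‖c k‖ ≤ ‖c' k‖ := by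
    intro k
    rcases eq_or_ne k 0 with rfl | hk
    · simp
    · have h1 := fourierCoeffOn_of_hasDerivAt neg_pi_lt_pi hk (fun x _ => hd x)
        (hc.intervalIntegrable _ _)
      rw [hper, sub_self, mul_zero, zero_sub] at h1
      have h2 : c k = c' k / (Complex.I * k) := by
        rw [hcdef, h1, hcdef']
        have hp : (Real.pi : ℂ) ≠ 0 := by exact_mod_cast Real.pi_ne_zero
        have hk' : (k : ℂ) ≠ 0 := by exact_mod_cast hk
        have hI := Complex.I_ne_zero
        push_cast
        field_simp
        ring
      have hk'' : |(k : ℝ)| ≠ 0 := by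
        rw [abs_ne_zero]; exact_mod_cast hk
      rw [h2, norm_div, norm_mul, Complex.norm_I, one_mul, Complex.norm_intCast]
      apply le_of_eq
      field_simp
  -- Cauchy–Schwarz with weights `M² + k²`; Parseval for `h` and `h'` then turns the weighted
  -- coefficients into the integral.
  have hCS := Finset.sum_sq_le_sum_mul_sum_of_sq_le_mul s
    (r := fun k => ‖c k‖) (f := fun k => 1 / (M ^ 2 + (k : ℝ) ^ 2))
    (g := fun k => M ^ 2 * ‖c k‖ ^ 2 + (|(k : ℝ)| * ‖c k‖) ^ 2)
    (fun k _ => by positivity) (fun k _ => by positivity) (fun k _ => by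
      apply le_of_eq; rw [mul_pow, sq_abs]; field_simp)
  refine hCS.trans (mul_le_mul (sum_one_div_sq_add_sq_le hM s) ?_
    (Finset.sum_nonneg fun k _ => by positivity) (by positivity))
  have hle : ∑ k ∈ s, (M ^ 2 * ‖c k‖ ^ 2 + (|(k : ℝ)| * ‖c k‖) ^ 2) ≤
      ∑ k ∈ s, (M ^ 2 * ‖c k‖ ^ 2 + ‖c' k‖ ^ 2) := by
    refine Finset.sum_le_sum fun k _ => ?_
    have := hrel k
    gcongr
  refine hle.trans ?_
  have hadd := (hP.mul_left (M ^ 2)).add hP'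
  refine (sum_le_hasSum s (fun k _ => by positivity) hadd).trans_eq ?_
  rw [intervalIntegral.integral_add, intervalIntegral.integral_const_mul]
  · rw [show Real.pi - -Real.pi = 2 * Real.pi by ring, smul_eq_mul, smul_eq_mul]
    ring
  · exact Continuous.intervalIntegrable (by fun_prop) _ _
  · exact Continuous.intervalIntegrable (by fun_prop) _ _

lemma integral_inv_one_add_div_sq_le {a : ℝ} (ha : 0 < a) :
    ∫ x in (-Real.pi)..Real.pi, (1 + (x / a) ^ 2)⁻¹ ≤ a * Real.pi := by
  rw [intervalIntegral.integral_comp_div (fun x : ℝ => (1 + x ^ 2)⁻¹) ha.ne',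
    integral_inv_one_add_sq, smul_eq_mul]
  gcongr
  linarith [Real.arctan_lt_pi_div_two (Real.pi / a), Real.neg_pi_div_two_lt_arctan (-Real.pi / a)]

/-! ### The Ritt property from a majorant -/

lemma exp_neg_bounds {c x : ℝ} (hc : 0 < c) (hx : 0 ≤ x) :
    Real.exp (-(c * x)) ≤ 1 ∧ x * Real.exp (-(c * x)) ≤ 1 / c ∧
      x ^ 2 * Real.exp (-(c * x)) ≤ 2 / c ^ 2 := by
  have h0 : 0 ≤ c * x := by positivity
  have h1 := Real.quadratic_le_exp_of_nonneg h0
  have hpos := Real.exp_pos (c * x)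
  rw [Real.exp_neg]
  refine ⟨?_, ?_, ?_⟩
  · exact inv_le_one_of_one_le₀ (Real.one_le_exp h0)
  · rw [← div_eq_mul_inv, div_le_div_iff₀ hpos hc]
    nlinarith [sq_nonneg (c * x)]
  · rw [← div_eq_mul_inv, div_le_div_iff₀ hpos (by positivity)]
    nlinarith

/-- The function `x ↦ min 1 (a / x)`, squared, is dominated by a Cauchy density. -/
lemma sq_le_of_le_min {a θ B u v : ℝ} (ha : 0 < a) (hθ : 0 < θ) (hu : 0 ≤ u)
    (hv : 0 ≤ v) (h1 : θ ≤ a → u ≤ B ∧ v ≤ B)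
    (h2 : a ≤ θ → u ≤ B * (a / θ) ∧ v ≤ B * (a / θ)) :
    u ^ 2 + v ^ 2 ≤ 4 * B ^ 2 * (1 + (θ / a) ^ 2)⁻¹ := by
  rw [← div_eq_mul_inv, le_div_iff₀ (by positivity)]
  rcases le_total θ a with h | h
  · obtain ⟨hu1, hv1⟩ := h1 h
    have h3 : (θ / a) ^ 2 ≤ 1 := by
      have : θ / a ≤ 1 := (div_le_one ha).2 h
      have : 0 ≤ θ / a := by positivity
      nlinarith
    have hu2 : u ^ 2 ≤ B ^ 2 := by gcongr
    have hv2 : v ^ 2 ≤ B ^ 2 := by gcongr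
    calc (u ^ 2 + v ^ 2) * (1 + (θ / a) ^ 2) ≤ (B ^ 2 + B ^ 2) * (1 + 1) := by gcongr
      _ = _ := by ring
  · obtain ⟨hu1, hv1⟩ := h2 h
    have h3 : 1 ≤ (θ / a) ^ 2 := one_le_pow₀ ((one_le_div ha).2 h)
    have hu2 : u ^ 2 ≤ (B * (a / θ)) ^ 2 := by gcongr
    have hv2 : v ^ 2 ≤ (B * (a / θ)) ^ 2 := by gcongr
    calc (u ^ 2 + v ^ 2) * (1 + (θ / a) ^ 2)
        ≤ ((B * (a / θ)) ^ 2 + (B * (a / θ)) ^ 2) * ((θ / a) ^ 2 + (θ / a) ^ 2) := by gcongr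
      _ = _ := by field_simp; ring

/-- The majorants of the characteristic function near the origin. -/
structure IsMajorant (f f' : ℝ → ℂ) (ψ : ℝ → ℝ) (c C : ℝ) : Prop where
  c_pos : 0 < c
  C_pos : 0 < C
  continuousOn : ContinuousOn ψ (Set.Icc 0 Real.pi)
  zero : ψ 0 = 0
  pos : ∀ θ ∈ Set.Ioc 0 Real.pi, 0 < ψ θ
  -- Monotonicity of `ψ(θ)/θ`, which compares `ψ` on either side of a scale `a` with the linear
  -- function through `(a, ψ(a))`.
  mono : ∀ x ∈ Set.Ioc 0 Real.pi, ∀ y ∈ Set.Ioc 0 Real.pi, x ≤ y → ψ x * y ≤ ψ y * x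
  norm_le : ∀ θ ∈ Set.Ioc 0 Real.pi, ‖f θ‖ ≤ 1 - c * ψ θ
  norm_one_sub_le : ∀ θ ∈ Set.Ioc 0 Real.pi, ‖1 - f θ‖ ≤ C * ψ θ
  norm_deriv_le : ∀ θ ∈ Set.Ioc 0 Real.pi, θ * ‖f' θ‖ ≤ C * ψ θ

variable {f f' : ℝ → ℂ} {ψ : ℝ → ℝ} {c C : ℝ}

lemma IsMajorant.norm_pow_le (h : IsMajorant f f' ψ c C) {θ : ℝ} (hθ : θ ∈ Set.Ioc 0 Real.pi)
    (n : ℕ) : ‖f θ‖ ^ n ≤ Real.exp (-(c * (n * ψ θ))) := by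
  have h1 : ‖f θ‖ ≤ Real.exp (-(c * ψ θ)) :=
    (h.norm_le θ hθ).trans (by linarith [Real.add_one_le_exp (-(c * ψ θ))])
  calc ‖f θ‖ ^ n ≤ Real.exp (-(c * ψ θ)) ^ n := by gcongr
    _ = _ := by rw [← Real.exp_nat_mul]; congr 1; ring

/-- For `g = f^(n+1) (1 - f)`, everything is expressed through `x = (n + 1) ψ(θ)`: each factor `1 -
f` or `θ f'` costs `C ψ`, and the power of `f` yields `e^{-cx}`. -/
lemma IsMajorant.bounds (h : IsMajorant f f' ψ c C) {θ : ℝ} (hθ : θ ∈ Set.Ioc 0 Real.pi)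
    (n : ℕ) :
    ((n : ℝ) + 1) * ‖f θ ^ (n + 1) * (1 - f θ)‖ ≤
      C * (((n + 1) * ψ θ) * Real.exp (-(c * ((n + 1) * ψ θ)))) ∧
    ((n : ℝ) + 1) * (θ * ‖(n + 1) * f θ ^ n * f' θ * (1 - f θ) - f θ ^ (n + 1) * f' θ‖) ≤
      3 * C ^ 2 * (((n + 1) * ψ θ) ^ 2 * Real.exp (-(c * ((n + 1) * ψ θ)))) +
        C * (((n + 1) * ψ θ) * Real.exp (-(c * ((n + 1) * ψ θ)))) := by
  have hθ0 := hθ.1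
  have hψ := h.pos θ hθ
  have hc := h.c_pos
  have hC := h.C_pos
  have h1 := h.norm_pow_le hθ (n + 1)
  push_cast at h1
  have h2 := h.norm_one_sub_le θ hθ
  have h3 := h.norm_deriv_le θ hθ
  set E := Real.exp (-(c * (((n : ℝ) + 1) * ψ θ))) with hE
  have hE0 : 0 < E := Real.exp_pos _
  have h4 : ‖f θ‖ ^ n ≤ 3 * E := by
    refine (h.norm_pow_le hθ n).trans ?_
    have e : -(c * (n * ψ θ)) = c * ψ θ + -(c * (((n : ℝ) + 1) * ψ θ)) := by ring
    rw [e, Real.exp_add]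
    refine mul_le_mul_of_nonneg_right ?_ hE0.le
    -- Nonnegativity of `|f|` bounds `c ψ`, so passing from exponent `n + 1` to `n` costs at most `e
    -- < 3`.
    have h5 : c * ψ θ ≤ 1 := by linarith [h.norm_le θ hθ, norm_nonneg (f θ)]
    calc Real.exp (c * ψ θ) ≤ Real.exp 1 := Real.exp_le_exp.2 h5
      _ ≤ 3 := by linarith [Real.exp_one_lt_d9]
  constructor
  · rw [norm_mul, norm_pow]
    calc ((n : ℝ) + 1) * (‖f θ‖ ^ (n + 1) * ‖1 - f θ‖) ≤ ((n : ℝ) + 1) * (E * (C * ψ θ)) := by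
          gcongr
      _ = _ := by ring
  · have h6 : θ * ‖(n + 1) * f θ ^ n * f' θ * (1 - f θ) - f θ ^ (n + 1) * f' θ‖ ≤
        ((n : ℝ) + 1) * (‖f θ‖ ^ n) * (θ * ‖f' θ‖) * ‖1 - f θ‖ +
          ‖f θ‖ ^ (n + 1) * (θ * ‖f' θ‖) := by
      calc _ ≤ θ * (‖(n + 1) * f θ ^ n * f' θ * (1 - f θ)‖ + ‖f θ ^ (n + 1) * f' θ‖) := by
            gcongr; exact norm_sub_le _ _
        _ = _ := by
          have : ‖(n : ℂ) + 1‖ = (n : ℝ) + 1 := by exact_mod_cast Complex.norm_natCast (n + 1)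
          simp only [norm_mul, norm_pow, this]
          ring
    have h7 : θ * ‖(n + 1) * f θ ^ n * f' θ * (1 - f θ) - f θ ^ (n + 1) * f' θ‖ ≤
        ((n : ℝ) + 1) * (3 * E) * (C * ψ θ) * (C * ψ θ) + E * (C * ψ θ) := by
      refine h6.trans ?_
      gcongr
    calc _ ≤ ((n : ℝ) + 1) * (((n : ℝ) + 1) * (3 * E) * (C * ψ θ) * (C * ψ θ) + E * (C * ψ θ)) := by
          gcongr
      _ = _ := by ring

lemma IsMajorant.exists_bound (h : IsMajorant f f' ψ c C) :
    ∃ B : ℝ, 0 < B ∧ ∀ n : ℕ, ∃ a ∈ Set.Ioc 0 Real.pi, ∀ θ ∈ Set.Ioc 0 Real.pi,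
      (((n : ℝ) + 1) * ‖f θ ^ (n + 1) * (1 - f θ)‖) ^ 2 +
      (((n : ℝ) + 1) * a *
        ‖(n + 1) * f θ ^ n * f' θ * (1 - f θ) - f θ ^ (n + 1) * f' θ‖) ^ 2 ≤
      4 * B ^ 2 * (1 + (θ / a) ^ 2)⁻¹ := by
  have hc := h.c_pos
  have hC := h.C_pos
  have hπ := Real.pi_pos
  set p := ψ Real.pi with hp
  have hp0 : 0 < p := h.pos _ ⟨hπ, le_rfl⟩
  -- One summand for each of the four cases below: function and derivative for `θ ≤ a`, then the
  -- same for `θ ≥ a`.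
  set B := C / c + p * (3 * C ^ 2 / c + C) + 2 * C / (c ^ 2 * p) +
    (6 * C ^ 2 / c ^ 2 + C / c) with hB
  refine ⟨B, by positivity, fun n => ?_⟩
  have hn : (0 : ℝ) < (n : ℝ) + 1 := by positivity
  -- The scale `a` solves `(n + 1) ψ(a) = ψ(π)`. By monotonicity of `ψ(θ)/θ`, `x` is at most `pθ/a`
  -- below `a` and at least `pθ/a` above it.
  obtain ⟨a, ha, hψa⟩ := intermediate_value_Icc hπ.le h.continuousOn
    (show p / ((n : ℝ) + 1) ∈ Set.Icc (ψ 0) (ψ Real.pi) from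
      ⟨by rw [h.zero]; positivity, div_le_self hp0.le (by linarith [(Nat.cast_nonneg n : (0 : ℝ) ≤ n)])⟩)
  have ha0 : 0 < a := by
    refine lt_of_le_of_ne ha.1 fun h0 => ?_
    rw [← h0, h.zero] at hψa
    have : 0 < p / ((n : ℝ) + 1) := by positivity
    linarith
  have haI : a ∈ Set.Ioc 0 Real.pi := ⟨ha0, ha.2⟩
  refine ⟨a, haI, fun θ hθ => ?_⟩
  have hθ0 := hθ.1
  obtain ⟨hb1, hb2⟩ := h.bounds hθ n
  set x := ((n : ℝ) + 1) * ψ θ with hx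
  have hx0 : 0 < x := mul_pos hn (h.pos θ hθ)
  obtain ⟨e0, e1, e2⟩ := exp_neg_bounds hc hx0.le
  set E := Real.exp (-(c * x)) with hE
  have hE0 : 0 < E := Real.exp_pos _
  set u := ((n : ℝ) + 1) * ‖f θ ^ (n + 1) * (1 - f θ)‖ with hu
  set w := ‖(n + 1) * f θ ^ n * f' θ * (1 - f θ) - f θ ^ (n + 1) * f' θ‖ with hw
  have hw0 : 0 ≤ w := norm_nonneg _
  have k1 : C * (x * E) ≤ C * (1 / c) := by gcongr
  have k2 : 3 * C ^ 2 * (x ^ 2 * E) ≤ 3 * C ^ 2 * (2 / c ^ 2) := by gcongr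
  have i1 : C * (1 / c) = C / c := by ring
  have i2 : 3 * C ^ 2 * (2 / c ^ 2) = 6 * C ^ 2 / c ^ 2 := by ring
  have pB1 : 0 ≤ C / c := by positivity
  have pB2 : 0 ≤ p * (3 * C ^ 2 / c + C) := by positivity
  have pB3 : 0 ≤ 2 * C / (c ^ 2 * p) := by positivity
  have pB4 : 0 ≤ 6 * C ^ 2 / c ^ 2 + C / c := by positivity
  refine sq_le_of_le_min ha0 hθ0 (by positivity) (by positivity) (fun hle => ⟨?_, ?_⟩)
    fun hle => ⟨?_, ?_⟩
  · linarith
  · have hxle : x * a ≤ p * θ := by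
      have := h.mono θ hθ a haI hle
      rw [hψa] at this
      calc x * a = ((n : ℝ) + 1) * (ψ θ * a) := by rw [hx]; ring
        _ ≤ ((n : ℝ) + 1) * (p / ((n : ℝ) + 1) * θ) := by gcongr
        _ = p * θ := by field_simp
    have h1 : ((n : ℝ) + 1) * (θ * w) ≤ x * (3 * C ^ 2 / c + C) := by
      refine hb2.trans ?_
      have j1 : 3 * C ^ 2 * (x ^ 2 * E) ≤ x * (3 * C ^ 2 / c) := by
        calc _ = x * (3 * C ^ 2 * (x * E)) := by ring
          _ ≤ x * (3 * C ^ 2 * (1 / c)) := by gcongr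
          _ = _ := by ring
      have j2 : C * (x * E) ≤ x * C := by
        calc _ ≤ C * (x * 1) := by gcongr
          _ = _ := by ring
      linarith
    have h2 : θ * (((n : ℝ) + 1) * a * w) ≤ θ * (p * (3 * C ^ 2 / c + C)) := by
      calc _ = ((n : ℝ) + 1) * (θ * w) * a := by ring
        _ ≤ x * (3 * C ^ 2 / c + C) * a := by gcongr
        _ = x * a * (3 * C ^ 2 / c + C) := by ring
        _ ≤ p * θ * (3 * C ^ 2 / c + C) := by gcongr
        _ = _ := by ring
    have := le_of_mul_le_mul_left h2 hθ0
    linarith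
  · have hxge : p * θ ≤ x * a := by
      have := h.mono a haI θ hθ hle
      rw [hψa] at this
      calc p * θ = ((n : ℝ) + 1) * (p / ((n : ℝ) + 1) * θ) := by field_simp
        _ ≤ ((n : ℝ) + 1) * (ψ θ * a) := by gcongr
        _ = x * a := by rw [hx]; ring
    have h1 : u * (p * θ) ≤ 2 * C / c ^ 2 * a := by
      calc u * (p * θ) ≤ C * (x * E) * (x * a) := by gcongr
        _ = C * (x ^ 2 * E) * a := by ring
        _ ≤ C * (2 / c ^ 2) * a := by gcongr
        _ = _ := by ring
    have h2 : u ≤ 2 * C / (c ^ 2 * p) * (a / θ) := by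
      have e : 2 * C / (c ^ 2 * p) * (a / θ) = 2 * C / c ^ 2 * a / (p * θ) := by field_simp
      rw [e, le_div_iff₀ (by positivity)]
      exact h1
    refine h2.trans ?_
    gcongr
    linarith
  · have h1 : ((n : ℝ) + 1) * (θ * w) ≤ 6 * C ^ 2 / c ^ 2 + C / c := by linarith
    have h2 : ((n : ℝ) + 1) * a * w ≤ (6 * C ^ 2 / c ^ 2 + C / c) * (a / θ) := by
      rw [mul_div_assoc', le_div_iff₀ hθ0]
      calc _ = ((n : ℝ) + 1) * (θ * w) * a := by ring
        _ ≤ _ := by gcongr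
    refine h2.trans ?_
    gcongr
    linarith

lemma trig_neg (c : ℤ → ℂ) (θ : ℝ) :
    trig c (-θ) = (starRingEnd ℂ) (trig (fun n => (starRingEnd ℂ) (c n)) θ) := by
  rw [trig, trig, Complex.conj_tsum]
  refine tsum_congr fun n => ?_
  rw [map_mul, ← Complex.exp_conj]
  simp

lemma summable_abs_mul_norm_mass {σ : Measure ℤ} (h : Centered σ) :
    Summable fun n : ℤ => |(n : ℝ)| * ‖(mass σ n : ℂ)‖ := by
  simpa [abs_of_nonneg (mass_nonneg σ _)] using h.1

/-- The derivative of the Fourier transform of a measure with a first moment. -/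
def hatDeriv (σ : Measure ℤ) : ℝ → ℂ := trig (dcoef fun n => (mass σ n : ℂ))

lemma hasDerivAt_hat {σ : Measure ℤ} (h : Centered σ) (θ : ℝ) :
    HasDerivAt (hat σ) (hatDeriv σ θ) θ :=
  hasDerivAt_trig (summable_abs_mul_norm_mass h) θ

lemma continuous_hatDeriv {σ : Measure ℤ} (h : Centered σ) : Continuous (hatDeriv σ) :=
  continuous_trig (by simpa only [norm_dcoef] using summable_abs_mul_norm_mass h)

lemma hatDeriv_neg (σ : Measure ℤ) (θ : ℝ) :
    hatDeriv σ (-θ) = -(starRingEnd ℂ) (hatDeriv σ θ) := by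
  rw [hatDeriv, trig_neg, ← map_neg]
  congr 1
  rw [trig, trig, ← tsum_neg]
  refine tsum_congr fun n => ?_
  simp [dcoef]

/-- The differences of convolution powers are the Fourier coefficients of `g = f^(n+1) (1 - f)`. In
the Carlson inequality with `M = 1/a`, the prefactor `8a` meets an integral of order `1/((n + 1)²
a)`, so `a`, which depends on `n`, disappears and leaves `(4B/(n + 1))²`. -/
lemma IsMajorant.mem_rittSet {σ : ProbabilityMeasure ℤ} (hσ : Centered σ)
    (h : IsMajorant (hat σ) (hatDeriv σ) ψ c C) : σ ∈ rittSet := by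
  obtain ⟨B, hB, hbound⟩ := h.exists_bound
  refine ⟨4 * B, fun N hN => ?_⟩
  obtain ⟨n, rfl⟩ := Nat.exists_eq_add_of_le' hN
  obtain ⟨a, ⟨ha0, haπ⟩, hle⟩ := hbound n
  have hn : (0 : ℝ) < (n : ℝ) + 1 := by positivity
  set f := hat σ with hf
  set f' := hatDeriv σ with hf'
  set g : ℝ → ℂ := fun θ => f θ ^ (n + 1) * (1 - f θ) with hg
  set g' : ℝ → ℂ := fun θ =>
    (n + 1) * f θ ^ n * f' θ * (1 - f θ) - f θ ^ (n + 1) * f' θ with hg'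
  have hd : ∀ θ, HasDerivAt g (g' θ) θ := fun θ => by
    have h1 := hasDerivAt_hat hσ θ
    have h2 := (h1.pow (n + 1)).mul (h1.const_sub 1)
    refine h2.congr_deriv ?_
    simp only [hg', Pi.pow_apply, add_tsub_cancel_right]
    push_cast
    ring
  have hcf : Continuous f := continuous_hat _
  have hcf' : Continuous f' := continuous_hatDeriv hσ
  have hcg' : Continuous g' := by fun_prop
  have hcg : Continuous g := by fun_prop
  have hper : g (-Real.pi) = g Real.pi := by
    have : f (-Real.pi) = f Real.pi := by
      rw [hf, ← hat_add_two_pi _ (-Real.pi)]; congr 1; ring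
    simp only [hg, this]
  set d : ℤ → ℂ := fun k => (mass (convPow σ (n + 1)) k : ℂ) - mass (convPow σ (n + 1 + 1)) k with hdd
  have hds : Summable fun k => ‖d k‖ :=
    Summable.of_nonneg_of_le (fun k => norm_nonneg _) (fun k => norm_sub_le _ _)
      ((summable_norm_mass _).add (summable_norm_mass _))
  have hgd : g = trig d := by
    funext θ
    have h1 : trig d θ = hat (convPow σ (n + 1)) θ - hat (convPow σ (n + 1 + 1)) θ := by
      rw [hat, hat, ← (summable_trig (summable_norm_mass _) θ).tsum_sub
        (summable_trig (summable_norm_mass _) θ), trig]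
      exact tsum_congr fun k => by rw [← sub_mul]
    rw [h1, hat_convPow, hat_convPow, hg]
    ring
  have hcoef : ∀ k, |mass (convPow σ (n + 1)) k - mass (convPow σ (n + 1 + 1)) k| =
      ‖fourierCoeffOn neg_pi_lt_pi g k‖ := fun k => by
    rw [hgd, fourierCoeffOn_trig hds]
    simp only [hdd]
    rw [← Complex.ofReal_sub, Complex.norm_real, Real.norm_eq_abs]
  -- Here `a ≤ π < 4` supplies the restriction on `M`.
  have hM : 1 / 4 ≤ 1 / a := by
    gcongr
    linarith [Real.pi_lt_four]
  have hpt : ∀ θ ∈ Set.Ioc 0 Real.pi, (1 / a) ^ 2 * ‖g θ‖ ^ 2 + ‖g' θ‖ ^ 2 ≤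
      4 * B ^ 2 / (((n : ℝ) + 1) ^ 2 * a ^ 2) * (1 + (θ / a) ^ 2)⁻¹ := by
    intro θ hθ
    have h1 := hle θ hθ
    have e1 : (1 / a) ^ 2 * ‖g θ‖ ^ 2 + ‖g' θ‖ ^ 2 = ((((n : ℝ) + 1) * ‖g θ‖) ^ 2 +
        (((n : ℝ) + 1) * a * ‖g' θ‖) ^ 2) / (((n : ℝ) + 1) ^ 2 * a ^ 2) := by
      field_simp
    rw [e1, div_mul_eq_mul_div]
    gcongr
  have hnorm_neg : ∀ θ, ‖g (-θ)‖ = ‖g θ‖ ∧ ‖g' (-θ)‖ = ‖g' θ‖ := by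
    intro θ
    have h1 : g (-θ) = (starRingEnd ℂ) (g θ) := by
      simp only [hg, hf, hat_neg, map_mul, map_pow, map_sub, map_one]
    have h2 : g' (-θ) = -(starRingEnd ℂ) (g' θ) := by
      simp only [hg', hf, hf', hat_neg, hatDeriv_neg, map_mul, map_pow, map_sub, map_one, map_add,
        map_natCast]
      ring
    rw [h1, h2, norm_neg, RCLike.norm_conj, RCLike.norm_conj]
    exact ⟨rfl, rfl⟩
  -- The majorant gives information only for `θ > 0`; the origin follows by continuity and negative
  -- angles by conjugation.
  have hg0 : (1 / a) ^ 2 * ‖g 0‖ ^ 2 + ‖g' 0‖ ^ 2 ≤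
      4 * B ^ 2 / (((n : ℝ) + 1) ^ 2 * a ^ 2) * (1 + (0 / a) ^ 2)⁻¹ := by
    have hcl : Tendsto (fun θ : ℝ => (1 / a) ^ 2 * ‖g θ‖ ^ 2 + ‖g' θ‖ ^ 2) (𝓝[>] 0)
        (𝓝 ((1 / a) ^ 2 * ‖g 0‖ ^ 2 + ‖g' 0‖ ^ 2)) :=
      (Continuous.tendsto (by fun_prop) 0).mono_left nhdsWithin_le_nhds
    have hcr : Tendsto (fun θ : ℝ => 4 * B ^ 2 / (((n : ℝ) + 1) ^ 2 * a ^ 2) *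
        (1 + (θ / a) ^ 2)⁻¹) (𝓝[>] 0)
        (𝓝 (4 * B ^ 2 / (((n : ℝ) + 1) ^ 2 * a ^ 2) * (1 + (0 / a) ^ 2)⁻¹)) := by
      refine Tendsto.mono_left (Continuous.tendsto (Continuous.mul continuous_const
        (Continuous.inv₀ (by fun_prop) fun x => by positivity)) 0) nhdsWithin_le_nhds
    refine le_of_tendsto_of_tendsto hcl hcr ?_
    filter_upwards [Ioc_mem_nhdsGT Real.pi_pos] with θ hθ using hpt θ hθ
  have hall : ∀ θ ∈ Set.Icc (-Real.pi) Real.pi, (1 / a) ^ 2 * ‖g θ‖ ^ 2 + ‖g' θ‖ ^ 2 ≤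
      4 * B ^ 2 / (((n : ℝ) + 1) ^ 2 * a ^ 2) * (1 + (θ / a) ^ 2)⁻¹ := by
    intro θ hθ
    rcases lt_trichotomy θ 0 with h0 | h0 | h0
    · have h1 := hpt (-θ) ⟨by linarith, by linarith [hθ.1]⟩
      rw [(hnorm_neg θ).1, (hnorm_neg θ).2, neg_div, neg_sq] at h1
      exact h1
    · rw [h0]; exact hg0
    · exact hpt θ ⟨h0, hθ.2⟩
  have hint : ∫ θ in (-Real.pi)..Real.pi, ((1 / a) ^ 2 * ‖g θ‖ ^ 2 + ‖g' θ‖ ^ 2) ≤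
      4 * B ^ 2 / (((n : ℝ) + 1) ^ 2 * a ^ 2) * (a * Real.pi) := by
    have hcr : Continuous fun θ : ℝ => 4 * B ^ 2 / (((n : ℝ) + 1) ^ 2 * a ^ 2) *
        (1 + (θ / a) ^ 2)⁻¹ :=
      Continuous.mul continuous_const (Continuous.inv₀ (by fun_prop) fun x => by positivity)
    refine (intervalIntegral.integral_mono_on neg_pi_lt_pi.le
      (Continuous.intervalIntegrable (by fun_prop) _ _) (hcr.intervalIntegrable _ _) hall).trans ?_
    rw [intervalIntegral.integral_const_mul]
    gcongr
    exact integral_inv_one_add_div_sq_le ha0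
  have hsq : ∀ s : Finset ℤ, (∑ k ∈ s, ‖fourierCoeffOn neg_pi_lt_pi g k‖) ^ 2 ≤
      (4 * B / ((n : ℝ) + 1)) ^ 2 := by
    intro s
    refine (sq_sum_norm_fourierCoeffOn_le hd hcg' hper hM s).trans ?_
    have hπ := Real.pi_pos
    calc _ ≤ 8 / (1 / a) * ((2 * Real.pi)⁻¹ *
          (4 * B ^ 2 / (((n : ℝ) + 1) ^ 2 * a ^ 2) * (a * Real.pi))) := by gcongr
      _ = _ := by field_simp; norm_num
  have hsum : ∑' k : ℤ, |mass (convPow σ (n + 1)) k - mass (convPow σ (n + 1 + 1)) k| ≤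
      4 * B / ((n : ℝ) + 1) := by
    simp only [hcoef]
    refine Real.tsum_le_of_sum_le (fun k => norm_nonneg _) fun s => ?_
    exact abs_le_of_sq_le_sq' (hsq s) (by positivity) |>.2
  rw [le_div_iff₀ hn] at hsum
  push_cast
  linarith

/-! ### The majorant and the derivatives of the integral representation -/

section MajorantAndPerturbation

variable {m : Measure ℝ}

/-- The function `ψ(θ) = θ² ∫ (1 - t + |θ|)⁻¹ dm(t)`. -/
def majorant (m : Measure ℝ) (θ : ℝ) : ℝ := θ ^ 2 * stieltjesInt m 0 |θ|

lemma majorant_of_pos {θ : ℝ} (h : 0 < θ) : majorant m θ = θ ^ 2 * stieltjesInt m 0 θ := by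
  rw [majorant, abs_of_pos h]

lemma majorant_neg (θ : ℝ) : majorant m (-θ) = majorant m θ := by
  rw [majorant, majorant, abs_neg, neg_sq]

lemma majorant_zero : majorant m 0 = 0 := by simp [majorant]

lemma contDiffOn_majorant [IsFiniteMeasure m] (hm : ∀ᵐ t ∂m, t ∈ Set.Ico (0 : ℝ) 1) :
    ContDiffOn ℝ 1 (majorant m) {0}ᶜ := by
  intro θ hθ
  have hθ0 : θ ≠ 0 := hθ
  have h1 : ContDiffAt ℝ 1 (stieltjesInt m 0) |θ| :=
    (contDiffOn_stieltjesInt hm 0).contDiffAt (Ioi_mem_nhds (abs_pos.2 hθ0))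
  have h2 : ContDiffAt ℝ 1 (fun θ : ℝ => |θ|) θ := contDiffAt_abs hθ0
  exact ((contDiffAt_id.pow 2).mul (h1.comp θ h2)).contDiffWithinAt

lemma continuous_majorant [IsFiniteMeasure m] (hm : ∀ᵐ t ∂m, t ∈ Set.Ico (0 : ℝ) 1) :
    Continuous (majorant m) := by
  rw [continuous_iff_continuousAt]
  intro θ
  by_cases hθ : θ = 0
  · subst hθ
    rw [ContinuousAt, majorant_zero]
    refine squeeze_zero_norm (a := fun θ => |θ| * m.real Set.univ) (fun θ => ?_) ?_
    · by_cases h0 : θ = 0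
      · simp [h0, majorant_zero]
      · have hp := abs_pos.2 h0
        have h1 := mul_stieltjesInt_zero_le hm hp
        have h2 := stieltjesInt_nonneg hm 0 hp
        rw [majorant, Real.norm_of_nonneg (by positivity), ← sq_abs]
        calc |θ| ^ 2 * stieltjesInt m 0 |θ| = |θ| * (|θ| * stieltjesInt m 0 |θ|) := by ring
          _ ≤ _ := by gcongr
    · have : Continuous fun θ : ℝ => |θ| * m.real Set.univ := by fun_prop
      simpa using this.tendsto 0
  · exact ((contDiffOn_majorant hm).continuousOn.continuousAt
      (isOpen_compl_singleton.mem_nhds hθ))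

lemma hasDerivAt_majorant [IsFiniteMeasure m] (hm : ∀ᵐ t ∂m, t ∈ Set.Ico (0 : ℝ) 1) {θ : ℝ}
    (h0 : 0 < θ) : HasDerivAt (majorant m)
      (2 * θ * stieltjesInt m 0 θ - θ ^ 2 * stieltjesInt m 1 θ) θ := by
  have h1 := ((hasDerivAt_id θ).pow 2).mul (hasDerivAt_stieltjesInt hm 0 h0)
  refine (h1.congr_deriv ?_).congr_of_eventuallyEq ?_
  · simp; ring
  · filter_upwards [Ioi_mem_nhds h0] with x hx
    exact majorant_of_pos hx

/-- From `θ ψ' = 2θ² R - θ³ ∫ (1 - t + θ)⁻² dm` and `θ ∫ (1 - t + θ)⁻² dm ≤ R`. This reduces the two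
conditions of (H) involving `ψ'` to bounds by `ψ` itself. -/
lemma majorant_le_mul_derivWithin [IsFiniteMeasure m] (hm : ∀ᵐ t ∂m, t ∈ Set.Ico (0 : ℝ) 1)
    {θ : ℝ} (hθ : θ ∈ Set.Ioc 0 Real.pi) :
    majorant m θ ≤ θ * derivWithin (majorant m) puncturedInterval θ := by
  have h0 := hθ.1
  -- Needed so that `derivWithin` is the genuine derivative even at the endpoint `π`.
  have hu : UniqueDiffWithinAt ℝ puncturedInterval θ := by
    refine (uniqueDiffOn_Ioc 0 Real.pi θ hθ).mono fun x hx => ?_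
    exact ⟨⟨by linarith [hx.1, Real.pi_pos], hx.2⟩, hx.1.ne'⟩
  rw [(hasDerivAt_majorant hm h0).hasDerivWithinAt.derivWithin hu, majorant_of_pos h0]
  have h1 := stieltjesInt_succ_le hm 0 h0
  nlinarith [mul_le_mul_of_nonneg_left h1 (sq_nonneg θ)]

/-- The majorant is never smaller than order `θ²`, so it absorbs any perturbation with a second
moment. -/
lemma sq_le_majorant [IsFiniteMeasure m] (hm : ∀ᵐ t ∂m, t ∈ Set.Ico (0 : ℝ) 1) {θ : ℝ}
    (hθ : θ ∈ Set.Ioc 0 Real.pi) :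
    m.real Set.univ / (1 + Real.pi) * θ ^ 2 ≤ majorant m θ := by
  have h0 := hθ.1
  rw [majorant_of_pos h0, mul_comm]
  refine mul_le_mul_of_nonneg_left (le_trans ?_ (stieltjesInt_zero_lower hm h0)) (sq_nonneg θ)
  have := hθ.2
  gcongr

lemma majorant_mul_le [IsFiniteMeasure m] (hm : ∀ᵐ t ∂m, t ∈ Set.Ico (0 : ℝ) 1) {x y : ℝ}
    (hx : 0 < x) (hxy : x ≤ y) : majorant m x * y ≤ majorant m y * x := by
  have hy := hx.trans_le hxy
  rw [majorant_of_pos hx, majorant_of_pos hy]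
  have h1 := mul_stieltjesInt_le_mul hm hx hxy
  calc _ = x * stieltjesInt m 0 x * (x * y) := by ring
    _ ≤ y * stieltjesInt m 0 y * (x * y) := by gcongr
    _ = _ := by ring

/-- The function `θ ↦ ∫ t^k (1 - t e^{iθ})^{-(k+1)} dm(t)`. -/
def circleInt (m : Measure ℝ) (k : ℕ) (θ : ℝ) : ℂ := cauchyInt m k (Complex.exp (θ * Complex.I))

lemma hasDerivAt_exp_mul_I (θ : ℝ) :
    HasDerivAt (fun θ : ℝ => Complex.exp (θ * Complex.I))
      (Complex.exp (θ * Complex.I) * Complex.I) θ := by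
  have h1 : HasDerivAt (fun θ : ℝ => (θ : ℂ) * Complex.I) (((1 : ℝ) : ℂ) * Complex.I) θ :=
    ((hasDerivAt_id θ).ofReal_comp).mul_const _
  refine h1.cexp.congr_deriv ?_
  simp

lemma hasDerivAt_circleInt [IsFiniteMeasure m] (hm : ∀ᵐ t ∂m, t ∈ Set.Ico (0 : ℝ) 1) (k : ℕ)
    {θ : ℝ} (hθ : Complex.exp (θ * Complex.I) ≠ 1) :
    HasDerivAt (circleInt m k) ((k + 1) * circleInt m (k + 1) θ *
      (Complex.exp (θ * Complex.I) * Complex.I)) θ := by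
  have := (hasDerivAt_cauchyInt hm k (exp_mul_I_mem_slitSet hθ)).scomp θ (hasDerivAt_exp_mul_I θ)
  refine this.congr_deriv ?_
  rw [smul_eq_mul, mul_comm]
  rfl

/-- The integral formula for `1 - hat μ`. -/
def oneSubHat (m : Measure ℝ) (θ : ℝ) : ℂ := (2 - 2 * Real.cos θ : ℝ) * circleInt m 0 θ

/-- The derivative of `oneSubHat`. -/
def oneSubHat₁ (m : Measure ℝ) (θ : ℝ) : ℂ := (2 * Real.sin θ : ℝ) * circleInt m 0 θ +
  (2 - 2 * Real.cos θ : ℝ) * (circleInt m 1 θ * (Complex.exp (θ * Complex.I) * Complex.I))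

/-- The second derivative of `oneSubHat`. -/
def oneSubHat₂ (m : Measure ℝ) (θ : ℝ) : ℂ := (2 * Real.cos θ : ℝ) * circleInt m 0 θ +
  2 * ((2 * Real.sin θ : ℝ) * (circleInt m 1 θ * (Complex.exp (θ * Complex.I) * Complex.I))) +
  (2 - 2 * Real.cos θ : ℝ) * (2 * circleInt m 2 θ * (Complex.exp (θ * Complex.I) * Complex.I) ^ 2 +
    circleInt m 1 θ * (Complex.exp (θ * Complex.I) * Complex.I * Complex.I))

lemma hasDerivAt_two_sub_two_cos (θ : ℝ) :
    HasDerivAt (fun θ : ℝ => ((2 - 2 * Real.cos θ : ℝ) : ℂ)) ((2 * Real.sin θ : ℝ) : ℂ) θ := by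
  refine HasDerivAt.ofReal_comp ?_
  exact (((Real.hasDerivAt_cos θ).const_mul 2).const_sub 2).congr_deriv (by ring)

lemma hasDerivAt_oneSubHat [IsFiniteMeasure m] (hm : ∀ᵐ t ∂m, t ∈ Set.Ico (0 : ℝ) 1)
    {θ : ℝ} (hθ : Complex.exp (θ * Complex.I) ≠ 1) :
    HasDerivAt (oneSubHat m) (oneSubHat₁ m θ) θ := by
  refine ((hasDerivAt_two_sub_two_cos θ).mul (hasDerivAt_circleInt hm 0 hθ)).congr_deriv ?_
  rw [oneSubHat₁]
  push_cast
  ring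

lemma hasDerivAt_oneSubHat₁ [IsFiniteMeasure m] (hm : ∀ᵐ t ∂m, t ∈ Set.Ico (0 : ℝ) 1)
    {θ : ℝ} (hθ : Complex.exp (θ * Complex.I) ≠ 1) :
    HasDerivAt (oneSubHat₁ m) (oneSubHat₂ m θ) θ := by
  have hs : HasDerivAt (fun θ : ℝ => ((2 * Real.sin θ : ℝ) : ℂ)) ((2 * Real.cos θ : ℝ) : ℂ) θ :=
    HasDerivAt.ofReal_comp ((Real.hasDerivAt_sin θ).const_mul 2)
  have h0 := hasDerivAt_circleInt hm 0 hθ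
  have h1 := hasDerivAt_circleInt hm 1 hθ
  have he := (hasDerivAt_exp_mul_I θ).mul_const Complex.I
  refine ((hs.mul h0).add ((hasDerivAt_two_sub_two_cos θ).mul (h1.mul he))).congr_deriv ?_
  rw [oneSubHat₂]
  simp only [Pi.mul_apply]
  push_cast
  ring

lemma norm_circleInt_le [IsFiniteMeasure m] (hm : ∀ᵐ t ∂m, t ∈ Set.Ico (0 : ℝ) 1) {θ : ℝ}
    (hθ : θ ∈ Set.Ioc 0 Real.pi) :
    ‖circleInt m 0 θ‖ ≤ 8 * stieltjesInt m 0 θ ∧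
    θ * ‖circleInt m 1 θ‖ ≤ 64 * stieltjesInt m 0 θ ∧
    θ ^ 2 * ‖circleInt m 2 θ‖ ≤ 512 * stieltjesInt m 0 θ := by
  have h0 := hθ.1
  have k0 := norm_cauchyInt_le hm 0 h0 hθ.2
  have k1 := norm_cauchyInt_le hm 1 h0 hθ.2
  have k2 := norm_cauchyInt_le hm 2 h0 hθ.2
  have s1 := stieltjesInt_succ_le hm 0 h0
  have s2 := stieltjesInt_succ_le hm 1 h0
  norm_num at k0 k1 k2 s1 s2
  refine ⟨k0, ?_, ?_⟩
  · calc _ ≤ θ * (64 * stieltjesInt m 1 θ) := by gcongr; exact k1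
      _ = 64 * (θ * stieltjesInt m 1 θ) := by ring
      _ ≤ _ := by gcongr
  · calc _ ≤ θ ^ 2 * (512 * stieltjesInt m 2 θ) := by gcongr; exact k2
      _ = 512 * (θ * (θ * stieltjesInt m 2 θ)) := by ring
      _ ≤ 512 * (θ * stieltjesInt m 1 θ) := by gcongr
      _ ≤ _ := by gcongr

lemma norm_oneSubHat₁_le [IsFiniteMeasure m] (hm : ∀ᵐ t ∂m, t ∈ Set.Ico (0 : ℝ) 1) {θ : ℝ}
    (hθ : θ ∈ Set.Ioc 0 Real.pi) : θ * ‖oneSubHat₁ m θ‖ ≤ 80 * majorant m θ := by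
  have h0 := hθ.1
  obtain ⟨k0, k1, -⟩ := norm_circleInt_le hm hθ
  have hsin : |2 * Real.sin θ| ≤ 2 * θ := by
    rw [abs_mul, abs_two]
    have := Real.abs_sin_le_abs (x := θ)
    rw [abs_of_pos h0] at this
    linarith
  have hcos : |2 - 2 * Real.cos θ| ≤ θ ^ 2 := by
    rw [abs_of_nonneg (by linarith [Real.cos_le_one θ])]
    exact (two_sub_two_cos_bounds h0 hθ.2).2
  rw [majorant_of_pos h0]
  calc θ * ‖oneSubHat₁ m θ‖ ≤ θ * (|2 * Real.sin θ| * ‖circleInt m 0 θ‖ +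
        |2 - 2 * Real.cos θ| * ‖circleInt m 1 θ‖) := by
        gcongr
        refine (norm_add_le _ _).trans_eq ?_
        simp only [norm_mul, Complex.norm_real, Real.norm_eq_abs, Complex.norm_exp_ofReal_mul_I,
          Complex.norm_I, mul_one, abs_mul]
    _ ≤ θ * (2 * θ * ‖circleInt m 0 θ‖ + θ ^ 2 * ‖circleInt m 1 θ‖) := by gcongr
    _ = 2 * θ ^ 2 * ‖circleInt m 0 θ‖ + θ ^ 2 * (θ * ‖circleInt m 1 θ‖) := by ring
    _ ≤ 2 * θ ^ 2 * (8 * stieltjesInt m 0 θ) + θ ^ 2 * (64 * stieltjesInt m 0 θ) := by gcongr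
    _ = _ := by ring

/-- Each derivative falling on `2 - 2 cos θ` or on the circle integral costs one factor `θ⁻¹`. The
constant is `16 + 256 + 1024 + 256`, the last term using `θ ≤ 4`. -/
lemma norm_oneSubHat₂_le [IsFiniteMeasure m] (hm : ∀ᵐ t ∂m, t ∈ Set.Ico (0 : ℝ) 1) {θ : ℝ}
    (hθ : θ ∈ Set.Ioc 0 Real.pi) : θ ^ 2 * ‖oneSubHat₂ m θ‖ ≤ 1552 * majorant m θ := by
  have h0 := hθ.1
  obtain ⟨k0, k1, k2⟩ := norm_circleInt_le hm hθ
  have hR := stieltjesInt_nonneg hm 0 h0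
  have hsin : |2 * Real.sin θ| ≤ 2 * θ := by
    rw [abs_mul, abs_two]
    have := Real.abs_sin_le_abs (x := θ)
    rw [abs_of_pos h0] at this
    linarith
  have hcos : |2 - 2 * Real.cos θ| ≤ θ ^ 2 := by
    rw [abs_of_nonneg (by linarith [Real.cos_le_one θ])]
    exact (two_sub_two_cos_bounds h0 hθ.2).2
  have hcos' : |2 * Real.cos θ| ≤ 2 := by
    rw [abs_mul, abs_two]
    linarith [Real.abs_cos_le_one θ]
  have hθ4 : θ ≤ 4 := by linarith [hθ.2, Real.pi_lt_four]
  rw [majorant_of_pos h0]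
  calc θ ^ 2 * ‖oneSubHat₂ m θ‖ ≤ θ ^ 2 * (|2 * Real.cos θ| * ‖circleInt m 0 θ‖ +
        2 * (|2 * Real.sin θ| * ‖circleInt m 1 θ‖) +
        |2 - 2 * Real.cos θ| * (2 * ‖circleInt m 2 θ‖ + ‖circleInt m 1 θ‖)) := by
        gcongr
        refine le_trans norm_add₃_le ?_
        simp only [norm_mul, Complex.norm_real, Real.norm_eq_abs, Complex.norm_exp_ofReal_mul_I,
          Complex.norm_I, mul_one, Complex.norm_ofNat, abs_mul]
        gcongr
        refine (norm_add_le _ _).trans_eq ?_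
        simp only [norm_mul, norm_pow, Complex.norm_exp_ofReal_mul_I,
          Complex.norm_I, mul_one, Complex.norm_ofNat, one_pow]
    _ ≤ θ ^ 2 * (2 * ‖circleInt m 0 θ‖ + 2 * (2 * θ * ‖circleInt m 1 θ‖) +
        θ ^ 2 * (2 * ‖circleInt m 2 θ‖ + ‖circleInt m 1 θ‖)) := by gcongr
    _ = θ ^ 2 * (2 * ‖circleInt m 0 θ‖ + 4 * (θ * ‖circleInt m 1 θ‖) +
        2 * (θ ^ 2 * ‖circleInt m 2 θ‖) + θ * (θ * ‖circleInt m 1 θ‖)) := by ring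
    _ ≤ θ ^ 2 * (2 * (8 * stieltjesInt m 0 θ) + 4 * (64 * stieltjesInt m 0 θ) +
        2 * (512 * stieltjesInt m 0 θ) + 4 * (64 * stieltjesInt m 0 θ)) := by gcongr
    _ = _ := by ring

lemma contDiffAt_oneSubHat [IsFiniteMeasure m] (hm : ∀ᵐ t ∂m, t ∈ Set.Ico (0 : ℝ) 1)
    {θ : ℝ} (hθ : Complex.exp (θ * Complex.I) ≠ 1) : ContDiffAt ℝ 2 (oneSubHat m) θ := by
  have h1 : ContDiffAt ℝ 2 (cauchyInt m 0) (Complex.exp (θ * Complex.I)) :=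
    (contDiffAt_cauchyInt hm 0 (exp_mul_I_mem_slitSet hθ) 2).restrict_scalars ℝ
  have h2 : ContDiffAt ℝ 2 (fun θ : ℝ => Complex.exp (θ * Complex.I)) θ :=
    ((Complex.ofRealCLM.contDiff.mul contDiff_const).cexp).contDiffAt
  have h3 : ContDiffAt ℝ 2 (fun θ : ℝ => ((2 - 2 * Real.cos θ : ℝ) : ℂ)) θ :=
    (Complex.ofRealCLM.contDiff.comp
      (contDiff_const.sub (contDiff_const.mul Real.contDiff_cos))).contDiffAt
  exact h3.mul (h1.comp θ h2)

lemma isOpen_exp_mul_I_ne_one : IsOpen {θ : ℝ | Complex.exp (θ * Complex.I) ≠ 1} :=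
  isOpen_ne_fun (by fun_prop) continuous_const

lemma exp_mul_I_ne_one_of_mem_puncturedInterval {θ : ℝ} (hθ : θ ∈ puncturedInterval) :
    Complex.exp (θ * Complex.I) ≠ 1 := by
  have hπ := Real.pi_pos
  have hne : θ ≠ 0 := hθ.2
  rcases lt_or_gt_of_ne hne with h | h
  · intro he
    refine exp_mul_I_ne_one (θ := -θ) ⟨by linarith, by linarith [hθ.1.1]⟩ ?_
    push_cast
    rw [neg_mul, Complex.exp_neg, he, inv_one]
  · exact exp_mul_I_ne_one ⟨h, by linarith [hθ.1.2]⟩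

lemma IsRepresentedBy.hat_eq_one_sub {μ : Measure ℤ} (h : IsRepresentedBy μ m) {θ : ℝ}
    (hθ : Complex.exp (θ * Complex.I) ≠ 1) : hat μ θ = 1 - oneSubHat m θ := h.hat_eq θ hθ

end MajorantAndPerturbation

/-! ### Perturbations with a second moment -/

lemma norm_dcoef_dcoef (e : ℤ → ℂ) (n : ℤ) : ‖dcoef (dcoef e) n‖ = (n : ℝ) ^ 2 * ‖e n‖ := by
  rw [norm_dcoef, norm_dcoef, ← mul_assoc, abs_mul_abs_self, pow_two]

section SecondMoment

variable {e : ℤ → ℂ}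

lemma hasDerivAt_trig_dcoef (he : Summable fun n : ℤ => (n : ℝ) ^ 2 * ‖e n‖) (θ : ℝ) :
    HasDerivAt (trig (dcoef e)) (trig (dcoef (dcoef e)) θ) θ := by
  refine hasDerivAt_trig (he.congr fun n => ?_) θ
  rw [← norm_dcoef_dcoef, norm_dcoef]

lemma norm_trig_dcoef_dcoef_le (he : Summable fun n : ℤ => (n : ℝ) ^ 2 * ‖e n‖) (θ : ℝ) :
    ‖trig (dcoef (dcoef e)) θ‖ ≤ ∑' n : ℤ, (n : ℝ) ^ 2 * ‖e n‖ := by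
  refine (norm_trig_le (by simpa only [norm_dcoef_dcoef] using he) θ).trans_eq ?_
  simp only [norm_dcoef_dcoef]

lemma norm_trig_dcoef_le (he : Summable fun n : ℤ => (n : ℝ) ^ 2 * ‖e n‖)
    (h0 : trig (dcoef e) 0 = 0) {θ : ℝ} (hθ : 0 ≤ θ) :
    ‖trig (dcoef e) θ‖ ≤ (∑' n : ℤ, (n : ℝ) ^ 2 * ‖e n‖) * θ := by
  have := norm_image_sub_le_of_norm_deriv_le_segment' (a := 0) (b := θ)
    (fun x _ => (hasDerivAt_trig_dcoef he x).hasDerivWithinAt)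
    (fun x _ => norm_trig_dcoef_dcoef_le he x) θ ⟨hθ, le_rfl⟩
  simpa [h0] using this

lemma norm_trig_sub_le (he : Summable fun n : ℤ => (n : ℝ) ^ 2 * ‖e n‖)
    (h0 : trig (dcoef e) 0 = 0) {θ : ℝ} (hθ : 0 ≤ θ) :
    ‖trig e θ - trig e 0‖ ≤ (∑' n : ℤ, (n : ℝ) ^ 2 * ‖e n‖) * θ ^ 2 := by
  have he1 := summable_abs_mul_of_summable_sq_mul he fun n => norm_nonneg _
  have hA : 0 ≤ ∑' n : ℤ, (n : ℝ) ^ 2 * ‖e n‖ := tsum_nonneg fun n => by positivity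
  have := norm_image_sub_le_of_norm_deriv_le_segment' (a := 0) (b := θ)
    (fun x _ => (hasDerivAt_trig he1 x).hasDerivWithinAt)
    (fun x hx => (norm_trig_dcoef_le he h0 hx.1).trans
      (mul_le_mul_of_nonneg_left hx.2.le hA)) θ ⟨hθ, le_rfl⟩
  refine this.trans_eq ?_
  ring

lemma contDiff_trig (he : Summable fun n : ℤ => (n : ℝ) ^ 2 * ‖e n‖) : ContDiff ℝ 2 (trig e) := by
  have he1 := summable_abs_mul_of_summable_sq_mul he fun n => norm_nonneg _
  have hd1 : deriv (trig e) = trig (dcoef e) := funext fun θ => (hasDerivAt_trig he1 θ).deriv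
  have hd2 : deriv (trig (dcoef e)) = trig (dcoef (dcoef e)) :=
    funext fun θ => (hasDerivAt_trig_dcoef he θ).deriv
  rw [show (2 : WithTop ℕ∞) = 1 + 1 by norm_num, contDiff_succ_iff_deriv, hd1]
  refine ⟨fun θ => (hasDerivAt_trig he1 θ).differentiableAt, by simp, ?_⟩
  rw [contDiff_one_iff_deriv, hd2]
  exact ⟨fun θ => (hasDerivAt_trig_dcoef he θ).differentiableAt,
    continuous_trig (by simpa only [norm_dcoef_dcoef] using he)⟩

end SecondMoment

lemma hatDeriv_zero {σ : Measure ℤ} (h : Centered σ) : hatDeriv σ 0 = 0 := by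
  have h1 : hatDeriv σ 0 = ∑' n : ℤ, ((((n : ℝ) * mass σ n : ℝ) : ℂ) * Complex.I) := by
    refine tsum_congr fun n => ?_
    simp only [dcoef, mul_zero, Complex.ofReal_zero, zero_mul, Complex.exp_zero, mul_one]
    push_cast; ring
  rw [h1, tsum_mul_right, ← Complex.ofReal_tsum, h.2]
  simp

/-- A centered measure `σ` differing from `c μ` by a second moment. -/
structure IsPerturbation (μ σ : Measure ℤ) (c : ℝ) : Prop where
  c_pos : 0 < c
  centered : Centered σ
  centered' : Centered μ
  summable : Summable fun n : ℤ => (n : ℝ) ^ 2 * |mass σ n - c * mass μ n|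

/-- The coefficients of the difference of the two Fourier transforms. -/
def diffCoef (μ σ : Measure ℤ) (c : ℝ) (n : ℤ) : ℂ := ((mass σ n - c * mass μ n : ℝ) : ℂ)

namespace IsPerturbation

variable {μ σ : Measure ℤ} {c : ℝ}

lemma summable_diffCoef (h : IsPerturbation μ σ c) :
    Summable fun n : ℤ => (n : ℝ) ^ 2 * ‖diffCoef μ σ c n‖ := by
  simpa only [diffCoef, Complex.norm_real, Real.norm_eq_abs] using h.summable

lemma hat_eq [IsFiniteMeasure μ] [IsFiniteMeasure σ] (θ : ℝ) :
    hat σ θ = c * hat μ θ + trig (diffCoef μ σ c) θ := by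
  have h1 := summable_trig (summable_norm_mass μ) θ
  have h2 := summable_trig (summable_norm_mass σ) θ
  have e : trig (diffCoef μ σ c) θ = hat σ θ - c * hat μ θ := by
    rw [hat, hat, ← tsum_mul_left, ← h2.tsum_sub (h1.mul_left _)]
    refine tsum_congr fun n => ?_
    rw [diffCoef]; push_cast; ring
  rw [e]; ring

lemma hatDeriv_eq (h : IsPerturbation μ σ c) (θ : ℝ) :
    hatDeriv σ θ = c * hatDeriv μ θ + trig (dcoef (diffCoef μ σ c)) θ := by
  have h1 := summable_trig (c := dcoef fun n => (mass μ n : ℂ))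
    (by simpa only [norm_dcoef] using summable_abs_mul_norm_mass h.centered') θ
  have h2 := summable_trig (c := dcoef fun n => (mass σ n : ℂ))
    (by simpa only [norm_dcoef] using summable_abs_mul_norm_mass h.centered) θ
  have e : trig (dcoef (diffCoef μ σ c)) θ = hatDeriv σ θ - c * hatDeriv μ θ := by
    rw [hatDeriv, hatDeriv, trig, trig, trig, ← tsum_mul_left, ← h2.tsum_sub (h1.mul_left _)]
    refine tsum_congr fun n => ?_
    simp only [dcoef, diffCoef]; push_cast; ring
  rw [e]; ring

/-- This is where centering of both measures enters: without a linear term, the perturbation is of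
order `θ²` after subtracting its value at `0`. -/
lemma trig_dcoef_diffCoef_zero (h : IsPerturbation μ σ c) :
    trig (dcoef (diffCoef μ σ c)) 0 = 0 := by
  have := h.hatDeriv_eq 0
  rw [hatDeriv_zero h.centered, hatDeriv_zero h.centered', mul_zero, zero_add] at this
  exact this.symm

lemma one_sub_hat [IsProbabilityMeasure μ] [IsProbabilityMeasure σ] (θ : ℝ) :
    1 - hat σ θ = c * (1 - hat μ θ) -
      (trig (diffCoef μ σ c) θ - trig (diffCoef μ σ c) 0) := by
  have h0 := hat_eq (μ := μ) (σ := σ) (c := c) 0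
  rw [hat_zero, hat_zero, mul_one] at h0
  rw [hat_eq (μ := μ) (c := c) θ]
  linear_combination h0

variable {m : Measure ℝ}

lemma deriv_hat (h : IsPerturbation μ σ c) : deriv (hat σ) = hatDeriv σ :=
  funext fun θ => (hasDerivAt_hat h.centered θ).deriv

lemma hatDeriv_eq_of_ne (h : IsPerturbation μ σ c) (hr : IsRepresentedBy μ m) {θ : ℝ}
    (hθ : Complex.exp (θ * Complex.I) ≠ 1) :
    hatDeriv σ θ = -c * oneSubHat₁ m θ + trig (dcoef (diffCoef μ σ c)) θ := by
  have := hr.finite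
  have h1 : HasDerivAt (hat μ) (-oneSubHat₁ m θ) θ := by
    refine ((hasDerivAt_oneSubHat hr.ae_mem hθ).const_sub 1).congr_of_eventuallyEq ?_
    filter_upwards [isOpen_exp_mul_I_ne_one.mem_nhds hθ] with x hx
    exact hr.hat_eq_one_sub hx
  rw [h.hatDeriv_eq, (hasDerivAt_hat h.centered' θ).unique h1]
  ring

lemma deriv_deriv_hat (h : IsPerturbation μ σ c) (hr : IsRepresentedBy μ m) {θ : ℝ}
    (hθ : Complex.exp (θ * Complex.I) ≠ 1) :
    deriv (deriv (hat σ)) θ = -c * oneSubHat₂ m θ + trig (dcoef (dcoef (diffCoef μ σ c))) θ := by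
  have := hr.finite
  rw [h.deriv_hat]
  have h1 := ((hasDerivAt_oneSubHat₁ hr.ae_mem hθ).const_mul (-c : ℂ)).add
    (hasDerivAt_trig_dcoef h.summable_diffCoef θ)
  refine (h1.congr_of_eventuallyEq ?_).deriv
  filter_upwards [isOpen_exp_mul_I_ne_one.mem_nhds hθ] with x hx
  exact h.hatDeriv_eq_of_ne hr hx

lemma contDiffAt_hat [IsFiniteMeasure μ] [IsFiniteMeasure σ] (h : IsPerturbation μ σ c)
    (hr : IsRepresentedBy μ m) {θ : ℝ} (hθ : Complex.exp (θ * Complex.I) ≠ 1) :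
    ContDiffAt ℝ 2 (hat σ) θ := by
  have := hr.finite
  have h1 : ContDiffAt ℝ 2 (fun θ => (c : ℂ) * (1 - oneSubHat m θ) + trig (diffCoef μ σ c) θ) θ :=
    (contDiffAt_const.mul (contDiffAt_const.sub (contDiffAt_oneSubHat hr.ae_mem hθ))).add
      (contDiff_trig h.summable_diffCoef).contDiffAt
  refine h1.congr_of_eventuallyEq ?_
  filter_upwards [isOpen_exp_mul_I_ne_one.mem_nhds hθ] with x hx
  rw [hat_eq (μ := μ) (c := c), hr.hat_eq_one_sub hx]

lemma exists_upper_bounds [IsProbabilityMeasure μ] [IsProbabilityMeasure σ]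
    (h : IsPerturbation μ σ c) (hr : IsRepresentedBy μ m) :
    ∃ C : ℝ, 0 < C ∧ ∀ θ ∈ Set.Ioc 0 Real.pi,
      ‖1 - hat σ θ‖ ≤ C * majorant m θ ∧ θ * ‖hatDeriv σ θ‖ ≤ C * majorant m θ ∧
      θ ^ 2 * ‖deriv (deriv (hat σ)) θ‖ ≤ C * majorant m θ := by
  have := hr.finite
  have hc := h.c_pos
  have hπ := Real.pi_pos
  set A := ∑' n : ℤ, (n : ℝ) ^ 2 * ‖diffCoef μ σ c n‖ with hA
  have hA0 : 0 ≤ A := tsum_nonneg fun n => by positivity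
  set a := m.real Set.univ / (1 + Real.pi) with ha
  have ha0 : 0 < a := by have := hr.pos; positivity
  -- `1552` is the largest of the constants `8`, `80`, `1552` for the function and its two
  -- derivatives; `A / a` converts `A θ²` into a multiple of the majorant.
  refine ⟨1552 * c + A / a, by positivity, fun θ hθ => ?_⟩
  have h0 := hθ.1
  have hne := exp_mul_I_ne_one ⟨h0, by linarith [hθ.2]⟩
  have hsq := sq_le_majorant hr.ae_mem hθ
  rw [← ha] at hsq
  have hM0 : 0 ≤ majorant m θ := (by positivity : 0 ≤ a * θ ^ 2).trans hsq
  have hAθ : A * θ ^ 2 ≤ A / a * majorant m θ := by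
    calc A * θ ^ 2 = A / a * (a * θ ^ 2) := by field_simp
      _ ≤ _ := by gcongr
  have hcM : 0 ≤ c * majorant m θ := by positivity
  have hs := h.summable_diffCoef
  have hz := h.trig_dcoef_diffCoef_zero
  have hcn : ‖(-c : ℂ)‖ = c := by rw [norm_neg, Complex.norm_real, Real.norm_of_nonneg hc.le]
  have hcn' : ‖(c : ℂ)‖ = c := by rw [Complex.norm_real, Real.norm_of_nonneg hc.le]
  refine ⟨?_, ?_, ?_⟩
  · rw [one_sub_hat (μ := μ) (c := c)]
    have h1 := hr.norm_one_sub_hat_le h0 hθ.2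
    rw [← majorant_of_pos h0] at h1
    have h2 := norm_trig_sub_le hs hz h0.le
    calc _ ≤ c * ‖1 - hat μ θ‖ + ‖trig (diffCoef μ σ c) θ - trig (diffCoef μ σ c) 0‖ := by
          refine (norm_sub_le _ _).trans_eq ?_
          rw [norm_mul, hcn']
      _ ≤ c * (8 * majorant m θ) + A * θ ^ 2 := by gcongr
      _ ≤ _ := by linarith
  · rw [h.hatDeriv_eq_of_ne hr hne]
    have h1 := norm_oneSubHat₁_le hr.ae_mem hθ
    have h2 := norm_trig_dcoef_le hs hz h0.le
    calc _ ≤ θ * (c * ‖oneSubHat₁ m θ‖ + ‖trig (dcoef (diffCoef μ σ c)) θ‖) := by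
          gcongr
          refine (norm_add_le _ _).trans_eq ?_
          rw [norm_mul, hcn]
      _ = c * (θ * ‖oneSubHat₁ m θ‖) + θ * ‖trig (dcoef (diffCoef μ σ c)) θ‖ := by ring
      _ ≤ c * (80 * majorant m θ) + θ * (A * θ) := by gcongr
      _ ≤ _ := by linarith
  · rw [h.deriv_deriv_hat hr hne]
    have h1 := norm_oneSubHat₂_le hr.ae_mem hθ
    have h2 := norm_trig_dcoef_dcoef_le hs θ
    calc _ ≤ θ ^ 2 * (c * ‖oneSubHat₂ m θ‖ + ‖trig (dcoef (dcoef (diffCoef μ σ c))) θ‖) := by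
          gcongr
          refine (norm_add_le _ _).trans_eq ?_
          rw [norm_mul, hcn]
      _ = c * (θ ^ 2 * ‖oneSubHat₂ m θ‖) +
          θ ^ 2 * ‖trig (dcoef (dcoef (diffCoef μ σ c))) θ‖ := by ring
      _ ≤ c * (1552 * majorant m θ) + θ ^ 2 * A := by gcongr
      _ ≤ _ := by linarith

lemma hasSecondMoment_right (h : IsPerturbation μ σ c) (hμ : HasSecondMoment μ) :
    HasSecondMoment σ := by
  refine Summable.of_nonneg_of_le (fun n => mul_nonneg (sq_nonneg _) (mass_nonneg σ n))
    (fun n => ?_) ((hμ.mul_left c).add h.summable)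
  have h1 : mass σ n ≤ c * mass μ n + |mass σ n - c * mass μ n| := by
    linarith [le_abs_self (mass σ n - c * mass μ n)]
  calc _ ≤ (n : ℝ) ^ 2 * (c * mass μ n + |mass σ n - c * mass μ n|) := by gcongr
    _ = _ := by ring

end IsPerturbation

lemma summable_int_of_support {f : ℤ → ℝ} (hsupp : ∀ n < -1, f n = 0)
    (hf : Summable fun n : ℕ => f n) : Summable f := by
  refine Summable.of_nat_of_neg_add_one hf ?_
  refine summable_of_ne_finset_zero (s := {0}) fun n hn => hsupp _ ?_
  have : n ≠ 0 := by simpa using hn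
  omega

/-- The real part of `1 - hat σ` is bounded below quadratically near the origin. -/
lemma exists_sq_le_re_one_sub_hat (σ : Measure ℤ) [IsProbabilityMeasure σ]
    (h : StrictlyAperiodic σ) :
    ∃ b δ : ℝ, 0 < b ∧ 0 < δ ∧ ∀ θ ∈ Set.Ioc 0 δ, b * θ ^ 2 ≤ (1 - hat σ θ).re := by
  obtain ⟨n, hn, hσn⟩ : ∃ n : ℤ, n ≠ 0 ∧ 0 < mass σ n := by
    by_contra! hcon
    have h1 : σ = Measure.dirac 0 := eq_dirac_zero_of_mass σ fun n hn =>
      le_antisymm (hcon n hn) (mass_nonneg σ n)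
    have h2 := h Real.pi ⟨Real.pi_pos, by linarith [Real.pi_pos]⟩
    rw [hat_eq_integral, h1, integral_dirac] at h2
    simp at h2
  have hn1 : 0 < |(n : ℝ)| := abs_pos.2 (by exact_mod_cast hn)
  -- In `∑ σ(k)(1 - cos kθ)` all terms are nonnegative, so one charged `n ≠ 0` suffices, as long as
  -- `|n| θ ≤ π`.
  refine ⟨mass σ n * ((n : ℝ) ^ 2 / 5), Real.pi / |(n : ℝ)|, ?_, by positivity, fun θ hθ => ?_⟩
  · have : (n : ℝ) ≠ 0 := by exact_mod_cast hn
    positivity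
  have h0 := hθ.1
  have hre : ∀ k : ℤ, ((mass σ k : ℂ) * Complex.exp (((k : ℝ) * θ : ℝ) * Complex.I)).re =
      mass σ k * Real.cos ((k : ℝ) * θ) := fun k => by
    rw [Complex.re_ofReal_mul, Complex.exp_ofReal_mul_I_re]
  have hsum := summable_trig (summable_norm_mass σ) θ
  have hs1 : HasSum (fun k : ℤ => mass σ k * Real.cos ((k : ℝ) * θ)) (hat σ θ).re := by
    have : HasSum _ (hat σ θ).re := Complex.hasSum_re hsum.hasSum
    simpa only [hre] using this
  have hs2 : HasSum (mass σ) 1 := by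
    rw [← tsum_mass σ]; exact (summable_mass σ).hasSum
  have hs3 := hs2.sub hs1
  have h1 := le_hasSum hs3 n fun k _ => by
    have := mass_nonneg σ k
    nlinarith [Real.cos_le_one ((k : ℝ) * θ)]
  simp only [Complex.sub_re, Complex.one_re]
  refine le_trans ?_ h1
  have h2 : |(n : ℝ)| * θ ≤ Real.pi := by
    have := hθ.2
    rw [le_div_iff₀ hn1] at this
    linarith
  have h3 := (one_sub_cos_bounds (θ := |(n : ℝ)| * θ) (by positivity) h2).1
  have h4 : Real.cos (|(n : ℝ)| * θ) = Real.cos ((n : ℝ) * θ) := by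
    rw [← Real.cos_abs ((n : ℝ) * θ), abs_mul, abs_of_pos h0]
  rw [h4, mul_pow, sq_abs] at h3
  calc _ = mass σ n * ((n : ℝ) ^ 2 * θ ^ 2 / 5) := by ring
    _ ≤ mass σ n * (1 - Real.cos ((n : ℝ) * θ)) := by gcongr
    _ = _ := by ring

lemma exists_sq_bound_of_hasSecondMoment (μ : Measure ℤ) [IsProbabilityMeasure μ]
    (hcent : Centered μ) (h : HasSecondMoment μ) :
    ∃ A : ℝ, 0 ≤ A ∧ ∀ θ, 0 ≤ θ → ‖1 - hat μ θ‖ ≤ A * θ ^ 2 := by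
  have hs : Summable fun n : ℤ => (n : ℝ) ^ 2 * ‖(mass μ n : ℂ)‖ := by
    have h' : Summable fun n : ℤ => (n : ℝ) ^ 2 * mass μ n := h
    simpa [abs_of_nonneg (mass_nonneg μ _)] using h'
  refine ⟨∑' n : ℤ, (n : ℝ) ^ 2 * ‖(mass μ n : ℂ)‖, tsum_nonneg fun n => by positivity,
    fun θ hθ => ?_⟩
  have h1 := norm_trig_sub_le hs (hatDeriv_zero hcent) hθ
  rw [← hat_eq_trig, hat_zero, norm_sub_rev] at h1
  exact h1

/-! ### Lower bounds for the perturbed measure and membership in both classes -/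

section MainEstimates

variable {μ : Measure ℤ} {m : Measure ℝ}

lemma stieltjesRe_le_stieltjesInt [IsFiniteMeasure m] (hm : ∀ᵐ t ∂m, t ∈ Set.Ico (0 : ℝ) 1)
    {x : ℝ} (hx : 0 < x) : stieltjesRe m x ≤ stieltjesInt m 0 x := by
  refine integral_mono_ae (integrable_stieltjesRe hm hx) (integrable_stieltjes hm 0 hx) ?_
  filter_upwards [hm] with t ht
  have h1 : 0 < 1 - t + x := by linarith [ht.2]
  simp only [zero_add, pow_one]
  rw [div_le_div_iff₀ (by positivity) h1]
  nlinarith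

/-- `R(θ) → ∞` as `θ → 0` when the second moment is infinite: otherwise `R(θ) < T` at some `θ ≤ 1/(n
+ 1)` for every `n`, and `∑_{k ≤ n+1} k² μ(k) ≤ 18 S(θ) ≤ 18 R(θ)` would bound the second moment. -/
lemma IsRepresentedBy.exists_le_stieltjesInt (h : IsRepresentedBy μ m)
    (hsupp : ∀ n : ℤ, n < -1 → mass μ n = 0) (h2 : ¬ HasSecondMoment μ) (T : ℝ) :
    ∃ δ : ℝ, 0 < δ ∧ ∀ θ ∈ Set.Ioc 0 δ, T ≤ stieltjesInt m 0 θ := by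
  have := h.finite
  by_contra! hcon
  apply h2
  refine summable_int_of_support (fun n hn => by rw [hsupp n hn, mul_zero]) ?_
  rw [← summable_nat_add_iff 1]
  refine summable_of_sum_range_le (c := 18 * T)
    (fun n => mul_nonneg (sq_nonneg _) (mass_nonneg μ _)) fun n => ?_
  have hn : (0 : ℝ) < (n : ℝ) + 1 := by positivity
  obtain ⟨θ, hθ, hlt⟩ := hcon (1 / ((n : ℝ) + 1)) (by positivity)
  have h3 := h.sum_sq_mul_mass_le (n := n + 1) (by omega) hθ.1 (by
    push_cast
    refine hθ.2.trans ?_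
    gcongr
    norm_num)
  have h4 := stieltjesRe_le_stieltjesInt h.ae_mem hθ.1
  have h5 : ∑ i ∈ range n, (((i + 1 : ℕ) : ℤ) : ℝ) ^ 2 * mass μ ((i + 1 : ℕ) : ℤ) ≤
      ∑ k ∈ Finset.Icc 1 (n + 1), (k : ℝ) ^ 2 * mass μ (k : ℤ) := by
    have e : ∀ N : ℕ, ∑ i ∈ range N, (((i + 1 : ℕ) : ℤ) : ℝ) ^ 2 * mass μ ((i + 1 : ℕ) : ℤ) =
        ∑ k ∈ Finset.Icc 1 N, (k : ℝ) ^ 2 * mass μ (k : ℤ) := by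
      intro N
      induction N with
      | zero => simp
      | succ N ih =>
        rw [Finset.sum_Icc_succ_top (by omega), ← ih, Finset.sum_range_succ]
        push_cast; rfl
    rw [e]
    refine Finset.sum_le_sum_of_subset_of_nonneg (Finset.Icc_subset_Icc_right (by omega)) ?_
    exact fun k _ _ => mul_nonneg (sq_nonneg _) (mass_nonneg μ _)
  linarith

/-- If aperiodicity failed, `σ` would miss one of any two neighbouring naturals, and there `|σ - cμ|
= cμ`. As `μ` is nonincreasing on `ℕ`, the summable weighted difference would then control the whole
second moment of `μ`. -/
lemma IsPerturbation.strictlyAperiodic {σ : Measure ℤ} [IsProbabilityMeasure σ] {c : ℝ}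
    (h : IsPerturbation μ σ c) (hsupp : ∀ n : ℤ, n < -1 → mass μ n = 0)
    (hcm : CompletelyMonotone (fun n : ℕ => mass μ (n : ℤ))) (h2 : ¬ HasSecondMoment μ) :
    StrictlyAperiodic σ := by
  have hc := h.c_pos
  by_contra hap
  apply h2
  have hadj : ∀ n : ℕ, mass σ (n : ℤ) = 0 ∨ mass σ ((n + 1 : ℕ) : ℤ) = 0 := by
    intro n
    by_contra! hcon
    refine hap (strictlyAperiodic_of_adjacent σ (n := n)
      (lt_of_le_of_ne (mass_nonneg σ _) hcon.1.symm) ?_)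
    have := lt_of_le_of_ne (mass_nonneg σ _) hcon.2.symm
    exact_mod_cast this
  set d : ℕ → ℝ := fun n => |mass σ (n : ℤ) - c * mass μ (n : ℤ)| with hd
  have hs0 : Summable fun n : ℕ => (n : ℝ) ^ 2 * d n := by
    have := h.summable.comp_injective (Nat.cast_injective (R := ℤ))
    simpa [Function.comp_def, hd] using this
  have hs1 : Summable fun n : ℕ => ((n + 1 : ℕ) : ℝ) ^ 2 * d (n + 1) :=
    (summable_nat_add_iff 1).2 hs0
  refine summable_int_of_support (fun n hn => by rw [hsupp n hn, mul_zero]) ?_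
  rw [← summable_nat_add_iff 2]
  refine Summable.of_nonneg_of_le (fun n => mul_nonneg (sq_nonneg _) (mass_nonneg μ _))
    (fun n => ?_) (((hs1.mul_left 4).add ((summable_nat_add_iff 1).2 hs1)).mul_left (1 / c))
  have hmono : mass μ ((n + 2 : ℕ) : ℤ) ≤ mass μ ((n + 1 : ℕ) : ℤ) := by
    have := hcm 1 (n + 1)
    simp only [Function.iterate_one, diffOp] at this
    have e : n + 1 + 1 = n + 2 := by ring
    rw [e] at this
    linarith
  have hd1 : c * mass μ ((n + 2 : ℕ) : ℤ) ≤ d (n + 1) + d (n + 2) := by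
    have hp1 : 0 ≤ d (n + 1) := abs_nonneg _
    have hp2 : 0 ≤ d (n + 2) := abs_nonneg _
    rcases hadj (n + 1) with h0 | h0
    · have e : d (n + 1) = c * mass μ ((n + 1 : ℕ) : ℤ) := by
        simp only [hd]
        rw [h0, zero_sub, abs_neg, abs_of_nonneg (mul_nonneg hc.le (mass_nonneg μ _))]
      have := mul_le_mul_of_nonneg_left hmono hc.le
      linarith
    · have e : d (n + 2) = c * mass μ ((n + 2 : ℕ) : ℤ) := by
        simp only [hd]
        rw [show n + 2 = n + 1 + 1 by ring, h0, zero_sub, abs_neg,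
          abs_of_nonneg (mul_nonneg hc.le (mass_nonneg μ _))]
      linarith
  rw [one_div, ← div_eq_inv_mul, le_div_iff₀ hc]
  have hp1 : 0 ≤ d (n + 1) := abs_nonneg _
  calc (((n + 2 : ℕ) : ℤ) : ℝ) ^ 2 * mass μ ((n + 2 : ℕ) : ℤ) * c
      = ((n : ℝ) + 2) ^ 2 * (c * mass μ ((n + 2 : ℕ) : ℤ)) := by push_cast; ring
    _ ≤ ((n : ℝ) + 2) ^ 2 * (d (n + 1) + d (n + 2)) := by gcongr
    _ ≤ 4 * (((n + 1 : ℕ) : ℝ) ^ 2 * d (n + 1)) + ((n + 1 + 1 : ℕ) : ℝ) ^ 2 * d (n + 1 + 1) := by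
        push_cast
        rw [mul_add]
        have e : ((n : ℝ) + 2) ^ 2 ≤ 4 * ((n : ℝ) + 1) ^ 2 := by
          nlinarith [(Nat.cast_nonneg n : (0 : ℝ) ≤ n)]
        have e2 : ((n : ℝ) + 2) ^ 2 * d (n + 1) ≤ 4 * ((n : ℝ) + 1) ^ 2 * d (n + 1) := by gcongr
        have e3 : ((n : ℝ) + 1 + 1) ^ 2 * d (n + 1 + 1) = ((n : ℝ) + 2) ^ 2 * d (n + 2) := by
          rw [show (n : ℝ) + 1 + 1 = n + 2 by ring]
        rw [e3]
        linarith

/-- With a second moment, `ψ = O(θ²)` near `0` and the quadratic lower bound valid for any strictly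
aperiodic `σ` is enough. Without one, `Re (1 - hat μ) ≥ ψ/K` and the `O(θ²)` perturbation is
negligible because `R → ∞`. -/
lemma IsPerturbation.exists_majorant_le_re {σ : Measure ℤ} [IsProbabilityMeasure μ]
    [IsProbabilityMeasure σ] {c : ℝ} (h : IsPerturbation μ σ c) (hr : IsRepresentedBy μ m)
    (hC : Comparable m) (hsupp : ∀ n : ℤ, n < -1 → mass μ n = 0)
    (hap : StrictlyAperiodic σ) :
    ∃ b δ : ℝ, 0 < b ∧ 0 < δ ∧ ∀ θ ∈ Set.Ioc 0 δ, b * majorant m θ ≤ (1 - hat σ θ).re := by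
  have := hr.finite
  have hc := h.c_pos
  obtain ⟨K, δ, hK, hδ, hδ1, hre⟩ := hr.norm_one_sub_hat_le_re hC
  have hK0 : 0 < K := by linarith
  by_cases h2 : HasSecondMoment μ
  · obtain ⟨b, δ', hb, hδ', hlow⟩ := exists_sq_le_re_one_sub_hat σ hap
    obtain ⟨A, hA, hup⟩ := exists_sq_bound_of_hasSecondMoment μ h.centered' h2
    refine ⟨b / (K * (A + 1)), min δ δ', by positivity, by positivity, fun θ hθ => ?_⟩
    have h0 := hθ.1
    have h3 := (hre θ ⟨h0, hθ.2.trans (min_le_left _ _)⟩).1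
    rw [← majorant_of_pos h0] at h3
    have h4 := hup θ h0.le
    have h5 := Complex.re_le_norm (1 - hat μ θ)
    have h6 : majorant m θ ≤ K * (A + 1) * θ ^ 2 := by
      calc _ ≤ K * (1 - hat μ θ).re := h3
        _ ≤ K * ((A + 1) * θ ^ 2) := by
          gcongr
          nlinarith [sq_nonneg θ]
        _ = _ := by ring
    refine le_trans ?_ (hlow θ ⟨h0, hθ.2.trans (min_le_right _ _)⟩)
    calc _ ≤ b / (K * (A + 1)) * (K * (A + 1) * θ ^ 2) := by gcongr
      _ = _ := by field_simp
  · set A := ∑' n : ℤ, (n : ℝ) ^ 2 * ‖diffCoef μ σ c n‖ with hA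
    have hA0 : 0 ≤ A := tsum_nonneg fun n => by positivity
    -- The threshold makes the perturbation `A θ²` at most half of the main term `(c/K) ψ`.
    obtain ⟨δ', hδ', hT⟩ := hr.exists_le_stieltjesInt hsupp h2 (2 * A * K / c)
    refine ⟨c / (2 * K), min δ δ', by positivity, by positivity, fun θ hθ => ?_⟩
    have h0 := hθ.1
    have h3 := (hre θ ⟨h0, hθ.2.trans (min_le_left _ _)⟩).1
    have h4 := hT θ ⟨h0, hθ.2.trans (min_le_right _ _)⟩
    have h5 := norm_trig_sub_le h.summable_diffCoef h.trig_dcoef_diffCoef_zero h0.le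
    have h6 := (Complex.re_le_norm _).trans h5
    have h7 : (1 - hat σ θ).re = c * (1 - hat μ θ).re -
        (trig (diffCoef μ σ c) θ - trig (diffCoef μ σ c) 0).re := by
      rw [one_sub_hat (μ := μ) (c := c), Complex.sub_re, Complex.re_ofReal_mul]
    rw [h7]
    have h8 : A * θ ^ 2 ≤ c / (2 * K) * majorant m θ := by
      rw [majorant_of_pos h0]
      calc A * θ ^ 2 = c / (2 * K) * (θ ^ 2 * (2 * A * K / c)) := by field_simp
        _ ≤ _ := by gcongr
    have h9 : c / K * majorant m θ ≤ c * (1 - hat μ θ).re := by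
      rw [majorant_of_pos h0]
      calc _ ≤ c / K * (K * (1 - hat μ θ).re) := by gcongr
        _ = _ := by field_simp
    have e : c / K = c / (2 * K) + c / (2 * K) := by field_simp; norm_num
    rw [e, add_mul] at h9
    linarith

lemma IsPerturbation.exists_isMajorant {σ : Measure ℤ} [IsProbabilityMeasure μ]
    [IsProbabilityMeasure σ] {c : ℝ} (h : IsPerturbation μ σ c) (hr : IsRepresentedBy μ m)
    (hC : Comparable m) (hsupp : ∀ n : ℤ, n < -1 → mass μ n = 0)
    (hap : StrictlyAperiodic σ) :
    ∃ c' C : ℝ, IsMajorant (hat σ) (hatDeriv σ) (majorant m) c' C ∧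
      ∀ θ ∈ Set.Ioc 0 Real.pi, θ ^ 2 * ‖deriv (deriv (hat σ)) θ‖ ≤ C * majorant m θ := by
  have := hr.finite
  have hπ := Real.pi_pos
  obtain ⟨C, hC0, hup⟩ := h.exists_upper_bounds hr
  obtain ⟨b, δ, hb, hδ, hlow⟩ := h.exists_majorant_le_re hr hC hsupp hap
  -- With `ε = b/C`, `|1 - f|² ≤ (b/C)(C ψ) = b ψ ≤ Re (1 - f)`, as `norm_le_of_sq_norm_one_sub_le`
  -- requires.
  obtain ⟨δ', hδ', hsmall⟩ := exists_mul_norm_one_sub_hat_le σ (ε := b / C) (by positivity)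
  obtain ⟨η, hη, hfar⟩ := exists_norm_hat_le σ hap (δ := min δ (δ' / 2)) (by positivity)
  have hpos : ∀ θ ∈ Set.Ioc 0 Real.pi, 0 < majorant m θ := fun θ hθ => by
    refine lt_of_lt_of_le ?_ (sq_le_majorant hr.ae_mem hθ)
    have h1 := hr.pos
    have h2 := hθ.1
    positivity
  have hp := hpos Real.pi ⟨hπ, le_rfl⟩
  -- `b/2` serves near the origin. Away from it `ψ(θ) ≤ ψ(π)`, so `η/ψ(π)` suffices.
  refine ⟨min (b / 2) (η / majorant m Real.pi), C, ⟨by positivity, hC0,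
    (continuous_majorant hr.ae_mem).continuousOn, majorant_zero, hpos,
    fun x hx y _ hxy => majorant_mul_le hr.ae_mem hx.1 hxy, fun θ hθ => ?_,
    fun θ hθ => (hup θ hθ).1, fun θ hθ => (hup θ hθ).2.1⟩, fun θ hθ => (hup θ hθ).2.2⟩
  have hψ := hpos θ hθ
  rcases le_total θ (min δ (δ' / 2)) with hle | hle
  · have h1 := hlow θ ⟨hθ.1, hle.trans (min_le_left _ _)⟩
    have h2 := hsmall θ (by
      rw [abs_of_pos hθ.1]
      linarith [hle.trans (min_le_right _ _)])
    have h3 := (hup θ hθ).1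
    have h4 : ‖1 - hat σ θ‖ ^ 2 ≤ (1 - hat σ θ).re := by
      calc _ = ‖1 - hat σ θ‖ * ‖1 - hat σ θ‖ := by ring
        _ ≤ b / C * (C * majorant m θ) := by gcongr
        _ = b * majorant m θ := by field_simp
        _ ≤ _ := h1
    have h5 := norm_le_of_sq_norm_one_sub_le h4
    have h6 : min (b / 2) (η / majorant m Real.pi) * majorant m θ ≤ b / 2 * majorant m θ :=
      mul_le_mul_of_nonneg_right (min_le_left _ _) hψ.le
    linarith
  · have h1 := hfar θ ⟨hle, hθ.2⟩
    have h2 : majorant m θ ≤ majorant m Real.pi := by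
      have h3 := majorant_mul_le hr.ae_mem hθ.1 hθ.2
      have h4 : majorant m Real.pi * θ ≤ majorant m Real.pi * Real.pi := by
        have := hθ.2
        gcongr
      exact le_of_mul_le_mul_right (h3.trans h4) hπ
    have h3 : min (b / 2) (η / majorant m Real.pi) * majorant m θ ≤ η := by
      calc _ ≤ η / majorant m Real.pi * majorant m Real.pi :=
            mul_le_mul (min_le_right _ _) h2 hψ.le (by positivity)
        _ = η := by field_simp
    linarith

lemma IsPerturbation.mem_hypHSet {σ : ProbabilityMeasure ℤ} [IsProbabilityMeasure μ] {c c' C : ℝ}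
    (h : IsPerturbation μ σ c) (hr : IsRepresentedBy μ m)
    (hM : IsMajorant (hat σ) (hatDeriv σ) (majorant m) c' C)
    (hM2 : ∀ θ ∈ Set.Ioc 0 Real.pi, θ ^ 2 * ‖deriv (deriv (hat σ)) θ‖ ≤ C * majorant m θ) :
    σ ∈ hypHSet := by
  have := hr.finite
  refine ⟨fun θ hθ => h.contDiffAt_hat hr (exp_mul_I_ne_one_of_mem_puncturedInterval hθ),
    majorant m, fun θ _ => majorant_neg θ, (continuous_majorant hr.ae_mem).continuousOn,
    majorant_zero, (contDiffOn_majorant hr.ae_mem).mono fun θ hθ => hθ.2,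
    c', C, hM.c_pos, hM.C_pos, fun θ hθ => ?_⟩
  have h0 := hθ.1
  have hC := hM.C_pos
  have h1 := hM.norm_deriv_le θ hθ
  have h2 := majorant_le_mul_derivWithin hr.ae_mem hθ
  have h3 := hM2 θ hθ
  have hn : ∀ z : ℂ, ‖(θ : ℂ) * z‖ = θ * ‖z‖ := fun z => by
    rw [norm_mul, Complex.norm_real, Real.norm_of_nonneg h0.le]
  have h4 : C * majorant m θ ≤ θ * (C * derivWithin (majorant m) puncturedInterval θ) := by
    calc _ ≤ C * (θ * derivWithin (majorant m) puncturedInterval θ) := by gcongr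
      _ = _ := by ring
  rw [hn, hn]
  refine ⟨hM.norm_le θ hθ, ?_, ?_, ?_⟩
  · rw [h.deriv_hat]; exact h1
  · rw [h.deriv_hat]; exact le_of_mul_le_mul_left (h1.trans h4) h0
  · refine le_of_mul_le_mul_left (le_trans (le_of_eq ?_) (h3.trans h4)) h0
    ring

end MainEstimates

end

end IntProb

/-! ### The theorem -/

theorem theorem1p5 (μ : MeasureTheory.ProbabilityMeasure ℤ)
    (hcent : IntProb.Centered μ)
    (hsupp : ∀ n : ℤ, n < -1 → IntProb.mass μ n = 0)
    (hcm : IntProb.CompletelyMonotone (fun n : ℕ => IntProb.mass μ (n : ℤ)))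
    (hne : (μ : MeasureTheory.Measure ℤ) ≠ MeasureTheory.Measure.dirac 0) :
    (IntProb.BAR μ ↔
      ∃ C : ℝ, 0 < C ∧ ∀ n : ℕ, 1 ≤ n →
        (n : ℝ) * ∑' k : Set.Ici n, ((k : ℕ) : ℝ) * IntProb.mass μ ((k : ℕ) : ℤ) ≤
          C * ∑ k ∈ Finset.Icc 1 n, (k : ℝ) ^ 2 * IntProb.mass μ (k : ℤ)) ∧
    (IntProb.BAR μ →
      (∀ σ : MeasureTheory.ProbabilityMeasure ℤ,
        IntProb.Centered σ →
        (IntProb.HasSecondMoment σ → IntProb.StrictlyAperiodic σ) →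
        (∃ c : ℝ, 0 < c ∧
          Summable (fun n : ℤ => (n : ℝ) ^ 2 * |IntProb.mass σ n - c * IntProb.mass μ n|)) →
        σ ∈ IntProb.hypHSet ∩ IntProb.rittSet) ∧
      μ ∈ IntProb.hypHSet ∩ IntProb.rittSet) := by
  obtain ⟨m, hr⟩ := IntProb.exists_isRepresentedBy (μ : Measure ℤ) hcent hsupp hcm hne
  have hap := hr.strictlyAperiodic hcm
  refine ⟨⟨fun hB => hr.tailCondition_of_comparable (hr.comparable_of_bar hB),
    fun hC => hr.bar_of_comparable hap (hr.comparable_of_tailCondition hC)⟩, fun hB => ?_⟩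
  have hC := hr.comparable_of_bar hB
  have key : ∀ σ : MeasureTheory.ProbabilityMeasure ℤ, IntProb.Centered σ →
      (IntProb.HasSecondMoment σ → IntProb.StrictlyAperiodic σ) →
      (∃ c : ℝ, 0 < c ∧
        Summable (fun n : ℤ => (n : ℝ) ^ 2 * |IntProb.mass σ n - c * IntProb.mass μ n|)) →
      σ ∈ IntProb.hypHSet ∩ IntProb.rittSet := by
    rintro σ hσ hσap ⟨c, hc, hsum⟩
    have hp : IntProb.IsPerturbation (μ : Measure ℤ) (σ : Measure ℤ) c := ⟨hc, hσ, hcent, hsum⟩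
    have hap' : IntProb.StrictlyAperiodic (σ : Measure ℤ) := by
      -- A second moment of `μ` passes to `σ`, where aperiodicity is assumed; without one it is
      -- automatic.
      by_cases h2 : IntProb.HasSecondMoment (μ : Measure ℤ)
      · exact hσap (hp.hasSecondMoment_right h2)
      · exact hp.strictlyAperiodic hsupp hcm h2
    obtain ⟨c', C, hM, hM2⟩ := hp.exists_isMajorant hr hC hsupp hap'
    exact ⟨hp.mem_hypHSet hr hM hM2, hM.mem_rittSet hσ⟩
  -- The measure `μ` is its own perturbation with `c = 1`.
  refine ⟨key, key μ hcent (fun _ => hap) ⟨1, one_pos, ?_⟩⟩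
  simp
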